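/- Let $G$ be a finite group and $K\le G$ a subgroup. The local operators of the bulk form the quantum double $D(G)$, with basis $D^{(h,g)}$ ($h,g\in G$) and product $D^{(h_1,g_1)}D^{(h_2,g_2)}=\delta_{h_1,\,g_1h_2g_1^{-1}}D^{(h_1,g_1g_2)}$. The local operators of the boundary form the algebra $Z=Z(G,1,K,1)$, with basis $Z^{(hK,k)}$ ($hK\in G/K$, $k\in K$) and product $Z^{(h_1K,k_1)}Z^{(h_2K,k_2)}=\delta_{h_1K,\,k_1h_2K}Z^{(h_1K,k_1k_2)}$, embedded in $D(G)$ by $Z^{(hK,k)}\mapsto\sum_{j\in hK}D^{(j,k)}$. Let $F^{(h,g)}$ and $Y^{(hK,k)}$ be the dual bases of the spaces of ribbon operators $D(G)^*$ and $Z^*$. A bulk elementary excitation is a pair $(C,\pi)$: $C$ is a conjugacy class of $G$, with a chosen element $r_C\in C$, and $\pi$ is (the class of) an irreducible complex representation of the centralizer $E(C)$ of $r_C$, given by matrices $\Gamma_\pi$. Choose representatives $p_i$ of $G/E(C)$, put $c_i=p_ir_Cp_i^{-1}$, and for $\mathbf u=(i,j)$, $\mathbf v=(i',j')$ let $$F^{(C,\pi);(\mathbf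 u,\mathbf v)}=\frac{\dim\pi}{|E(C)|}\sum_{k\in E(C)}\big(\Gamma_\pi^{-1}(k)\big)_{jj'}F^{(c_i^{-1},\,p_ikp_{i'}^{-1})}.$$ A boundary elementary excitation is a pair $(T,R)$: $T=Kr_TK$ is a double coset with a chosen representative $r_T$, and $R$ is an irreducible complex representation of $K^{r_T}=K\cap r_TKr_T^{-1}$, given by matrices $\Gamma_R$. Choose representatives $q_i$ of $K/(K\cap r_T^{-1}Kr_T)$, put $s_i=q_ir_Tq_i^{-1}$, and let $$Y^{(T,R);(\mathbf u,\mathbf v)}=\frac{\dim R}{|K^{r_T}|}\sum_{k\in K^{r_T}}\big(\Gamma_R^{-1}(k)\big)_{jj'}Y^{(s_i^{-1}K,\,q_i\,r_T^{-1}kr_T\,q_{i'}^{-1})}.$$ The quantum dimensions are $\mathrm{FPdim}(C,\pi)=|C|\dim\pi$ and $\mathrm{FPdim}(T,R)=\frac{|K|}{|K^{r_T}|}\dim R$. Also write $(C,\pi)$ for the irreducible $D(G)$-module of the functions $f:G\to V_\pi$ with $f(ye)=\pi(e)^{-1}f(y)$ for $e\in E(C)$, where $(D^{(h,g)}f)(y)=\delta_{h,\,yr_Cy^{-1}}f(g^{-1}y)$,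 and $(T,R)$ for the irreducible $Z$-module of the functions $f:K\to V_R$ with $f(ys)=R(s)^{-1}f(y)$ for $s\in K^{r_T}$, where $(Z^{(hK,k)}f)(y)=\delta_{hK,\,yr_TK}f(k^{-1}y)$. For $x\in G$ let $x\triangleright\pi$ be the representation of $xE(C)x^{-1}$ in which $y$ acts as $\pi(x^{-1}yx)$, and let $n_\sigma^{x\triangleright\pi}$ and $n_\sigma^R$ be the multiplicities of an irreducible representation $\sigma$ of $xE(C)x^{-1}\cap K^{r_T}$ in the restrictions of $x\triangleright\pi$ and of $R$ to this group. **Theorem.** Let $(T,R)$ be a boundary excitation. 1. The operators $F^{(C,\pi);(\mathbf u,\mathbf v)}$ are linearly independent, and, under the expansion $Y^{(hK,k)}=\frac1{|K|}\sum_{j\in hK}F^{(j,k)}$, every $Y^{(T,R);(\mathbf u_2,\mathbf v_2)}$ is a linear combination of them. On a dual triangle $\tau$ with edge $e$, where $F^{(h,g)}_\tau=\delta_{1,g}L^h(e)$ and $Y^{(hK,k)}_\tau=\delta_{1,k}\frac1{|K|}\sum_{j\in hK}L^j(e)$, with $L^g$ the operator $L^g_+|x\rangle=|gx\rangle$ or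 $L^g_-|x\rangle=|xg^{-1}\rangle$ on $\mathbb C[G]$ according to the orientation of $e$, the same coefficients express $Y_\tau^{(T,R);(\mathbf u_2,\mathbf v_2)}$ through the $F_\tau^{(C,\pi);(\mathbf u_1,\mathbf v_1)}$. For a bulk excitation $(C,\pi)$, the coefficient of $F^{(C,\pi);(\mathbf u_1,\mathbf v_1)}$ in $Y^{(T,R);(\mathbf u_2,\mathbf v_2)}$ is nonzero for some $(\mathbf u_1,\mathbf v_1,\mathbf u_2,\mathbf v_2)$ if and only if (1) $C\cap T\neq\emptyset$, and (2) there are $x\in G$ with $xr_Cx^{-1}\in r_TK$ and an irreducible representation $\sigma$ of $xE(C)x^{-1}\cap K^{r_T}$ with $n_\sigma^{x\triangleright\pi}\ne0$ and $n_\sigma^R\neq0$. 2. Pulling $(T,R)$ into the bulk, that is, inducing it from $Z$ to $D(G)$, gives $D(G)\otimes_Z(T,R)\cong\bigoplus_{(C,\pi)}n^{(T,R)}_{(C,\pi)}\,(C,\pi)$, where $n^{(T,R)}_{(C,\pi)}=\dim\mathrm{Hom}_{D(G)}\big((C,\pi),\,D(G)\otimes_Z(T,R)\big)$. These multiplicities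 equal those of condensation, $n^{(T,R)}_{(C,\pi)}=n^{(C,\pi)}_{(T,R)}$, where $n^{(C,\pi)}_{(T,R)}$ is the multiplicity of $(T,R)$ in the restriction of $(C,\pi)$ to $Z$. Moreover $$n^{(T,R)}_{(C,\pi)}=\sum_{\substack{x\in X(C)\\ xr_Cx^{-1}\in T}}\ \sum_{\sigma}n_\sigma^R\,n_\sigma^{x\triangleright\pi},$$ where $\sigma$ runs over the irreducible representations of $xE(C)x^{-1}\cap K^{r_T}$ and $X(C)$ is any set of representatives of $K\backslash G/E(C)$ in which each $x$ with $xr_Cx^{-1}\in T$ is chosen such that $xr_Cx^{-1}\in r_TK$. 3. There are finitely many bulk excitations, and $\sum_{(C,\pi)}n^{(T,R)}_{(C,\pi)}\,\mathrm{FPdim}(C,\pi)=|G|\,\mathrm{FPdim}(T,R)$. -/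

import Mathlib

open scoped TensorProduct DirectSum

noncomputable section

namespace KitaevBoundary

universe u v w

/-! ### Algebras of local operators -/

/-- For a finite group `H` acting on a set `X` through `φ`, the algebra `F[X] ⋊ ℂ[H]`. An element
`a` is the linear combination `∑ a x h • e (x, h)`, and the product is
`e (x, h) * e (y, k) = δ_{x, h • y} e (x, h k)`. -/
def ActionAlgebra {H : Type u} {X : Type v} [Group H] (_φ : H →* Equiv.Perm X) :
    Type (max u v) :=
  X → H → ℂ

namespace ActionAlgebra

variable {H : Type u} {X : Type v} [Group H] (φ : H →* Equiv.Perm X)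

instance : AddCommGroup (ActionAlgebra φ) := inferInstanceAs (AddCommGroup (X → H → ℂ))

instance : Module ℂ (ActionAlgebra φ) := inferInstanceAs (Module ℂ (X → H → ℂ))

variable {φ}

/-- The coefficient of `a` at the basis vector `e (x, h)`. -/
def coeff (a : ActionAlgebra φ) (x : X) (h : H) : ℂ := a x h

theorem ext_coeff {a b : ActionAlgebra φ} (hab : ∀ x h, a.coeff x h = b.coeff x h) : a = b :=
  funext fun x => funext fun h => hab x h

@[simp] theorem coeff_add (a b : ActionAlgebra φ) (x : X) (h : H) :
    (a + b).coeff x h = a.coeff x h + b.coeff x h := rfl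

@[simp] theorem coeff_zero (x : X) (h : H) : (0 : ActionAlgebra φ).coeff x h = 0 := rfl

@[simp] theorem coeff_smul (c : ℂ) (a : ActionAlgebra φ) (x : X) (h : H) :
    (c • a).coeff x h = c * a.coeff x h := rfl

variable (φ) in
/-- The element with given coefficients. -/
def ofCoeff (a : X → H → ℂ) : ActionAlgebra φ := a

@[simp] theorem coeff_ofCoeff (a : X → H → ℂ) (x : X) (h : H) : (ofCoeff φ a).coeff x h = a x h :=
  rfl

instance : One (ActionAlgebra φ) :=
  ⟨open Classical in fun _ h => if h = 1 then 1 else 0⟩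

open Classical in
theorem coeff_one (x : X) (h : H) :
    (1 : ActionAlgebra φ).coeff x h = if h = 1 then 1 else 0 := rfl

variable [Finite H]

instance : Mul (ActionAlgebra φ) :=
  ⟨fun a b x h => letI := Fintype.ofFinite H
    ∑ k : H, a x k * b ((φ k)⁻¹ x) (k⁻¹ * h)⟩

theorem coeff_mul [Fintype H] (a b : ActionAlgebra φ) (x : X) (h : H) :
    (a * b).coeff x h = ∑ k : H, a.coeff x k * b.coeff ((φ k)⁻¹ x) (k⁻¹ * h) := by
  rename_i _ inst
  rw [Subsingleton.elim inst (Fintype.ofFinite H)]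
  rfl

instance : Ring (ActionAlgebra φ) :=
  { (inferInstance : AddCommGroup (ActionAlgebra φ)),
    (inferInstance : Mul (ActionAlgebra φ)),
    (inferInstance : One (ActionAlgebra φ)) with
    left_distrib := fun a b c => by
      let _ := Fintype.ofFinite H
      refine ext_coeff fun x h => ?_
      simp [coeff_mul, mul_add, Finset.sum_add_distrib]
    right_distrib := fun a b c => by
      let _ := Fintype.ofFinite H
      refine ext_coeff fun x h => ?_
      simp [coeff_mul, add_mul, Finset.sum_add_distrib]
    zero_mul := fun a => by
      let _ := Fintype.ofFinite H
      refine ext_coeff fun x h => ?_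
      simp [coeff_mul]
    mul_zero := fun a => by
      let _ := Fintype.ofFinite H
      refine ext_coeff fun x h => ?_
      simp [coeff_mul]
    one_mul := fun a => by
      classical
      let _ := Fintype.ofFinite H
      refine ext_coeff fun x h => ?_
      simp only [coeff_mul, coeff_one, ite_mul, one_mul, zero_mul, Finset.sum_ite_eq',
        Finset.mem_univ, if_true, map_one, inv_one, Equiv.Perm.coe_one, id_eq]
    mul_one := fun a => by
      classical
      let _ := Fintype.ofFinite H
      refine ext_coeff fun x h => ?_
      simp [coeff_mul, coeff_one, inv_mul_eq_one]
    mul_assoc := fun a b c => by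
      let _ := Fintype.ofFinite H
      refine ext_coeff fun x h => ?_
      simp only [coeff_mul, Finset.sum_mul, Finset.mul_sum]
      rw [Finset.sum_comm]
      refine Finset.sum_congr rfl fun l _ => ?_
      refine Fintype.sum_equiv (Equiv.mulLeft l⁻¹) _ _ fun k => ?_
      simp [mul_assoc, map_mul] }

instance : Algebra ℂ (ActionAlgebra φ) :=
  Algebra.ofModule
    (fun c a b => by
      let _ := Fintype.ofFinite H
      refine ext_coeff fun x h => ?_
      simp [coeff_mul, Finset.mul_sum, mul_assoc])
    (fun c a b => by
      let _ := Fintype.ofFinite H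
      refine ext_coeff fun x h => ?_
      simp only [coeff_mul, Finset.mul_sum, coeff_smul]
      exact Finset.sum_congr rfl fun k _ => by ring)

end ActionAlgebra

/-! ### Modules attached to a point and a representation of its stabilizer -/

section StabModule

variable {H : Type u} {X : Type v} [Group H] (φ : H →* Equiv.Perm X) (x₀ : X)
  {S : Type w} [Group S] (σ : S →* H) (hσ : ∀ s, φ (σ s) x₀ = x₀)
  {V : Type*} [AddCommGroup V] [Module ℂ V] (ρ : Representation ℂ S V)

/-- The space of functions `f : H → V` with `f (h s) = ρ(s)⁻¹ f(h)` for `s` in the stabilizer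
`S` of `x₀`. The vectors supported on the coset `h S` sit at the point `h • x₀` of the orbit. -/
def StabModule (_hσ : ∀ s, φ (σ s) x₀ = x₀) : Type _ :=
  ({ carrier := {f | ∀ h s, f (h * σ s) = ρ s⁻¹ (f h)}
     add_mem' := fun {f g} hf hg h s => by simp [hf h s, hg h s]
     zero_mem' := fun h s => by simp
     smul_mem' := fun c f hf h s => by simp [hf h s] } : Submodule ℂ (H → V))

namespace StabModule

instance : AddCommGroup (StabModule φ x₀ σ ρ hσ) :=
  inferInstanceAs (AddCommGroup (Submodule.mk _ _ : Submodule ℂ (H → V)))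

instance : Module ℂ (StabModule φ x₀ σ ρ hσ) :=
  inferInstanceAs (Module ℂ (Submodule.mk _ _ : Submodule ℂ (H → V)))

variable {φ x₀ σ ρ hσ}

/-- The value of an element of `StabModule` at `h`. -/
def val (f : StabModule φ x₀ σ ρ hσ) (h : H) : V := f.1 h

theorem val_mul (f : StabModule φ x₀ σ ρ hσ) (h : H) (s : S) :
    f.val (h * σ s) = ρ s⁻¹ (f.val h) := f.2 h s

theorem ext_val {f g : StabModule φ x₀ σ ρ hσ} (hfg : ∀ h, f.val h = g.val h) : f = g :=
  Subtype.ext (funext hfg)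

@[simp] theorem val_add (f g : StabModule φ x₀ σ ρ hσ) (h : H) :
    (f + g).val h = f.val h + g.val h := rfl

@[simp] theorem val_zero (h : H) : (0 : StabModule φ x₀ σ ρ hσ).val h = 0 := rfl

@[simp] theorem val_csmul (c : ℂ) (f : StabModule φ x₀ σ ρ hσ) (h : H) :
    (c • f).val h = c • f.val h := rfl

variable [Finite H]

/-- The basis vector `e (x, k)` first translates by `k` and then projects to the point `x`:
`(e (x, k) • f) (h) = δ_{h • x₀, x} f (k⁻¹ h)`. -/
instance : SMul (ActionAlgebra φ) (StabModule φ x₀ σ ρ hσ) :=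
  ⟨fun a f => letI := Fintype.ofFinite H
    ⟨fun h => ∑ k : H, a.coeff (φ h x₀) k • f.val (k⁻¹ * h), fun h s => by
      simp [map_mul, hσ s, ← mul_assoc, val_mul]⟩⟩

theorem val_smul [Fintype H] (a : ActionAlgebra φ) (f : StabModule φ x₀ σ ρ hσ) (h : H) :
    (a • f).val h = ∑ k : H, a.coeff (φ h x₀) k • f.val (k⁻¹ * h) := by
  rename_i _ inst
  rw [Subsingleton.elim inst (Fintype.ofFinite H)]
  rfl

instance : Module (ActionAlgebra φ) (StabModule φ x₀ σ ρ hσ) where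
  one_smul f := by
    classical
    let _ := Fintype.ofFinite H
    refine ext_val fun h => ?_
    simp [val_smul, ActionAlgebra.coeff_one]
  mul_smul a b f := by
    let _ := Fintype.ofFinite H
    refine ext_val fun h => ?_
    simp only [val_smul, ActionAlgebra.coeff_mul, Finset.sum_smul, Finset.smul_sum]
    rw [Finset.sum_comm]
    refine Finset.sum_congr rfl fun l _ => ?_
    refine Fintype.sum_equiv (Equiv.mulLeft l⁻¹) _ _ fun k => ?_
    simp [mul_assoc, map_mul, mul_smul]
  smul_zero a := by
    let _ := Fintype.ofFinite H
    refine ext_val fun h => ?_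
    simp [val_smul]
  smul_add a f g := by
    let _ := Fintype.ofFinite H
    refine ext_val fun h => ?_
    simp [val_smul, Finset.sum_add_distrib]
  add_smul a b f := by
    let _ := Fintype.ofFinite H
    refine ext_val fun h => ?_
    simp [val_smul, Finset.sum_add_distrib, add_smul]
  zero_smul f := by
    let _ := Fintype.ofFinite H
    refine ext_val fun h => ?_
    simp [val_smul]

instance : IsScalarTower ℂ (ActionAlgebra φ) (StabModule φ x₀ σ ρ hσ) :=
  ⟨fun c a f => by
    let _ := Fintype.ofFinite H
    refine ext_val fun h => ?_
    simp [val_smul, Finset.smul_sum, mul_smul]⟩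

instance : SMulCommClass (ActionAlgebra φ) ℂ (StabModule φ x₀ σ ρ hσ) :=
  ⟨fun a c f => by
    let _ := Fintype.ofFinite H
    refine ext_val fun h => ?_
    simp only [val_smul, val_csmul, Finset.smul_sum]
    exact Finset.sum_congr rfl fun k _ => smul_comm _ _ _⟩

end StabModule

end StabModule

/-! ### Irreducible representations in matrix form -/

/-- An irreducible complex representation together with a basis. -/
structure MatIrrep (H : Type u) [Group H] : Type u where
  dim : ℕ
  rep : Representation ℂ H (Fin dim → ℂ)
  irreducible : rep.IsIrreducible

/-- The matrix `Γ(k)`. -/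
def MatIrrep.mat {H : Type u} [Group H] (π : MatIrrep H) (k : H) :
    Matrix (Fin π.dim) (Fin π.dim) ℂ :=
  LinearMap.toMatrix' (π.rep k)

instance MatIrrep.setoid (H : Type u) [Group H] : Setoid (MatIrrep H) where
  r π π' := Nonempty (π.rep.Equiv π'.rep)
  iseqv :=
    { refl := fun π => ⟨.refl π.rep⟩
      symm := fun ⟨e⟩ => ⟨e.symm⟩
      trans := fun ⟨e⟩ ⟨f⟩ => ⟨e.trans f⟩ }

/-- The set of isomorphism classes of irreducible complex representations of `H`. -/
def Irr (H : Type u) [Group H] : Type u := Quotient (MatIrrep.setoid H)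

/-- The multiplicity of the irreducible representation `σ` in `ρ`. -/
def repMult {H : Type u} [Group H] (σ : MatIrrep H) {V : Type*} [AddCommGroup V] [Module ℂ V]
    (ρ : Representation ℂ H V) : ℕ :=
  Module.finrank ℂ (Representation.IntertwiningMap σ.rep ρ)

variable {G : Type u} [Group G]

/-- The conjugate subgroup `x H x⁻¹`. -/
def conjSubgroup (x : G) (H : Subgroup G) : Subgroup G :=
  H.comap (MulAut.conj x⁻¹).toMonoidHom

theorem mem_conjSubgroup {x : G} {H : Subgroup G} {y : G} :
    y ∈ conjSubgroup x H ↔ x⁻¹ * y * x ∈ H := by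
  simp [conjSubgroup]

/-- The centralizer `E(C)`, for a chosen element `r` of the conjugacy class `C`. -/
abbrev centralizerOf (r : G) : Subgroup G := Subgroup.centralizer {r}

/-- The stabilizer `K^r = K ∩ r K r⁻¹` of the coset `r K` under left translation by `K`. -/
abbrev stab (K : Subgroup G) (r : G) : Subgroup G := K ⊓ conjSubgroup r K

/-! ### The bulk: the quantum double and its elementary excitations -/

/-- The quantum double `D(G) = F[G] ⊗ ℂ[G]`, with basis `D^{(h,g)} = B^h A^g` and product
`D^{(h₁,g₁)} D^{(h₂,g₂)} = δ_{h₁, g₁ h₂ g₁⁻¹} D^{(h₁, g₁ g₂)}`. -/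
abbrev QuantumDouble (G : Type u) [Group G] : Type u :=
  ActionAlgebra ((MulAut.toPerm (M := G)).comp MulAut.conj)

/-- The choices that go into the labelling of bulk excitations: an element `r C` in every conjugacy
class `C`, representatives `p C i` of the cosets `i ∈ G / E(C)`, and a representation in matrix
form in every isomorphism class of irreducible representations of `E(C)`. -/
structure BulkChoice (G : Type u) [Group G] where
  r : ConjClasses G → G
  mk_r : ∀ C, ConjClasses.mk (r C) = C
  p : ∀ C, G ⧸ centralizerOf (r C) → G
  mk_p : ∀ C i, (p C i : G ⧸ centralizerOf (r C)) = i
  irrep : ∀ C, Irr (centralizerOf (r C)) → MatIrrep (centralizerOf (r C))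
  mk_irrep : ∀ C π, (Quotient.mk _ (irrep C π) : Irr (centralizerOf (r C))) = π

/-- The types of elementary bulk excitations: pairs `(C, π)`. -/
abbrev BulkAnyon (β : BulkChoice G) : Type u :=
  Σ C : ConjClasses G, Irr (centralizerOf (β.r C))

namespace BulkAnyon

variable {β : BulkChoice G} (a : BulkAnyon β)

/-- The chosen element `r_C` of the conjugacy class `C` of the excitation `(C, π)`. -/
abbrev pt : G := β.r a.1

/-- The representation `π` of the excitation `(C, π)`. -/
abbrev irrep : MatIrrep (centralizerOf a.pt) := β.irrep a.1 a.2

/-- The quantum dimension `|C| dim π` of the excitation `(C, π)`. -/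
def FPdim : ℚ := (Nat.card a.1.carrier : ℚ) * a.irrep.dim

theorem pt_fixed (s : centralizerOf a.pt) :
    ((MulAut.toPerm (M := G)).comp MulAut.conj) ((centralizerOf a.pt).subtype s) a.pt = a.pt := by
  have hs := Subgroup.mem_centralizer_singleton_iff.mp s.2
  change (s : G) * a.pt * (s : G)⁻¹ = a.pt
  rw [hs]
  group

/-- The irreducible `D(G)`-module `(C, π)`. -/
abbrev Mod : Type _ :=
  StabModule ((MulAut.toPerm (M := G)).comp MulAut.conj) a.pt (centralizerOf a.pt).subtype
    a.irrep.rep a.pt_fixed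

/-- The set of local degrees of freedom `(i, j)` of the excitation `(C, π)`. -/
abbrev Loc : Type _ := (G ⧸ centralizerOf a.pt) × Fin a.irrep.dim

end BulkAnyon

/-! ### The boundary: its local operators and its elementary excitations -/

/-- The algebra `Z(G,1,K,1) = F[G/K] ⊗ ℂ[K]`, with basis `Z^{(hK,k)} = B^{hK} A^k` and product
`Z^{(h₁K,k₁)} Z^{(h₂K,k₂)} = δ_{h₁K, k₁h₂K} Z^{(h₁K,k₁k₂)}`. -/
abbrev BoundaryAlgebra (K : Subgroup G) : Type u :=
  ActionAlgebra (MulAction.toPermHom K (G ⧸ K))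

/-- The choices that go into a boundary excitation `(T, R)`: a representative `r` of the double
coset `T = K r K`, an irreducible representation `R` of `K^r` in matrix form, and representatives
`q` of the cosets of `r⁻¹ K^r r = K ∩ r⁻¹ K r` in `K`. -/
structure BoundaryAnyon (K : Subgroup G) where
  r : G
  irrep : MatIrrep (stab K r)
  q : K ⧸ (stab K r⁻¹).subgroupOf K → K
  mk_q : ∀ i, (q i : K ⧸ (stab K r⁻¹).subgroupOf K) = i

namespace BoundaryAnyon

variable {K : Subgroup G} (b : BoundaryAnyon K)

/-- The double coset `T = K r K`. -/
def T : Set G := DoubleCoset.doubleCoset b.r (K : Set G) (K : Set G)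

/-- The quantum dimension `|K| / |K^r| * dim R` of the excitation `(T, R)`. -/
def FPdim : ℚ := (Nat.card K : ℚ) / Nat.card (stab K b.r) * b.irrep.dim

theorem pt_fixed (s : stab K b.r) :
    MulAction.toPermHom K (G ⧸ K) (Subgroup.inclusion inf_le_left s) (b.r : G ⧸ K) =
      (b.r : G ⧸ K) := by
  have hs : b.r⁻¹ * (s : G) * b.r ∈ K := mem_conjSubgroup.mp s.2.2
  change (((s : G) * b.r : G) : G ⧸ K) = (b.r : G ⧸ K)
  rw [eq_comm, QuotientGroup.eq, ← mul_assoc]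
  exact hs

/-- The irreducible `Z(G,1,K,1)`-module `(T, R)`. -/
abbrev Mod : Type _ :=
  StabModule (MulAction.toPermHom K (G ⧸ K)) (b.r : G ⧸ K)
    (Subgroup.inclusion (inf_le_left : stab K b.r ≤ K)) b.irrep.rep b.pt_fixed

/-- The set of local degrees of freedom `(i, j)` of the excitation `(T, R)`. -/
abbrev Loc : Type _ := (K ⧸ (stab K b.r⁻¹).subgroupOf K) × Fin b.irrep.dim

end BoundaryAnyon

/-! ### Condensation and inverse condensation -/

section Condensation

variable [Finite G]

open Classical in
/-- The inclusion `Z(G,1,K,1) → D(G)`, which sends `Z^{(hK,k)}` to `∑_{j ∈ hK} D^{(j,k)}`. -/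
def incl (K : Subgroup G) : BoundaryAlgebra K →ₐ[ℂ] QuantumDouble G :=
  AlgHom.ofLinearMap
    { toFun := fun z => ActionAlgebra.ofCoeff _ fun h g =>
        if hg : g ∈ K then z.coeff (h : G ⧸ K) ⟨g, hg⟩ else 0
      map_add' := fun z w => by
        refine ActionAlgebra.ext_coeff fun h g => ?_
        by_cases hg : g ∈ K <;> simp [hg]
      map_smul' := fun c z => by
        refine ActionAlgebra.ext_coeff fun h g => ?_
        by_cases hg : g ∈ K <;> simp [hg] }
    (by
      refine ActionAlgebra.ext_coeff fun h g => ?_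
      by_cases hg : g ∈ K
      · simp [hg, ActionAlgebra.coeff_one, Subtype.ext_iff]
      · have hne : g ≠ 1 := fun h1 => hg (h1 ▸ K.one_mem)
        simp [hg, hne, ActionAlgebra.coeff_one])
    (by
      intro z w
      let _ := Fintype.ofFinite G
      let _ := Fintype.ofFinite K
      refine ActionAlgebra.ext_coeff fun h g => ?_
      change (if hg : g ∈ K then (z * w).coeff (h : G ⧸ K) ⟨g, hg⟩ else 0) = _
      rw [ActionAlgebra.coeff_mul]
      simp only [LinearMap.coe_mk, AddHom.coe_mk, ActionAlgebra.coeff_ofCoeff]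
      by_cases hg : g ∈ K
      · rw [dif_pos hg, ActionAlgebra.coeff_mul]
        refine Fintype.sum_of_injective (Subtype.val : K → G) Subtype.val_injective _ _ ?_ ?_
        · intro l hl
          have hlK : l ∉ K := fun hlK => hl ⟨⟨l, hlK⟩, rfl⟩
          simp [hlK]
        · intro k
          have hkg : (k : G)⁻¹ * g ∈ K := K.mul_mem (K.inv_mem k.2) hg
          rw [dif_pos k.2, dif_pos hkg]
          congr 2
          change (((k⁻¹ : K) : G) * h : G) = (((k : G)⁻¹ * h * k : G) : G ⧸ K)
          rw [QuotientGroup.eq]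
          simp [mul_assoc]
      · rw [dif_neg hg]
        refine (Finset.sum_eq_zero fun k _ => ?_).symm
        by_cases hk : k ∈ K
        · have : k⁻¹ * g ∉ K := fun hkg => hg (by simpa using K.mul_mem hk hkg)
          simp [this]
        · simp [hk])

/-- The `D(G)`-module `D(G) ⊗_Z M` induced from a module `M` over `Z = Z(G,1,K,1)`, as the quotient
of `D(G) ⊗_ℂ M` by the relations `d z ⊗ m = d ⊗ z m`. -/
abbrev Induced (K : Subgroup G) (M : Type*) [AddCommGroup M] [Module ℂ M]
    [Module (BoundaryAlgebra K) M] : Type _ :=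
  (QuantumDouble G ⊗[ℂ] M) ⧸ Submodule.span (QuantumDouble G)
    {t : QuantumDouble G ⊗[ℂ] M | ∃ (d : QuantumDouble G) (z : BoundaryAlgebra K) (m : M),
      t = (d * incl K z) ⊗ₜ[ℂ] m - d ⊗ₜ[ℂ] (z • m)}

variable {β : BulkChoice G} {K : Subgroup G}

/-- The multiplicity `n_{(C,π)}^{(T,R)}` of `(C, π)` in the `D(G)`-module induced from `(T, R)`. -/
def inverseMult (b : BoundaryAnyon K) (a : BulkAnyon β) : ℕ :=
  Module.finrank ℂ (a.Mod →ₗ[QuantumDouble G] Induced K b.Mod)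

/-- The multiplicity `n^{(C,π)}_{(T,R)}` of `(T, R)` in the restriction of the `D(G)`-module
`(C, π)` to `Z(G,1,K,1)`: the dimension of the space of linear maps `f : (T, R) → (C, π)` such
that `f (z • m) = incl z • f m`. -/
def condensationMult (a : BulkAnyon β) (b : BoundaryAnyon K) : ℕ :=
  Module.finrank ℂ (b.Mod →ₛₗ[(incl K).toRingHom] a.Mod)

/-! #### The condensation coefficients -/

variable (β K) in
/-- The intersection `x E(C) x⁻¹ ∩ K^r`. -/
abbrev interStab (C : ConjClasses G) (r x : G) : Subgroup G :=
  conjSubgroup x (centralizerOf (β.r C)) ⊓ stab K r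

/-- The restriction to `x E(C) x⁻¹ ∩ K^r` of the representation `x ▷ π` of `x E(C) x⁻¹`, in which
`y` acts as `x⁻¹ y x` does in `π`. -/
def twistRes (a : BulkAnyon β) (r x : G) :
    Representation ℂ (interStab β K a.1 r x) (Fin a.irrep.dim → ℂ) :=
  a.irrep.rep.comp
    { toFun := fun y => ⟨x⁻¹ * (y : G) * x, mem_conjSubgroup.mp y.2.1⟩
      map_one' := by ext; simp
      map_mul' := fun y z => by ext; simp [mul_assoc] }

/-- The restriction of `R` to `x E(C) x⁻¹ ∩ K^r`. -/
def boundaryRes (b : BoundaryAnyon K) (C : ConjClasses G) (x : G) :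
    Representation ℂ (interStab β K C b.r x) (Fin b.irrep.dim → ℂ) :=
  b.irrep.rep.comp (Subgroup.inclusion inf_le_right)

/-- The multiplicity `n_σ^{x ▷ π}`. -/
def twistMult (a : BulkAnyon β) (b : BoundaryAnyon K) (x : G)
    (σ : Irr (interStab β K a.1 b.r x)) : ℕ :=
  repMult (Quotient.out σ) (twistRes a b.r x)

/-- The multiplicity `n_σ^R`. -/
def boundaryMult (a : BulkAnyon β) (b : BoundaryAnyon K) (x : G)
    (σ : Irr (interStab β K a.1 b.r x)) : ℕ :=
  repMult (Quotient.out σ) (boundaryRes b a.1 x)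

/-- The group element `x` carries the chosen element `r_C` of `C` into the left coset `r K` of the
chosen representative `r` of `T`. -/
def Aligned (a : BulkAnyon β) (b : BoundaryAnyon K) (x : G) : Prop :=
  b.r⁻¹ * (x * a.pt * x⁻¹) ∈ K

/-- A set `X(C)` of representatives of the double cosets `K \ G / E(C)`, in which every `x` with
`x r_C x⁻¹ ∈ T` is chosen such that `x r_C x⁻¹ ∈ r K`. -/
structure DoubleCosetReps (a : BulkAnyon β) (b : BoundaryAnyon K) where
  x : DoubleCoset.Quotient (K : Set G) (centralizerOf a.pt : Set G) → G
  mk_x : ∀ d, DoubleCoset.mk K (centralizerOf a.pt) (x d) = d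
  aligned : ∀ d, x d * a.pt * (x d)⁻¹ ∈ b.T → Aligned a b (x d)

open Classical in
/-- The sum of `n_σ^R n_σ^{x ▷ π}` over the `x ∈ X(C)` with `x r_C x⁻¹ ∈ T` and over the
irreducible representations `σ` of `x E(C) x⁻¹ ∩ K^r`. -/
def condensationSum {a : BulkAnyon β} {b : BoundaryAnyon K} (X : DoubleCosetReps a b) : ℕ :=
  ∑ᶠ d, if X.x d * a.pt * (X.x d)⁻¹ ∈ b.T then
    ∑ᶠ σ, boundaryMult a b (X.x d) σ * twistMult a b (X.x d) σ else 0

/-- The two conditions for `(C, π)` and `(T, R)` to condense into one another: `C` and `T`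
intersect, and for some `x` with `x r_C x⁻¹ ∈ r K` the restrictions of `x ▷ π` and of `R` to
`x E(C) x⁻¹ ∩ K^r` have a common irreducible constituent. -/
def Compatible (a : BulkAnyon β) (b : BoundaryAnyon K) : Prop :=
  (a.1.carrier ∩ b.T).Nonempty ∧
    ∃ x, Aligned a b x ∧ ∃ σ, twistMult a b x σ ≠ 0 ∧ boundaryMult a b x σ ≠ 0

end Condensation

/-! ### Ribbon operators -/

section Ribbon

variable {β : BulkChoice G} {K : Subgroup G} {M : Type*} [AddCommGroup M] [Module ℂ M]

open Classical in
/-- The Fourier transform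
`F^{(C,π);(u,v)} = dim π / |E(C)| * ∑_{k ∈ E(C)} Γ_π⁻¹(k)_{jj'} F^{(c_i⁻¹, p_i k p_{i'}⁻¹)}`, with
`c_i = p_i r_C p_i⁻¹`, `u = (i, j)` and `v = (i', j')`, of a family `F^{(h,g)}`. -/
def bulkFourier [Finite G] (F : G → G → M) (a : BulkAnyon β) (u v : a.Loc) : M :=
  letI := Fintype.ofFinite (centralizerOf a.pt)
  ((a.irrep.dim : ℂ) / Nat.card (centralizerOf a.pt)) •
    ∑ k : centralizerOf a.pt, a.irrep.mat k⁻¹ u.2 v.2 •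
      F (β.p a.1 u.1 * a.pt * (β.p a.1 u.1)⁻¹)⁻¹ (β.p a.1 u.1 * k * (β.p a.1 v.1)⁻¹)

/-- The element `r⁻¹ k r` of `K`, for `k ∈ K^r`. -/
def BoundaryAnyon.shift (b : BoundaryAnyon K) (k : stab K b.r) : K :=
  ⟨b.r⁻¹ * (k : G) * b.r, mem_conjSubgroup.mp k.2.2⟩

/-- The Fourier transform
`Y^{(T,R);(u,v)} = dim R / |K^r| * ∑_{k ∈ K^r} Γ_R⁻¹(k)_{jj'} Y^{(s_i⁻¹ K, q_i r⁻¹ k r q_{i'}⁻¹)}`,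
with `s_i = q_i r q_i⁻¹`, `u = (i, j)` and `v = (i', j')`, of a family `Y^{(hK,k)}`. -/
def boundaryFourier [Finite G] (Y : G ⧸ K → K → M) (b : BoundaryAnyon K) (u v : b.Loc) : M :=
  letI := Fintype.ofFinite (stab K b.r)
  ((b.irrep.dim : ℂ) / Nat.card (stab K b.r)) •
    ∑ k : stab K b.r, b.irrep.mat k⁻¹ u.2 v.2 •
      Y (((b.q u.1 : G) * b.r * (b.q u.1 : G)⁻¹)⁻¹ : G) (b.q u.1 * b.shift k * (b.q v.1)⁻¹)

/-- The space of bulk ribbon operators, the dual of `D(G)`. -/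
abbrev BulkRibbon (G : Type u) [Group G] : Type u := Module.Dual ℂ (QuantumDouble G)

/-- The space of boundary ribbon operators, the dual of `Z(G,1,K,1)`. -/
abbrev BoundaryRibbon (K : Subgroup G) : Type u := Module.Dual ℂ (BoundaryAlgebra K)

/-- The basis ribbon operator `F^{(h,g)}`, dual to `D^{(h,g)}`. -/
def ribbonF (h g : G) : BulkRibbon G where
  toFun d := d.coeff h g
  map_add' _ _ := rfl
  map_smul' _ _ := rfl

/-- The basis ribbon operator `Y^{(hK,k)}`, dual to `Z^{(hK,k)}`. -/
def ribbonY (x : G ⧸ K) (k : K) : BoundaryRibbon K where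
  toFun z := z.coeff x k
  map_add' _ _ := rfl
  map_smul' _ _ := rfl

variable [Finite G]

open Classical in
variable (K) in
/-- The linear map `D(G) → Z(G,1,K,1)` which sends `D^{(j,k)}` to `|K|⁻¹ Z^{(jK,k)}` if `k ∈ K` and
to `0` otherwise. -/
def average : QuantumDouble G →ₗ[ℂ] BoundaryAlgebra K :=
  letI := Fintype.ofFinite G
  { toFun := fun d => ActionAlgebra.ofCoeff _ fun x k =>
      (Nat.card K : ℂ)⁻¹ * ∑ j : G, if (j : G ⧸ K) = x then d.coeff j k else 0
    map_add' := fun d e => by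
      refine ActionAlgebra.ext_coeff fun x k => ?_
      simp only [ActionAlgebra.coeff_ofCoeff, ActionAlgebra.coeff_add, ← mul_add,
        ← Finset.sum_add_distrib]
      congr 1
      refine Finset.sum_congr rfl fun j _ => ?_
      split_ifs <;> simp
    map_smul' := fun c d => by
      refine ActionAlgebra.ext_coeff fun x k => ?_
      simp [Finset.mul_sum, mul_left_comm] }

variable (K) in
/-- The expansion `Y^{(hK,k)} = |K|⁻¹ ∑_{j ∈ hK} F^{(j,k)}` of boundary ribbon operators in bulk
ribbon operators. -/
def expand : BoundaryRibbon K →ₗ[ℂ] BulkRibbon G :=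
  Module.Dual.transpose (average K)

/-- The operator `L^g_+ |x⟩ = |g x⟩` or `L^g_- |x⟩ = |x g⁻¹⟩` on the Hilbert space `ℂ[G]` of an
edge, according to the orientation of the edge. -/
def edgeL (plus : Bool) (g : G) : Module.End ℂ (G →₀ ℂ) :=
  Finsupp.lmapDomain ℂ ℂ fun x => if plus then g * x else x * g⁻¹

open Classical in
/-- The bulk operator `F_τ^{(h,g)} = δ_{1,g} L^h(e)` on a dual triangle `τ` with edge `e`. -/
def triangleF (plus : Bool) (h g : G) : Module.End ℂ (G →₀ ℂ) :=
  if g = 1 then edgeL plus h else 0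

open Classical in
/-- The boundary operator `Y_τ^{(hK,k)} = δ_{1,k} |hK|⁻¹ ∑_{j ∈ hK} L^j(e)` on a dual triangle `τ`
with edge `e`. -/
def triangleY (plus : Bool) (x : G ⧸ K) (k : K) : Module.End ℂ (G →₀ ℂ) :=
  letI := Fintype.ofFinite G
  if k = 1 then (Nat.card K : ℂ)⁻¹ • ∑ j : G, if (j : G ⧸ K) = x then edgeL plus j else 0 else 0

variable (β) in
/-- The labels `(C, π); (u, v)`. -/
abbrev RibbonIndex : Type u := Σ a : BulkAnyon β, a.Loc × a.Loc

variable (β) in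
/-- The family of all `F^{(C,π);(u,v)}` obtained from a family `F^{(h,g)}`. -/
def bulkFamily (F : G → G → M) (t : RibbonIndex β) : M := bulkFourier F t.1 t.2.1 t.2.2

end Ribbon

end KitaevBoundary

end

noncomputable section

namespace KitaevBoundary

universe u v w

/-! ### Decomposition of semisimple modules over an algebraically closed field -/

section Decomposition

variable {k : Type*} [Field k] {A : Type*} [Ring A] [Algebra k A]

/-! Both algebras have the form `F[X] ⋊ ℂ[H]`: for D(G) the group G acts on itself by conjugation,
for Z the group K acts on G/K by translation. Averaging over the arrows of the action makes such an
algebra semisimple (`exists_isCompl_submodule`). Frobenius reciprocity (`homEquiv`) identifies maps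
out of a `StabModule` with stabilizer-equivariant maps out of its representation. Hence the modules
(C,π) are simple, pairwise non-isomorphic, and exhaust the simple D(G)-modules, so every
finite-dimensional D(G)-module V is the sum of the (C,π) with multiplicities dim Hom((C,π), V).

Multiplicities. By semisimplicity Hom((C,π), Ind) and Hom(Ind, (C,π)) have the same dimension, and
the universal property of the induced module turns the latter space into the Z-maps from (T,R) to
(C,π). Frobenius reciprocity along `incl` describes these as functions from G to Hom(V_R, V_π) that
live on the y with y r_C y⁻¹ ∈ r_T K and are equivariant under K^{r_T} on the left and E(C) on the
right. That set of y is a disjoint union of double cosets K^{r_T} x E(C), and the value at x can be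
any intertwiner over xE(C)x⁻¹ ∩ K^{r_T} (`mackeyEquiv`). Counting intertwiners by irreducible
constituents gives the formula. The dimension identity holds because D(G) is free of rank |G| as a
right Z-module (`finrank_induced`) and quantum dimensions are vector space dimensions.

Ribbon operators. Schur orthogonality provides elements `dualElt` dual to the F^{(C,π);(u,v)}, so a
coefficient is a value on such an element. For Y^{(T,R);(u,v)} this value is a sum over pairs (k,e)
∈ K^{r_T} × E(C) solving one equation; the solutions, if any, form a torsor under xE(C)x⁻¹ ∩ K^{r_T}
for x = r_T q⁻¹ p. The sum is therefore a combination of entries of averaged matrix units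
(`pairSum_eq_sum`), and these averages span the intertwiners from R to x ▷ π
(`exists_sum_mat_ne_zero_iff`). The triangle operators are images of the abstract ribbon operators
under one linear map (`ribbonLift`), so they obey the same expansion. -/

theorem finite_linearMap {M N : Type*} [AddCommGroup M] [Module k M] [Module A M]
    [IsScalarTower k A M] [AddCommGroup N] [Module k N] [Module A N] [IsScalarTower k A N]
    [SMulCommClass A k N] [Module.Finite k M] [Module.Finite k N] :
    Module.Finite k (M →ₗ[A] N) :=
  Module.Finite.of_injective (LinearMap.restrictScalarsₗ k A M N k)
    (LinearMap.restrictScalars_injective k)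

theorem finite_submodule {N : Type*} [AddCommGroup N] [Module k N] [Module A N]
    [IsScalarTower k A N] [Module.Finite k N] (S : Submodule A N) : Module.Finite k S :=
  Module.Finite.of_injective (S.subtype.restrictScalars k) S.subtype_injective

theorem exists_simple_of_not_injective {N : Type v} {V : Type*} [AddCommGroup N] [Module A N]
    [AddCommGroup V] [Module A V] [IsSemisimpleModule A N] (f : N →ₗ[A] V)
    (hf : ¬ Function.Injective f) :
    ∃ (S : Type v) (_ : AddCommGroup S) (_ : Module A S), IsSimpleModule A S ∧
      ∃ j : S →ₗ[A] N, Function.Injective j ∧ ∀ s, f (j s) = 0 := by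
  have : Nontrivial (LinearMap.ker f) :=
    Submodule.nontrivial_iff_ne_bot.mpr fun h => hf (LinearMap.ker_eq_bot.mp h)
  obtain ⟨S, hS⟩ := IsSemisimpleModule.exists_simple_submodule A (LinearMap.ker f)
  exact ⟨S, inferInstance, inferInstance, hS, (Submodule.subtype _).comp S.subtype,
    (Submodule.subtype_injective _).comp (Submodule.subtype_injective _), fun s => s.1.2⟩

variable {ι : Type*} (M : ι → Type*) [∀ a, AddCommGroup (M a)] [∀ a, Module k (M a)]
  [∀ a, Module A (M a)] [∀ a, IsScalarTower k A (M a)]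
  [∀ a, Module.Finite k (M a)]
  (V : Type*) [AddCommGroup V] [Module k V] [Module A V] [IsScalarTower k A V]
  [SMulCommClass A k V] [Module.Finite k V]

/-- The evaluation map `⨁ Hom(M a, V) ⊗ M a → V`, in terms of bases of the spaces
`Hom(M a, V)`. -/
def isotypicEval : (⨁ a, (Fin (Module.finrank k (M a →ₗ[A] V)) → M a)) →ₗ[A] V :=
  have := fun a => finite_linearMap (k := k) (A := A) (M := M a) (N := V)
  letI := Classical.decEq ι
  DirectSum.toModule A ι V fun a =>
    ∑ i, (Module.finBasis k (M a →ₗ[A] V) i).comp (LinearMap.proj i)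

variable {M V}

theorem isotypicEval_lof [DecidableEq ι] (a : ι)
    (x : Fin (Module.finrank k (M a →ₗ[A] V)) → M a) :
    have := fun a => finite_linearMap (k := k) (A := A) (M := M a) (N := V)
    isotypicEval (k := k) (A := A) M V (DirectSum.lof A ι _ a x) =
      ∑ i, (Module.finBasis k (M a →ₗ[A] V) i) (x i) := by
  obtain rfl := Subsingleton.elim ‹DecidableEq ι› (Classical.decEq ι)
  simp [isotypicEval]

/-- The simple submodules span V, and the inclusion of one, read as a map out of some `M a`, is a
combination of the chosen basis of `Hom(M a, V)`. -/
theorem isotypicEval_surjective [IsSemisimpleModule A V]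
    (hc : ∀ S : Submodule A V, IsSimpleModule A S → ∃ a, Nonempty (M a ≃ₗ[A] S)) :
    Function.Surjective (isotypicEval (k := k) (A := A) M V) := by
  classical
  have := fun a => finite_linearMap (k := k) (A := A) (M := M a) (N := V)
  rw [← LinearMap.range_eq_top, eq_top_iff, ← IsSemisimpleModule.sSup_simples_eq_top]
  refine sSup_le fun S hS => ?_
  obtain ⟨a, ⟨e⟩⟩ := hc S hS
  intro v hv
  set f : M a →ₗ[A] V := S.subtype.comp e.toLinearMap
  set B := Module.finBasis k (M a →ₗ[A] V)
  refine ⟨DirectSum.lof A ι _ a fun i => B.repr f i • e.symm ⟨v, hv⟩, ?_⟩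
  rw [isotypicEval_lof]
  have : v = f (e.symm ⟨v, hv⟩) := by simp [f]
  conv_rhs => rw [this, ← B.sum_repr f]
  simp only [LinearMap.sum_apply, LinearMap.smul_apply]
  refine Finset.sum_congr rfl fun i _ => ?_
  exact LinearMap.map_smul_of_tower (B i) (B.repr f i) _

variable [IsAlgClosed k] [∀ a, IsSimpleModule A (M a)]

/-- A nonzero kernel contains a simple module S. By Schur's lemma S projects nontrivially to only
one type `M a`, and its projections there are scalar multiples of one isomorphism. The vanishing of
the evaluation on S is then a linear relation among basis elements of `Hom(M a, V)`. -/
theorem isotypicEval_injective (hM : ∀ a b, Nonempty (M a ≃ₗ[A] M b) → a = b) :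
    Function.Injective (isotypicEval (k := k) (A := A) M V) := by
  classical
  have := fun a => finite_linearMap (k := k) (A := A) (M := M a) (N := V)
  have : IsSemisimpleModule A (⨁ a, (Fin (Module.finrank k (M a →ₗ[A] V)) → M a)) :=
    inferInstanceAs (IsSemisimpleModule A (Π₀ a, (Fin (Module.finrank k (M a →ₗ[A] V)) → M a)))
  by_contra hne
  obtain ⟨S, hS1, hS2, hS, j, hjinj, hj0⟩ := exists_simple_of_not_injective
    (isotypicEval (k := k) (A := A) M V) hne
  have : Nontrivial S := IsSimpleModule.nontrivial A S
  obtain ⟨s, hs⟩ := exists_ne (0 : S)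
  have hjs : j s ≠ 0 := fun h => hs (hjinj (by rw [h, map_zero]))
  obtain ⟨a, ha⟩ : ∃ a, (j s) a ≠ 0 := by
    by_contra! h
    exact hjs (DFinsupp.ext h)
  obtain ⟨i, hi⟩ : ∃ i, (j s) a i ≠ 0 := by
    by_contra! h
    exact ha (funext h)
  let pr : ∀ (b : ι) (l : Fin (Module.finrank k (M b →ₗ[A] V))), S →ₗ[A] M b := fun b l =>
    (LinearMap.proj l).comp ((DirectSum.component A ι _ b).comp j)
  have hpr : ∀ b l s, pr b l s = (j s) b l := fun b l s => rfl
  have hai : Function.Bijective (pr a i) :=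
    (LinearMap.bijective_or_eq_zero (pr a i)).resolve_right fun h => hi (by
      rw [← hpr, h]; rfl)
  let e : S ≃ₗ[A] M a := LinearEquiv.ofBijective (pr a i) hai
  have hother : ∀ b l, b ≠ a → pr b l = 0 := fun b l hb =>
    (LinearMap.bijective_or_eq_zero (pr b l)).resolve_left fun h =>
      hb (hM _ _ ⟨(LinearEquiv.ofBijective (pr b l) h).symm.trans e⟩)
  have hscal : ∀ l, ∃ c : k, ∀ s, pr a l s = c • e s := by
    intro l
    obtain ⟨c, hc⟩ := (IsSimpleModule.algebraMap_end_bijective_of_isAlgClosed (A := A)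
      (V := M a) k).2 ((pr a l).comp e.symm.toLinearMap)
    refine ⟨c, fun s => ?_⟩
    have := LinearMap.congr_fun hc (e s)
    simpa [Module.algebraMap_end_apply] using this.symm
  choose c hc using hscal
  -- The isomorphism `e` is the `i`-th projection itself, so the relation found below has a nonzero
  -- coefficient.
  have hci : c i = 1 := by
    have h1 := hc i s
    have h2 : pr a i s = e s := rfl
    rw [h2] at h1
    by_contra h
    have h3 : (c i - 1) • e s = 0 := by rw [sub_smul, one_smul, ← h1, sub_self]
    rcases smul_eq_zero.mp h3 with h4 | h4
    · exact h (sub_eq_zero.mp h4)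
    · exact hi h4
  have hsingle : ∀ s, j s = DirectSum.lof A ι _ a fun l => c l • e s := by
    intro s
    refine DFinsupp.ext fun b => ?_
    by_cases hb : b = a
    · subst hb
      rw [DirectSum.lof_apply]
      funext l
      exact hc l s
    · rw [DirectSum.lof_eq_of, DirectSum.of_eq_of_ne _ _ _ hb]
      funext l
      exact LinearMap.congr_fun (hother b l hb) s
  have hzero : ∑ l, c l • Module.finBasis k (M a →ₗ[A] V) l = 0 := by
    refine LinearMap.ext fun m => ?_
    obtain ⟨s, rfl⟩ := e.surjective m
    have := hj0 s
    rw [hsingle, isotypicEval_lof] at this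
    rw [LinearMap.zero_apply, ← this, LinearMap.sum_apply]
    exact Finset.sum_congr rfl fun l _ =>
      ((Module.finBasis k (M a →ₗ[A] V) l).map_smul_of_tower (c l) (e s)).symm
  have := Fintype.linearIndependent_iff.mp
    (Module.finBasis k (M a →ₗ[A] V)).linearIndependent c hzero i
  rw [hci] at this
  exact one_ne_zero this

/-- A semisimple module is the direct sum of the simple modules `M a`, each as often as the
dimension of `Hom(M a, V)` says. -/
def isotypicEquiv [IsSemisimpleModule A V] (hM : ∀ a b, Nonempty (M a ≃ₗ[A] M b) → a = b)
    (hc : ∀ S : Submodule A V, IsSimpleModule A S → ∃ a, Nonempty (M a ≃ₗ[A] S)) :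
    V ≃ₗ[A] ⨁ a, (Fin (Module.finrank k (M a →ₗ[A] V)) → M a) :=
  (LinearEquiv.ofBijective _
    ⟨isotypicEval_injective (k := k) hM, isotypicEval_surjective (k := k) hc⟩).symm

theorem finrank_eq_sum_isotypic [Fintype ι] [IsSemisimpleModule A V]
    (hM : ∀ a b, Nonempty (M a ≃ₗ[A] M b) → a = b)
    (hc : ∀ S : Submodule A V, IsSimpleModule A S → ∃ a, Nonempty (M a ≃ₗ[A] S)) :
    Module.finrank k V =
      ∑ a, Module.finrank k (M a →ₗ[A] V) * Module.finrank k (M a) := by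
  classical
  rw [((isotypicEquiv (k := k) hM hc).restrictScalars k).finrank_eq,
    Module.finrank_directSum]
  simp [Module.finrank_pi_fintype]

/-- Only V is decomposed: `Hom(⨁ (M a)^n, W)` is a product of copies of `Hom(M a, W)`, so W may be
any finite-dimensional module. -/
theorem finrank_hom_eq_sum_isotypic [Fintype ι] [IsSemisimpleModule A V]
    (hM : ∀ a b, Nonempty (M a ≃ₗ[A] M b) → a = b)
    (hc : ∀ S : Submodule A V, IsSimpleModule A S → ∃ a, Nonempty (M a ≃ₗ[A] S))
    (W : Type*) [AddCommGroup W] [Module k W] [Module A W] [IsScalarTower k A W]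
    [SMulCommClass A k W] [Module.Finite k W] :
    Module.finrank k (V →ₗ[A] W) =
      ∑ a, Module.finrank k (M a →ₗ[A] V) * Module.finrank k (M a →ₗ[A] W) := by
  classical
  have := fun a => finite_linearMap (k := k) (A := A) (M := M a) (N := W)
  have e1 : (V →ₗ[A] W) ≃ₗ[k] ((⨁ a, (Fin (Module.finrank k (M a →ₗ[A] V)) → M a)) →ₗ[A] W) :=
    { toFun := fun f => f.comp (isotypicEquiv (k := k) hM hc).symm.toLinearMap
      invFun := fun f => f.comp (isotypicEquiv (k := k) hM hc).toLinearMap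
      map_add' := fun f g => rfl
      map_smul' := fun c f => rfl
      left_inv := fun f => by ext; simp
      right_inv := fun f => by ext; simp }
  have e2 : ((⨁ a, (Fin (Module.finrank k (M a →ₗ[A] V)) → M a)) →ₗ[A] W) ≃ₗ[k]
      ∀ a, Fin (Module.finrank k (M a →ₗ[A] V)) → (M a →ₗ[A] W) :=
    (DFinsupp.lsum (R := A) k).symm.trans
      (LinearEquiv.piCongrRight fun a => (LinearMap.lsum A (fun _ => M a) k).symm)
  rw [(e1.trans e2).finrank_eq, Module.finrank_pi_fintype]
  simp [Module.finrank_pi_fintype]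

variable [∀ a, SMulCommClass A k (M a)]

theorem finrank_hom_simple [DecidableEq ι] (hM : ∀ a b, Nonempty (M a ≃ₗ[A] M b) → a = b)
    (a b : ι) : Module.finrank k (M a →ₗ[A] M b) = if a = b then 1 else 0 := by
  split_ifs with h
  · subst h
    exact (LinearEquiv.ofBijective (Algebra.linearMap k (Module.End A (M a)))
      (IsSimpleModule.algebraMap_end_bijective_of_isAlgClosed k)).finrank_eq.symm.trans
        (Module.finrank_self k)
  · have : Subsingleton (M a →ₗ[A] M b) := by
      refine subsingleton_of_forall_eq 0 fun f => ?_
      exact (LinearMap.bijective_or_eq_zero f).resolve_left fun hf =>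
        h (hM _ _ ⟨LinearEquiv.ofBijective f hf⟩)
    exact Module.finrank_zero_of_subsingleton

/-- Both dimensions are the multiplicity of `M b` in V. This exchange lets the universal property of
induction, which governs maps out of the induced module, compute the multiplicities defined by maps
into it. -/
theorem finrank_hom_comm [Fintype ι] [IsSemisimpleModule A V]
    (hM : ∀ a b, Nonempty (M a ≃ₗ[A] M b) → a = b)
    (hc : ∀ S : Submodule A V, IsSimpleModule A S → ∃ a, Nonempty (M a ≃ₗ[A] S)) (b : ι) :
    Module.finrank k (V →ₗ[A] M b) = Module.finrank k (M b →ₗ[A] V) := by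
  classical
  rw [finrank_hom_eq_sum_isotypic (k := k) hM hc]
  simp [finrank_hom_simple (k := k) hM]

omit [IsAlgClosed k] in
/-- A nonzero semisimple module whose endomorphisms are the scalars is simple. -/
theorem isSimpleModule_of_finrank_end_eq_one {N : Type*} [AddCommGroup N] [Module k N]
    [Module A N] [IsScalarTower k A N] [SMulCommClass A k N] [IsSemisimpleModule A N]
    [Nontrivial N] (h : Module.finrank k (N →ₗ[A] N) = 1) : IsSimpleModule A N := by
  rw [isSimpleModule_iff]
  refine { exists_pair_ne := ⟨⊥, ⊤, bot_ne_top⟩, eq_bot_or_eq_top := fun W => ?_ }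
  obtain ⟨p, hp⟩ := exists_isCompl W
  have hid : (LinearMap.id : N →ₗ[A] N) ≠ 0 := by
    obtain ⟨n, hn⟩ := exists_ne (0 : N)
    exact fun h0 => hn (LinearMap.congr_fun h0 n)
  -- The projection onto W along a complement is an endomorphism, hence a scalar; W is zero or
  -- everything according to whether the scalar vanishes.
  obtain ⟨c, hc⟩ := (finrank_eq_one_iff_of_nonzero' _ hid).mp h
    (W.subtype.comp (W.projectionOnto p hp))
  have hcv : ∀ v, c • v = W.projectionOnto p hp v := fun v => LinearMap.congr_fun hc v
  by_cases h0 : c = 0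
  · left
    rw [eq_bot_iff]
    intro w hw
    have := hcv w
    rw [h0, zero_smul, Submodule.projectionOnto_apply_left hp ⟨w, hw⟩] at this
    exact this.symm
  · right
    rw [eq_top_iff]
    intro v _
    have : c • c⁻¹ • v ∈ W := by rw [hcv]; exact Submodule.coe_mem _
    rwa [smul_smul, mul_inv_cancel₀ h0, one_smul] at this

end Decomposition

/-! ### Matrix coefficients of irreducible representations of a finite group -/

section FiniteGroup

variable {H : Type u} [Group H]

/-- The average `∑ τ(s) M ρ(s)⁻¹` of a linear map over the group. -/
def averageMap [Fintype H] {V W : Type*} [AddCommGroup V] [Module ℂ V] [AddCommGroup W]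
    [Module ℂ W] (ρ : Representation ℂ H V) (τ : Representation ℂ H W) (M : V →ₗ[ℂ] W) :
    Representation.IntertwiningMap ρ τ where
  toLinearMap := ∑ s, (τ s).comp (M.comp (ρ s⁻¹))
  isIntertwining' g := by
    refine LinearMap.ext fun v => ?_
    simp only [LinearMap.comp_apply, LinearMap.sum_apply, map_sum]
    refine Fintype.sum_equiv (Equiv.mulLeft g⁻¹) _ _ fun s => ?_
    simp only [Equiv.coe_mulLeft, mul_inv_rev, inv_inv, map_mul, Module.End.mul_apply]
    simp [← Module.End.mul_apply, ← map_mul]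

theorem averageMap_apply [Fintype H] {V W : Type*} [AddCommGroup V] [Module ℂ V]
    [AddCommGroup W] [Module ℂ W] (ρ : Representation ℂ H V) (τ : Representation ℂ H W)
    (M : V →ₗ[ℂ] W) (v : V) : averageMap ρ τ M v = ∑ s, τ s (M (ρ s⁻¹ v)) := by
  change (∑ s, (τ s).comp (M.comp (ρ s⁻¹))) v = _
  simp [LinearMap.sum_apply]

/-- The summands are all equal on an intertwiner, so averaging is a projection up to the factor |H|;
in particular every intertwiner is an average. -/
theorem averageMap_intertwining [Fintype H] {V W : Type*} [AddCommGroup V] [Module ℂ V]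
    [AddCommGroup W] [Module ℂ W] (ρ : Representation ℂ H V) (τ : Representation ℂ H W)
    (f : Representation.IntertwiningMap ρ τ) :
    averageMap ρ τ f.toLinearMap = (Fintype.card H : ℂ) • f := by
  ext v
  change averageMap ρ τ f.toLinearMap v = ((Fintype.card H : ℂ) • f) v
  rw [averageMap_apply]
  have : ∀ s, τ s (f.toLinearMap (ρ s⁻¹ v)) = f v := fun s => by
    rw [Representation.IntertwiningMap.toLinearMap_apply,
      Representation.IntertwiningMap.isIntertwining, ← Module.End.mul_apply, ← map_mul]
    simp
  rw [Finset.sum_congr rfl fun s _ => this s]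
  simp [Nat.cast_smul_eq_nsmul]

theorem MatIrrep.mat_mul (π : MatIrrep H) (g h : H) : π.mat (g * h) = π.mat g * π.mat h := by
  simp [MatIrrep.mat, map_mul, LinearMap.toMatrix'_mul]

theorem MatIrrep.mat_one (π : MatIrrep H) : π.mat 1 = 1 := by
  simp [MatIrrep.mat]

theorem MatIrrep.dim_pos (π : MatIrrep H) : 0 < π.dim := by
  have := π.irreducible
  by_contra h
  have h0 : π.dim = 0 := by omega
  have : Subsingleton (Fin π.dim → ℂ) := by rw [h0]; infer_instance
  exact bot_ne_top (α := Subrepresentation π.rep) (by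
    ext v
    simp [Subsingleton.elim v 0])

/-- The common source of the orthogonality relations: sums of products of matrix coefficients are
the entries of averaged matrix units, and averages are constrained by Schur's lemma. -/
theorem averageMap_single [Fintype H] {m n : ℕ} (ρ : Representation ℂ H (Fin m → ℂ))
    (τ : Representation ℂ H (Fin n → ℂ)) (a b : Fin n) (c d : Fin m) :
    averageMap ρ τ (Matrix.toLin' (Matrix.single b c 1)) (Pi.single d 1) a =
      ∑ s, LinearMap.toMatrix' (τ s) a b * LinearMap.toMatrix' (ρ s⁻¹) c d := by
  rw [averageMap_apply, Finset.sum_apply]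
  refine Finset.sum_congr rfl fun s _ => ?_
  have h1 : Matrix.toLin' (Matrix.single b c (1 : ℂ)) (ρ s⁻¹ (Pi.single d 1)) =
      LinearMap.toMatrix' (ρ s⁻¹) c d • Pi.single b 1 := by
    funext i
    simp [Matrix.toLin'_apply, LinearMap.toMatrix'_apply, Matrix.single_mulVec,
      Function.update_apply, Pi.single_apply]
  rw [h1, map_smul, Pi.smul_apply, smul_eq_mul, mul_comm, LinearMap.toMatrix'_apply]
  congr 2

/-- The averages of the matrix units span the intertwiners, because |H| times an intertwiner is its
own average. So all these sums vanish exactly when there are no nonzero intertwiners. -/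
theorem exists_sum_mat_ne_zero_iff [Fintype H] {m n : ℕ} (ρ : Representation ℂ H (Fin m → ℂ))
    (τ : Representation ℂ H (Fin n → ℂ)) :
    (∃ a b c d, ∑ s, LinearMap.toMatrix' (τ s) a b * LinearMap.toMatrix' (ρ s⁻¹) c d ≠ 0) ↔
      Module.finrank ℂ (Representation.IntertwiningMap ρ τ) ≠ 0 := by
  constructor
  · rintro ⟨a, b, c, d, h⟩ h0
    have := Module.finrank_zero_iff.mp h0
    rw [← averageMap_single, Subsingleton.elim (averageMap ρ τ _) 0] at h
    exact h rfl
  · intro h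
    by_contra! h0
    refine h (Module.finrank_zero_iff.mpr (subsingleton_of_forall_eq 0 fun f => ?_))
    have hE : ∀ b c, averageMap ρ τ (Matrix.toLin' (Matrix.single b c 1)) = 0 := by
      intro b c
      refine Representation.IntertwiningMap.ext (LinearMap.pi_ext' fun d => ?_)
      ext a
      have := h0 a b c d
      rw [← averageMap_single] at this
      exact this
    have hav : averageMap ρ τ f.toLinearMap = 0 := by
      obtain ⟨e, hf⟩ : ∃ e : Matrix (Fin n) (Fin m) ℂ, f.toLinearMap =
          ∑ b, ∑ c, e b c • Matrix.toLin' (Matrix.single b c 1) := by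
        refine ⟨LinearMap.toMatrix' f.toLinearMap, ?_⟩
        conv_lhs => rw [← Matrix.toLin'_toMatrix' f.toLinearMap,
          Matrix.matrix_eq_sum_single (LinearMap.toMatrix' f.toLinearMap)]
        simp only [map_sum]
        refine Finset.sum_congr rfl fun b _ => Finset.sum_congr rfl fun c _ => ?_
        rw [← map_smul, Matrix.smul_single, smul_eq_mul, mul_one]
      refine Representation.IntertwiningMap.ext (LinearMap.ext fun v => ?_)
      have hEv : ∀ b c, ∑ s, τ s (Matrix.toLin' (Matrix.single b c 1) (ρ s⁻¹ v)) = 0 :=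
        fun b c => by rw [← averageMap_apply, hE]; rfl
      change averageMap ρ τ f.toLinearMap v = 0
      rw [averageMap_apply]
      simp only [hf, LinearMap.sum_apply, LinearMap.smul_apply, map_sum, map_smul]
      rw [Finset.sum_comm]
      refine Finset.sum_eq_zero fun b _ => ?_
      rw [Finset.sum_comm]
      refine Finset.sum_eq_zero fun c _ => ?_
      rw [← Finset.smul_sum, hEv, smul_zero]
    rw [averageMap_intertwining] at hav
    exact (smul_eq_zero.mp hav).resolve_left (Nat.cast_ne_zero.mpr Fintype.card_ne_zero)

/-- Schur orthogonality for inequivalent representations. -/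
theorem sum_mat_mul_mat_inv_of_not_equiv [Fintype H] {π π' : MatIrrep H} (h : ¬ π ≈ π')
    (a b : Fin π.dim) (c d : Fin π'.dim) : ∑ s, π.mat s a b * π'.mat s⁻¹ c d = 0 := by
  have := π.irreducible
  have := π'.irreducible
  have h1 := averageMap_single π'.rep π.rep a b c d
  have h2 := (Representation.IsIrreducible.bijective_or_eq_zero
    (averageMap π'.rep π.rep (Matrix.toLin' (Matrix.single b c 1)))).resolve_left
      fun hb => h ⟨(Representation.IntertwiningMap.ofBijective _ hb).symm⟩
  rw [h2] at h1
  exact h1.symm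

/-- Schur orthogonality. -/
theorem sum_mat_mul_mat_inv [Fintype H] (π : MatIrrep H) (a b c d : Fin π.dim) :
    ∑ s, π.mat s a b * π.mat s⁻¹ c d =
      if a = d ∧ b = c then (Fintype.card H : ℂ) / π.dim else 0 := by
  have := π.irreducible
  obtain ⟨z, hz⟩ := (Representation.IsIrreducible.algebraMap_intertwiningMap_bijective_of_isAlgClosed
    (ρ := π.rep)).2 (averageMap π.rep π.rep (Matrix.toLin' (Matrix.single b c 1)))
  have hz' : ∀ a d, ∑ s, π.mat s a b * π.mat s⁻¹ c d = if a = d then z else 0 := by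
    intro a d
    have h1 := averageMap_single π.rep π.rep a b c d
    rw [← hz] at h1
    simp only [MatIrrep.mat]
    rw [← h1]
    change (z • (Pi.single d 1 : Fin π.dim → ℂ)) a = _
    simp [Pi.single_apply]
  -- The scalar is found from a trace: summing over `a = d` produces `∑ (π(s⁻¹) π(s))_{cb}`, which
  -- is |H| times an entry of the identity matrix.
  have htr : (π.dim : ℂ) * z = if b = c then (Fintype.card H : ℂ) else 0 := by
    calc (π.dim : ℂ) * z = ∑ a : Fin π.dim, ∑ s, π.mat s a b * π.mat s⁻¹ c a := by
          simp [hz']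
      _ = ∑ s : H, (π.mat s⁻¹ * π.mat s) c b := by
          rw [Finset.sum_comm]
          refine Finset.sum_congr rfl fun s _ => ?_
          rw [Matrix.mul_apply]
          exact Finset.sum_congr rfl fun _ _ => mul_comm _ _
      _ = _ := by
          simp only [← MatIrrep.mat_mul, inv_mul_cancel, MatIrrep.mat_one, Matrix.one_apply]
          simp [eq_comm]
  have hd : (π.dim : ℂ) ≠ 0 := Nat.cast_ne_zero.mpr π.dim_pos.ne'
  rw [hz']
  by_cases h1 : a = d
  · rw [if_pos h1]
    by_cases h2 : b = c
    · rw [if_pos ⟨h1, h2⟩, eq_div_iff hd, mul_comm, htr, if_pos h2]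
    · rw [if_neg (fun h => h2 h.2)]
      rw [if_neg h2] at htr
      exact (mul_eq_zero.mp htr).resolve_left hd
  · rw [if_neg h1, if_neg (fun h => h1 h.1)]

/-- By orthogonality, one diagonal matrix coefficient from each of pairwise inequivalent
representations gives an independent family in the finite-dimensional space of functions on H. -/
theorem finite_of_matIrrep [Finite H] {ι : Type*} (irr : ι → MatIrrep H)
    (hirr : ∀ a b, irr a ≈ irr b → a = b) : Finite ι := by
  classical
  let _ := Fintype.ofFinite H
  have key : LinearIndependent ℂ fun a : ι => fun s : H =>
      (irr a).mat s ⟨0, (irr a).dim_pos⟩ ⟨0, (irr a).dim_pos⟩ := by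
    rw [linearIndependent_iff']
    intro S g hg a ha
    have h1 := congrArg (fun f : H → ℂ => ∑ s, f s *
      (irr a).mat s⁻¹ ⟨0, (irr a).dim_pos⟩ ⟨0, (irr a).dim_pos⟩) hg
    simp only [Finset.sum_apply, Pi.smul_apply, smul_eq_mul, Finset.sum_mul, Pi.zero_apply,
      zero_mul, Finset.sum_const_zero] at h1
    rw [Finset.sum_comm, Finset.sum_eq_single a] at h1
    · simp only [mul_assoc, ← Finset.mul_sum] at h1
      rw [sum_mat_mul_mat_inv] at h1
      simp only [and_self, if_true] at h1
      refine (mul_eq_zero.mp h1).resolve_right (div_ne_zero ?_ ?_)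
      · exact Nat.cast_ne_zero.mpr Fintype.card_ne_zero
      · exact Nat.cast_ne_zero.mpr (irr a).dim_pos.ne'
    · intro b _ hb
      simp only [mul_assoc, ← Finset.mul_sum]
      rw [sum_mat_mul_mat_inv_of_not_equiv (fun h => hb (hirr _ _ h)), mul_zero]
    · exact fun h => absurd ha h
  exact key.finite

theorem out_equiv_out_iff {σ τ : Irr H} : Quotient.out σ ≈ Quotient.out τ ↔ σ = τ :=
  Quotient.out_equiv_out

instance [Finite H] : Finite (Irr H) :=
  finite_of_matIrrep (fun σ : Irr H => Quotient.out σ) fun _ _ h => out_equiv_out_iff.mp h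

/-- A simple module over the group algebra comes from an irreducible matrix representation. -/
theorem exists_matIrrep (N : Type*) [AddCommGroup N] [Module ℂ N] [Module (MonoidAlgebra ℂ H) N]
    [IsScalarTower ℂ (MonoidAlgebra ℂ H) N] [Module.Finite ℂ N]
    [IsSimpleModule (MonoidAlgebra ℂ H) N] :
    ∃ σ : MatIrrep H, Nonempty (σ.rep.asModule ≃ₗ[MonoidAlgebra ℂ H] N) := by
  let e : N ≃ₗ[ℂ] (Fin (Module.finrank ℂ N) → ℂ) := (Module.finBasis ℂ N).equivFun
  let ρ : Representation ℂ H (Fin (Module.finrank ℂ N) → ℂ) :=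
    { toFun := fun g => e.toLinearMap.comp ((Representation.ofModule' N g).comp e.symm.toLinearMap)
      map_one' := by ext; simp
      map_mul' := fun g h => by ext; simp [map_mul] }
  have hρ : ∀ g v, e.symm (ρ g v) = MonoidAlgebra.single g (1 : ℂ) • e.symm v := fun g v => by
    change e.symm (e (MonoidAlgebra.of ℂ H g • e.symm v)) = _
    simp
  let E : ρ.asModule ≃ₗ[MonoidAlgebra ℂ H] N :=
    { MonoidAlgebra.equivariantOfLinearOfComm
        (ρ.asModuleEquiv.trans e.symm).toLinearMap (fun g v => by
          change e.symm (ρ.asModuleEquiv (MonoidAlgebra.single g (1 : ℂ) • v)) = _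
          rw [Representation.single_smul, one_smul]
          exact hρ g _) with
      invFun := (ρ.asModuleEquiv.trans e.symm).symm
      left_inv := (ρ.asModuleEquiv.trans e.symm).left_inv
      right_inv := (ρ.asModuleEquiv.trans e.symm).right_inv }
  refine ⟨⟨_, ρ, ?_⟩, ⟨E⟩⟩
  rw [Representation.irreducible_iff_isSimpleModule_asModule]
  exact IsSimpleModule.congr E

theorem equiv_of_asModule_equiv {π π' : MatIrrep H}
    (e : π.rep.asModule ≃ₗ[MonoidAlgebra ℂ H] π'.rep.asModule) : π ≈ π' :=
  ⟨Representation.IntertwiningMap.ofBijective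
    ((Representation.IntertwiningMap.equivLinearMapAsModule π.rep π'.rep).symm e.toLinearMap)
    e.bijective⟩

/-- Equivalent representations have isomorphic modules over the group algebra. -/
def asModuleCongr {V W : Type*} [AddCommGroup V] [Module ℂ V] [AddCommGroup W] [Module ℂ W]
    {ρ : Representation ℂ H V} {τ : Representation ℂ H W} (f : ρ.Equiv τ) :
    ρ.asModule ≃ₗ[MonoidAlgebra ℂ H] τ.asModule :=
  LinearEquiv.ofBijective
    (Representation.IntertwiningMap.equivLinearMapAsModule _ _ f.toIntertwiningMap)
    f.toLinearEquiv.bijective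

/-- A complete set of irreducible representations detects the group algebra: a function which is
orthogonal to all matrix coefficients vanishes. -/
theorem eq_zero_of_sum_mul_mat_eq_zero [Fintype H] {ι : Type*} (irr : ι → MatIrrep H)
    (hirr : ∀ π, ∃ a, irr a ≈ π) (f : H → ℂ)
    (hf : ∀ a i j, ∑ s, f s * (irr a).mat s i j = 0) : f = 0 := by
  classical
  -- The hypothesis says that this element acts as zero on every irreducible representation. The
  -- simple submodules of the regular module span it, so the element kills the whole algebra, in
  -- particular 1.
  let x : MonoidAlgebra ℂ H := ∑ s, MonoidAlgebra.single s (f s)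
  have h1 : ∀ a (v : (irr a).rep.asModule), x • v = 0 := by
    intro a v
    have h2 : ∑ s, f s • (irr a).rep s = 0 := by
      refine LinearMap.toMatrix'.injective ?_
      ext i j
      simpa [MatIrrep.mat, Matrix.sum_apply] using hf a i j
    have h3 := LinearMap.congr_fun h2 ((irr a).rep.asModuleEquiv v)
    simp only [x, Finset.sum_smul, Representation.single_smul]
    exact (by simpa using h3 : ∑ s, f s • (irr a).rep s ((irr a).rep.asModuleEquiv v) = 0)
  have h2 : ∀ y : MonoidAlgebra ℂ H, x • y = 0 := by
    intro y
    have hy : y ∈ (⊤ : Submodule (MonoidAlgebra ℂ H) (MonoidAlgebra ℂ H)) := trivial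
    rw [← IsSemisimpleModule.sSup_simples_eq_top, sSup_eq_iSup'] at hy
    induction hy using Submodule.iSup_induction' with
    | mem S y hy =>
      have : IsSimpleModule (MonoidAlgebra ℂ H) S.1 := S.2
      have : Module.Finite ℂ S.1 := finite_submodule S.1
      obtain ⟨σ, ⟨e⟩⟩ := exists_matIrrep (H := H) S.1
      obtain ⟨a, ⟨g⟩⟩ := hirr σ
      let E := (asModuleCongr g).trans e
      have h3 : x • (⟨y, hy⟩ : S.1) = 0 := by
        rw [← E.apply_symm_apply ⟨y, hy⟩, ← map_smul, h1, map_zero]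
      exact congrArg Subtype.val h3
    | zero => exact smul_zero x
    | add y z _ _ hy hz => rw [smul_add, hy, hz, add_zero]
  have h3 : x = 0 := by simpa using h2 1
  funext s
  have := congrArg (fun z : MonoidAlgebra ℂ H => z.coeff s) h3
  simpa [x, Finsupp.single_apply] using this

/-- The multiplicity of an irreducible representation. -/
theorem finrank_intertwiningMap_eq_sum [Finite H] {V W : Type*} [AddCommGroup V] [Module ℂ V]
    [Module.Finite ℂ V] [AddCommGroup W] [Module ℂ W] [Module.Finite ℂ W]
    (ρ : Representation ℂ H V) (τ : Representation ℂ H W) :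
    Module.finrank ℂ (Representation.IntertwiningMap ρ τ) =
      ∑ᶠ σ : Irr H, repMult (Quotient.out σ) ρ * repMult (Quotient.out σ) τ := by
  classical
  let _ := Fintype.ofFinite (Irr H)
  have := fun σ : Irr H => (Quotient.out σ).irreducible
  rw [finsum_eq_sum_of_fintype,
    (Representation.IntertwiningMap.equivLinearMapAsModule ρ τ).finrank_eq,
    finrank_hom_eq_sum_isotypic (k := ℂ) (A := MonoidAlgebra ℂ H)
      (M := fun σ : Irr H => (Quotient.out σ).rep.asModule)
      (fun σ τ ⟨e⟩ => out_equiv_out_iff.mp (equiv_of_asModule_equiv e))]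
  · refine Finset.sum_congr rfl fun σ _ => ?_
    rw [repMult, repMult,
      (Representation.IntertwiningMap.equivLinearMapAsModule _ ρ).finrank_eq,
      (Representation.IntertwiningMap.equivLinearMapAsModule _ τ).finrank_eq]
  · intro S hS
    have : Module.Finite ℂ S := finite_submodule S
    obtain ⟨σ, ⟨e⟩⟩ := exists_matIrrep (H := H) S
    obtain ⟨f⟩ : Quotient.out (Quotient.mk _ σ : Irr H) ≈ σ := Quotient.mk_out σ
    exact ⟨Quotient.mk _ σ, ⟨(asModuleCongr f).trans e⟩⟩

end FiniteGroup

/-! ### Basis vectors of the action algebra and Maschke's theorem -/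

namespace ActionAlgebra

variable {H : Type u} {X : Type v} [Group H] (φ : H →* Equiv.Perm X)

open Classical in
/-- The basis vector `e (x, h)`. -/
def single (x : X) (h : H) : ActionAlgebra φ :=
  ofCoeff φ fun y k => if y = x ∧ k = h then 1 else 0

open Classical in
theorem coeff_single (x y : X) (h k : H) :
    (single φ x h).coeff y k = if y = x ∧ k = h then 1 else 0 := rfl

/-- The algebra as a space of functions. -/
def coeffEquiv : ActionAlgebra φ ≃ₗ[ℂ] (X → H → ℂ) := LinearEquiv.refl ℂ _

instance [Finite X] [Finite H] : Module.Finite ℂ (ActionAlgebra φ) :=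
  Module.Finite.equiv (coeffEquiv φ).symm

/-- The coefficient at a basis vector as a linear form. -/
def coeffHom (x : X) (h : H) : ActionAlgebra φ →ₗ[ℂ] ℂ where
  toFun a := a.coeff x h
  map_add' _ _ := rfl
  map_smul' _ _ := rfl

variable {φ} in
theorem coeff_sum {ι : Type*} (s : Finset ι) (f : ι → ActionAlgebra φ) (x : X) (h : H) :
    (∑ i ∈ s, f i).coeff x h = ∑ i ∈ s, (f i).coeff x h :=
  map_sum (coeffHom φ x h) f s

theorem sum_coeff_smul_single [Fintype X] [Fintype H] (a : ActionAlgebra φ) :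
    ∑ x, ∑ h, a.coeff x h • single φ x h = a := by
  classical
  have hs : ∀ (y k), (∑ x, ∑ h, a.coeff x h • single φ x h).coeff y k =
      ∑ x, ∑ h, a.coeff x h * (single φ x h).coeff y k := by
    intro y k
    simp only [coeff_sum, coeff_smul]
  refine ext_coeff fun y k => ?_
  rw [hs]
  simp [coeff_single, ite_and]

variable [Finite H]

open Classical in
theorem single_mul_single (x y : X) (h k : H) :
    single φ x h * single φ y k = if x = φ h y then single φ x (h * k) else 0 := by
  let _ := Fintype.ofFinite H
  refine ext_coeff fun z l => ?_
  rw [coeff_mul, Finset.sum_eq_single h]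
  · split_ifs with hx
    · subst hx
      by_cases hz : z = φ h y
      · subst hz
        by_cases hl : l = h * k
        · subst hl
          simp [coeff_single]
        · have : h⁻¹ * l ≠ k := fun h' => hl (by rw [← h', mul_inv_cancel_left])
          simp [coeff_single, hl, this]
      · simp [coeff_single, hz]
    · by_cases hz : z = x
      · subst hz
        have : (φ h)⁻¹ z ≠ y := fun h' => hx (by rw [← h', ← Equiv.Perm.mul_apply, mul_inv_cancel, Equiv.Perm.one_apply])
        simp only [coeff_single, this, false_and, if_false, mul_zero, coeff_zero]
      · simp [coeff_single, hz]
  · intro l _ hl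
    simp [coeff_single, hl]
  · simp

theorem single_mul_single_same (y : X) (h k : H) :
    single φ (φ h y) h * single φ y k = single φ (φ h y) (h * k) := by
  rw [single_mul_single, if_pos rfl]

theorem one_eq_sum [Fintype X] : (1 : ActionAlgebra φ) = ∑ x, single φ x 1 := by
  classical
  let _ := Fintype.ofFinite H
  conv_lhs => rw [← sum_coeff_smul_single φ 1]
  refine Finset.sum_congr rfl fun x _ => ?_
  rw [Finset.sum_eq_single 1]
  · simp [coeff_one]
  · intro h _ hh
    simp [coeff_one, hh]
  · simp

section Modules

variable [Finite X] {B : Type*} [Ring B] [Algebra ℂ B] (g : ActionAlgebra φ →ₐ[ℂ] B)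
  {M : Type*} [AddCommGroup M] [Module ℂ M] [Module (ActionAlgebra φ) M]
  [IsScalarTower ℂ (ActionAlgebra φ) M]
  {N : Type*} [AddCommGroup N] [Module ℂ N] [Module B N] [IsScalarTower ℂ B N]

variable {φ}

/-- A linear map which is compatible with the action of the basis vectors is semilinear. -/
def semilinearOfSingle (f : M →ₗ[ℂ] N)
    (hf : ∀ x h m, f (single φ x h • m) = g (single φ x h) • f m) : M →ₛₗ[g.toRingHom] N where
  toFun := f
  map_add' := map_add f
  map_smul' a m := by
    let _ := Fintype.ofFinite H
    let _ := Fintype.ofFinite X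
    conv_lhs => rw [← sum_coeff_smul_single φ a]
    conv_rhs => rw [← sum_coeff_smul_single φ a]
    simp only [AlgHom.toRingHom_eq_coe, RingHom.coe_coe, map_sum, Finset.sum_smul, map_smul,
      smul_assoc, hf]

/-- A linear map which commutes with the basis vectors is linear over the algebra. -/
def linearOfSingle {N : Type*} [AddCommGroup N] [Module ℂ N] [Module (ActionAlgebra φ) N]
    [IsScalarTower ℂ (ActionAlgebra φ) N] (f : M →ₗ[ℂ] N)
    (hf : ∀ x h m, f (single φ x h • m) = single φ x h • f m) : M →ₗ[ActionAlgebra φ] N :=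
  { f with map_smul' := (semilinearOfSingle (AlgHom.id ℂ _) f hf).map_smulₛₗ }

omit [Module ℂ M] [IsScalarTower ℂ (ActionAlgebra φ) M] in
theorem exists_single_smul_ne_zero [Nontrivial M] : ∃ (x : X) (m : M), single φ x 1 • m ≠ 0 := by
  let _ := Fintype.ofFinite X
  obtain ⟨m, hm⟩ := exists_ne (0 : M)
  by_contra! h
  apply hm
  rw [← one_smul (ActionAlgebra φ) m, one_eq_sum, Finset.sum_smul]
  exact Finset.sum_eq_zero fun x _ => h x m

/-- Maschke's argument for the arrows of the action: `e (h⁻¹x, h⁻¹)` is inverse to `e (x, h)`, and a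
linear projection onto W is averaged over conjugation by all arrows. -/
theorem exists_isCompl_submodule (W : Submodule (ActionAlgebra φ) M) : ∃ W', IsCompl W W' := by
  classical
  let _ := Fintype.ofFinite H
  let _ := Fintype.ofFinite X
  obtain ⟨p, hp⟩ := (W.subtype.restrictScalars ℂ).exists_leftInverse_of_injective
    (LinearMap.ker_eq_bot.mpr (Submodule.subtype_injective _))
  have hpW : ∀ (w : M) (hw : w ∈ W), p w = ⟨w, hw⟩ := fun w hw =>
    LinearMap.congr_fun hp ⟨w, hw⟩
  let P : M →ₗ[ℂ] W := (Fintype.card H : ℂ)⁻¹ • ∑ h : H, ∑ x : X,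
    (Algebra.lsmul ℂ ℂ W (single φ (φ h⁻¹ x) h⁻¹)).comp
      (p.comp (Algebra.lsmul ℂ ℂ M (single φ x h)))
  have hP : ∀ m, P m = (Fintype.card H : ℂ)⁻¹ • ∑ h : H, ∑ x : X,
      single φ (φ h⁻¹ x) h⁻¹ • p (single φ x h • m) := fun m => by
    simp [P, LinearMap.sum_apply]
  refine ⟨LinearMap.ker (linearOfSingle (φ := φ) P ?_), LinearMap.isCompl_of_proj ?_⟩
  · intro y k m
    rw [hP, hP, smul_comm]
    congr 1
    rw [Finset.smul_sum]
    -- In both orders of composing with `e (y, k)` a single point of X survives for each h; the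
    -- surviving terms correspond under the substitution `h ↦ h k`.
    have h1 : ∀ h, ∑ x : X, single φ (φ h⁻¹ x) h⁻¹ • p (single φ x h • single φ y k • m) =
        single φ y h⁻¹ • p (single φ (φ h y) (h * k) • m) := by
      intro h
      rw [Finset.sum_eq_single (φ h y)]
      · rw [← mul_smul, single_mul_single_same, ← Equiv.Perm.mul_apply, ← map_mul]
        simp
      · intro x _ hx
        rw [← mul_smul, single_mul_single, if_neg hx, zero_smul, map_zero, smul_zero]
      · simp
    have h2 : ∀ h, single φ y k • ∑ x : X, single φ (φ h⁻¹ x) h⁻¹ • p (single φ x h • m) =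
        single φ y (k * h⁻¹) • p (single φ (φ (h * k⁻¹) y) h • m) := by
      intro h
      rw [Finset.smul_sum, Finset.sum_eq_single (φ (h * k⁻¹) y)]
      · rw [← mul_smul, single_mul_single, if_pos]
        simp [map_mul]
      · intro x _ hx
        rw [← mul_smul, single_mul_single, if_neg, zero_smul]
        rintro rfl
        apply hx
        simp [map_mul]
      · simp
    simp only [h1, h2]
    refine Fintype.sum_equiv (Equiv.mulRight k) _ _ fun h => ?_
    simp
  · intro w
    change P w = w
    -- On W each group element contributes the identity, since the products of inverse arrows are
    -- the idempotents at the points and these sum to 1. This is why the normalization is `1/|H|`,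
    -- independent of the size of X.
    have h1 : ∀ h, ∑ x : X, single φ (φ h⁻¹ x) h⁻¹ • p (single φ x h • (w : M)) = w := by
      intro h
      have h2 : ∀ x, single φ (φ h⁻¹ x) h⁻¹ • p (single φ x h • (w : M)) =
          single φ (φ h⁻¹ x) 1 • w := fun x => by
        rw [hpW _ (W.smul_mem _ w.2)]
        change single φ (φ h⁻¹ x) h⁻¹ • single φ x h • w = _
        rw [← mul_smul, single_mul_single_same, inv_mul_cancel]
      simp only [h2]
      rw [Fintype.sum_equiv (φ h⁻¹) _ (fun x => single φ x 1 • w) fun _ => rfl,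
        ← Finset.sum_smul, ← one_eq_sum, one_smul]
    rw [hP]
    simp only [h1, Finset.sum_const, Finset.card_univ]
    rw [← Nat.cast_smul_eq_nsmul ℂ, smul_smul,
      inv_mul_cancel₀ (Nat.cast_ne_zero.mpr Fintype.card_ne_zero), one_smul]

instance : IsSemisimpleRing (ActionAlgebra φ) :=
  { exists_isCompl := exists_isCompl_submodule }

end Modules

end ActionAlgebra

/-- An algebra homomorphism fixes scalars, so semilinearity over it still contains complex
linearity. This allows restriction along `g` to be handled without putting a second module structure
on the target. -/
theorem semilinear_map_smul {A B : Type*} [Ring A] [Algebra ℂ A] [Ring B] [Algebra ℂ B]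
    {g : A →ₐ[ℂ] B} {M N : Type*} [AddCommGroup M] [Module ℂ M] [Module A M]
    [IsScalarTower ℂ A M] [AddCommGroup N] [Module ℂ N] [Module B N] [IsScalarTower ℂ B N]
    (f : M →ₛₗ[g.toRingHom] N) (c : ℂ) (m : M) : f (c • m) = c • f m := by
  rw [← algebraMap_smul A c m, map_smulₛₗ]
  change g (algebraMap ℂ A c) • f m = _
  rw [AlgHom.commutes, algebraMap_smul]

/-! ### Frobenius reciprocity for modules attached to a stabilizer -/

namespace StabModule

open ActionAlgebra

variable {H : Type u} {X : Type v} [Group H] {φ : H →* Equiv.Perm X} {x₀ : X}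
  {S : Type w} [Group S] {σ : S →* H} {hσ : ∀ s, φ (σ s) x₀ = x₀}
  {V : Type*} [AddCommGroup V] [Module ℂ V] {ρ : Representation ℂ S V}

theorem sum_val {ι : Type*} (s : Finset ι) (f : ι → StabModule φ x₀ σ ρ hσ) (h : H) :
    (∑ i ∈ s, f i).val h = ∑ i ∈ s, (f i).val h :=
  map_sum ({ toFun := fun f => f.val h, map_zero' := rfl, map_add' := fun _ _ => rfl } :
    StabModule φ x₀ σ ρ hσ →+ V) f s

open Classical in
theorem single_smul_val [Finite H] (x : X) (k : H) (f : StabModule φ x₀ σ ρ hσ) (h : H) :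
    (single φ x k • f).val h = if φ h x₀ = x then f.val (k⁻¹ * h) else 0 := by
  let _ := Fintype.ofFinite H
  rw [val_smul, Finset.sum_eq_single k]
  · simp [coeff_single]
  · intro l _ hl
    simp [coeff_single, hl]
  · simp

variable (σ ρ) in
open Classical in
/-- The function with value `ρ(s)⁻¹ v` at `σ s` which vanishes outside the stabilizer. -/
def deltaFun (v : V) (h : H) : V := if hh : ∃ s, σ s = h then ρ hh.choose⁻¹ v else 0

theorem deltaFun_apply (hinj : Function.Injective σ) (v : V) (s : S) :
    deltaFun σ ρ v (σ s) = ρ s⁻¹ v := by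
  have h1 : ∃ t, σ t = σ s := ⟨s, rfl⟩
  have e1 : h1.choose = s := hinj h1.choose_spec
  rw [deltaFun, dif_pos h1, e1]

theorem deltaFun_of_notMem (v : V) {h : H} (hh : ¬ ∃ s, σ s = h) : deltaFun σ ρ v h = 0 := by
  rw [deltaFun, dif_neg hh]

variable (φ x₀ ρ hσ) in
/-- The element supported on the trivial coset with value `v` at `1`. -/
def delta (hinj : Function.Injective σ) : V →ₗ[ℂ] StabModule φ x₀ σ ρ hσ where
  toFun v := ⟨deltaFun σ ρ v, fun h s => by
    by_cases hh : ∃ t, σ t = h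
    · obtain ⟨t, rfl⟩ := hh
      rw [← map_mul, deltaFun_apply hinj, deltaFun_apply hinj, mul_inv_rev, map_mul,
        Module.End.mul_apply]
    · rw [deltaFun_of_notMem _ hh, deltaFun_of_notMem, map_zero]
      exact fun ⟨t, ht⟩ => hh ⟨t * s⁻¹, by rw [map_mul, ht, map_inv, mul_inv_cancel_right]⟩⟩
  map_add' v w := ext_val fun h => by
    change deltaFun σ ρ _ h = deltaFun σ ρ v h + deltaFun σ ρ w h
    by_cases hh : ∃ t, σ t = h
    · obtain ⟨t, rfl⟩ := hh
      simp [deltaFun_apply hinj]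
    · simp [deltaFun_of_notMem _ hh]
  map_smul' c v := ext_val fun h => by
    change deltaFun σ ρ _ h = c • deltaFun σ ρ v h
    by_cases hh : ∃ t, σ t = h
    · obtain ⟨t, rfl⟩ := hh
      simp [deltaFun_apply hinj]
    · simp [deltaFun_of_notMem _ hh]

theorem delta_val (hinj : Function.Injective σ) (v : V) (s : S) :
    (delta φ x₀ hσ ρ hinj v).val (σ s) = ρ s⁻¹ v :=
  deltaFun_apply hinj v s

theorem delta_val_of_notMem (hinj : Function.Injective σ) (v : V) {h : H} (hh : ¬ ∃ s, σ s = h) :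
    (delta φ x₀ hσ ρ hinj v).val h = 0 :=
  deltaFun_of_notMem v hh

/-- The vectors at the base point carry the original representation: this makes restriction to them
a map into `EquivariantMaps`. -/
theorem single_smul_delta [Finite H] (hinj : Function.Injective σ) (s : S) (v : V) :
    single φ x₀ (σ s) • delta φ x₀ hσ ρ hinj v = delta φ x₀ hσ ρ hinj (ρ s v) := by
  classical
  refine ext_val fun h => ?_
  rw [single_smul_val]
  by_cases hh : ∃ t, σ t = h
  · obtain ⟨t, rfl⟩ := hh
    rw [if_pos (hσ t), delta_val, ← map_inv, ← map_mul, delta_val]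
    simp [← Module.End.mul_apply, ← map_mul]
  · rw [delta_val_of_notMem hinj _ hh, delta_val_of_notMem, ite_self]
    rintro ⟨t, ht⟩
    exact hh ⟨s * t, by rw [map_mul, ht, mul_inv_cancel_left]⟩

/-- The summand of h is the restriction of f to the coset hS. Each coset is reached from |S|
elements, hence the factor. The vectors `delta v` thus generate the module. -/
theorem card_smul_eq_sum_single_smul_delta [Fintype H] (hinj : Function.Injective σ)
    (f : StabModule φ x₀ σ ρ hσ) :
    (Nat.card S : ℂ) • f =
      ∑ h, single φ (φ h x₀) h • delta φ x₀ hσ ρ hinj (f.val h) := by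
  classical
  have : Finite S := Finite.of_injective σ hinj
  let _ := Fintype.ofFinite S
  refine ext_val fun y => ?_
  rw [sum_val, val_csmul]
  have h1 : ∀ s : S, f.val y = (single φ (φ (y * σ s) x₀) (y * σ s) •
      delta φ x₀ hσ ρ hinj (f.val (y * σ s))).val y := by
    intro s
    rw [single_smul_val, if_pos (by simp [map_mul, hσ s])]
    rw [show (y * σ s)⁻¹ * y = σ s⁻¹ by simp, delta_val, val_mul]
    simp [← Module.End.mul_apply, ← map_mul]
  rw [← Fintype.sum_of_injective (fun s : S => y * σ s)
    (fun s t h => hinj (mul_left_cancel h)) (fun _ => f.val y) _ _ h1]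
  · simp [Nat.card_eq_fintype_card, Nat.cast_smul_eq_nsmul]
  · intro h hh
    rw [single_smul_val, delta_val_of_notMem, ite_self]
    rintro ⟨t, ht⟩
    exact hh ⟨t⁻¹, by simp [map_inv, ht]⟩

section Adjunction

variable [Finite H] [Finite X] {B : Type*} [Ring B] [Algebra ℂ B] (g : ActionAlgebra φ →ₐ[ℂ] B)
  {N : Type*} [AddCommGroup N] [Module ℂ N] [Module B N] [IsScalarTower ℂ B N]
  [SMulCommClass B ℂ N]

variable (x₀ σ ρ N) in
/-- The linear maps from `V` to the part of `N` at the point `x₀` which are compatible with the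
action of the stabilizer. -/
def EquivariantMaps : Submodule ℂ (V →ₗ[ℂ] N) where
  carrier := {ψ | ∀ s v, g (single φ x₀ (σ s)) • ψ v = ψ (ρ s v)}
  add_mem' := fun {a b} ha hb s v => by simp [ha s v, hb s v]
  zero_mem' := fun s v => by simp
  smul_mem' := fun c a ha s v => by
    rw [LinearMap.smul_apply, LinearMap.smul_apply, smul_comm, ha s v]

/-- The semilinear map determined by its values on the vectors `delta v`. -/
def extendEquivariant (ψ : EquivariantMaps x₀ σ ρ g N) :
    StabModule φ x₀ σ ρ hσ →ₛₗ[g.toRingHom] N :=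
  letI := Fintype.ofFinite H
  semilinearOfSingle g
    -- The formula is forced by `card_smul_eq_sum_single_smul_delta`; dividing by |S| compensates
    -- for running over H instead of over cosets.
    { toFun := fun f => (Nat.card S : ℂ)⁻¹ • ∑ h, g (single φ (φ h x₀) h) • ψ.1 (f.val h)
      map_add' := fun a b => by simp [Finset.sum_add_distrib]
      map_smul' := fun c a => by
        simp only [val_csmul, map_smul, RingHom.id_apply]
        rw [smul_comm c]
        congr 1
        rw [Finset.smul_sum]
        exact Finset.sum_congr rfl fun h _ => smul_comm _ _ _ }
    fun x k f => by
      classical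
      simp only [LinearMap.coe_mk, AddHom.coe_mk]
      rw [smul_comm]
      congr 1
      rw [Finset.smul_sum]
      refine Fintype.sum_equiv (Equiv.mulLeft k⁻¹) _ _ fun h => ?_
      rw [single_smul_val, ← mul_smul, ← map_mul, single_mul_single]
      simp only [Equiv.coe_mulLeft, ← Equiv.Perm.mul_apply, ← map_mul, mul_inv_cancel_left]
      split_ifs with h1 h2 h2
      · rw [h1]
      · exact absurd h1.symm h2
      · exact absurd h2.symm h1
      · simp

theorem extendEquivariant_apply [Fintype H] (ψ : EquivariantMaps x₀ σ ρ g N)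
    (f : StabModule φ x₀ σ ρ hσ) : extendEquivariant g ψ f =
      (Nat.card S : ℂ)⁻¹ • ∑ h, g (single φ (φ h x₀) h) • ψ.1 (f.val h) := by
  obtain rfl := Subsingleton.elim ‹Fintype H› (Fintype.ofFinite H)
  rfl

/-- Frobenius reciprocity for `StabModule`. -/
def homEquiv (hinj : Function.Injective σ) :
    (StabModule φ x₀ σ ρ hσ →ₛₗ[g.toRingHom] N) ≃ₗ[ℂ] EquivariantMaps x₀ σ ρ g N where
  toFun Ψ := ⟨{ toFun := fun v => Ψ (delta φ x₀ hσ ρ hinj v)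
                map_add' := fun v w => by rw [map_add, map_add]
                map_smul' := fun c v => by
                  rw [map_smul, RingHom.id_apply, semilinear_map_smul] },
    fun s v => by
      change g _ • Ψ _ = Ψ _
      rw [← single_smul_delta, map_smulₛₗ]
      rfl⟩
  map_add' _ _ := rfl
  map_smul' _ _ := rfl
  invFun ψ := extendEquivariant g ψ
  left_inv Ψ := by
    let _ := Fintype.ofFinite H
    have : Finite S := Finite.of_injective σ hinj
    refine LinearMap.ext fun f => ?_
    rw [extendEquivariant_apply]
    change (Nat.card S : ℂ)⁻¹ • ∑ h, g (single φ (φ h x₀) h) • Ψ _ = _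
    have h1 : ∀ a m, g a • Ψ m = Ψ (a • m) := fun a m => by
      rw [map_smulₛₗ]
      rfl
    simp only [h1]
    rw [← map_sum, ← card_smul_eq_sum_single_smul_delta, semilinear_map_smul, smul_smul, inv_mul_cancel₀, one_smul]
    exact Nat.cast_ne_zero.mpr Nat.card_pos.ne'
  right_inv ψ := by
    let _ := Fintype.ofFinite H
    have : Finite S := Finite.of_injective σ hinj
    let _ := Fintype.ofFinite S
    refine Subtype.ext (LinearMap.ext fun v => ?_)
    change extendEquivariant g ψ (delta φ x₀ hσ ρ hinj v) = ψ.1 v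
    rw [extendEquivariant_apply]
    have h1 : ∀ s : S, ψ.1 v = g (single φ (φ (σ s) x₀) (σ s)) •
        ψ.1 ((delta φ x₀ hσ ρ hinj v).val (σ s)) := fun s => by
      rw [hσ, delta_val, ψ.2]
      simp [← Module.End.mul_apply, ← map_mul]
    rw [← Fintype.sum_of_injective σ hinj (fun _ => ψ.1 v) _ _ h1]
    · rw [Finset.sum_const, Finset.card_univ, ← Nat.card_eq_fintype_card,
        ← Nat.cast_smul_eq_nsmul ℂ, smul_smul, inv_mul_cancel₀, one_smul]
      exact Nat.cast_ne_zero.mpr Nat.card_pos.ne'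
    · intro h hh
      rw [delta_val_of_notMem hinj v hh, map_zero, smul_zero]

end Adjunction

end StabModule

/-! ### Simple modules of the action algebra -/

namespace StabModule

open ActionAlgebra

variable {H : Type u} {X : Type v} [Group H] {φ : H →* Equiv.Perm X} {x₀ : X}
  {S : Type w} [Group S] {σ : S →* H} {hσ : ∀ s, φ (σ s) x₀ = x₀}
  {V : Type*} [AddCommGroup V] [Module ℂ V] {ρ : Representation ℂ S V}
  {V' : Type*} [AddCommGroup V'] [Module ℂ V'] {ρ' : Representation ℂ S V'}

instance [Finite H] [Module.Finite ℂ V] : Module.Finite ℂ (StabModule φ x₀ σ ρ hσ) :=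
  inferInstanceAs (Module.Finite ℂ (Submodule.mk _ _ : Submodule ℂ (H → V)))

/-- The values on a set of coset representatives determine an element of `StabModule`. -/
def evalEquiv {ι : Type*} (p : ι → H) (hp : Function.Bijective fun q : ι × S => p q.1 * σ q.2) :
    StabModule φ x₀ σ ρ hσ ≃ₗ[ℂ] (ι → V) where
  toFun f i := f.val (p i)
  map_add' _ _ := rfl
  map_smul' _ _ := rfl
  invFun f := ⟨fun h => ρ ((Equiv.ofBijective _ hp).symm h).2⁻¹
      (f ((Equiv.ofBijective _ hp).symm h).1), fun h s => by
    obtain ⟨q, rfl⟩ := (Equiv.ofBijective _ hp).surjective h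
    have h1 : Equiv.ofBijective _ hp q * σ s = Equiv.ofBijective _ hp (q.1, q.2 * s) := by
      simp [mul_assoc]
    beta_reduce
    rw [h1, Equiv.symm_apply_apply, Equiv.symm_apply_apply]
    simp⟩
  left_inv f := ext_val fun h => by
    obtain ⟨q, rfl⟩ := (Equiv.ofBijective _ hp).surjective h
    change ρ _ (f.val (p _)) = _
    rw [Equiv.symm_apply_apply, ← val_mul]
    rfl
  right_inv f := by
    funext i
    have h1 : p i = Equiv.ofBijective _ hp (i, 1) := by simp
    change ρ _ (f _) = _
    rw [h1, Equiv.symm_apply_apply]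
    simp

/-- A function in the module is freely determined by its values on representatives of H/S; the
product form avoids division. -/
theorem finrank_mul_card [Finite H] [Module.Finite ℂ V] (hinj : Function.Injective σ) :
    Module.finrank ℂ (StabModule φ x₀ σ ρ hσ) * Nat.card S =
      Nat.card H * Module.finrank ℂ V := by
  let _ := Fintype.ofFinite (H ⧸ σ.range)
  have hp : Function.Bijective fun q : (H ⧸ σ.range) × S => q.1.out * σ q.2 := by
    constructor
    · rintro ⟨i, s⟩ ⟨j, t⟩ h
      have hij : i = j := by
        have := congrArg (QuotientGroup.mk (s := σ.range)) h
        simpa [QuotientGroup.mk_mul_of_mem, MonoidHom.mem_range] using this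
      subst hij
      exact Prod.ext rfl (hinj (mul_left_cancel h))
    · intro h
      obtain ⟨t, ht⟩ := QuotientGroup.mk_out_eq_mul σ.range h
      obtain ⟨s, hs⟩ := t.2
      refine ⟨((h : H ⧸ σ.range), s⁻¹), ?_⟩
      simp [ht, ← hs]
  rw [(evalEquiv (ρ := ρ) (hσ := hσ) _ hp).finrank_eq, Module.finrank_pi_fintype,
    ← Nat.card_congr (Equiv.ofBijective _ hp), Nat.card_prod,
    Nat.card_eq_fintype_card (α := H ⧸ σ.range)]
  simp [mul_right_comm]

variable [Finite H] [Finite X]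

/-- Linear maps as semilinear maps over the identity. -/
def linearMapEquivSemilinear {A : Type*} [Ring A] [Algebra ℂ A] (M N : Type*) [AddCommGroup M]
    [Module A M] [AddCommGroup N] [Module A N] [Module ℂ N] [SMulCommClass A ℂ N] :
    (M →ₗ[A] N) ≃ₗ[ℂ] (M →ₛₗ[(AlgHom.id ℂ A).toRingHom] N) where
  toFun f := { f with }
  invFun f := { f with }
  map_add' _ _ := rfl
  map_smul' _ _ := rfl
  left_inv _ := rfl
  right_inv _ := rfl

omit [Finite X] in
-- At `s = 1` equivariance says that the image is fixed by `e (x₀, 1)`, the projection to functions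
-- living over x₀.
theorem val_eq_zero_of_equivariant {y₀ : X} {S' : Type*} [Group S'] {σ' : S' →* H}
    {hσ' : ∀ s, φ (σ' s) y₀ = y₀} {ρ' : Representation ℂ S' V'}
    (ψ : EquivariantMaps x₀ σ ρ (AlgHom.id ℂ (ActionAlgebra φ)) (StabModule φ y₀ σ' ρ' hσ')) (v : V) (h : H)
    (hh : φ h y₀ ≠ x₀) : (ψ.1 v).val h = 0 := by
  classical
  have := ψ.2 1 v
  rw [map_one, map_one, Module.End.one_apply] at this
  rw [← this, AlgHom.coe_id, id_eq, single_smul_val, if_neg hh]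

/-- Linear maps between modules at the same point are intertwining maps. -/
def homEquivIntertwining (hinj : Function.Injective σ)
    (hst : ∀ h, φ h x₀ = x₀ → ∃ s, σ s = h) :
    (StabModule φ x₀ σ ρ hσ →ₗ[ActionAlgebra φ] StabModule φ x₀ σ ρ' hσ) ≃ₗ[ℂ]
      Representation.IntertwiningMap ρ ρ' :=
  (linearMapEquivSemilinear _ _).trans <| (homEquiv (AlgHom.id ℂ _) hinj).trans
    { toFun := fun ψ =>
        { toFun := fun v => (ψ.1 v).val 1
          map_add' := fun v w => by simp
          map_smul' := fun c v => by simp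
          isIntertwining' := fun s => by
            classical
            refine LinearMap.ext fun v => ?_
            change (ψ.1 (ρ s v)).val 1 = ρ' s ((ψ.1 v).val 1)
            rw [← ψ.2, AlgHom.coe_id, id_eq, single_smul_val, if_pos (by simp), mul_one,
              ← map_inv, ← one_mul (σ s⁻¹), val_mul, inv_inv] }
      map_add' := fun _ _ => rfl
      map_smul' := fun _ _ => rfl
      invFun := fun f => ⟨(delta φ x₀ hσ ρ' hinj).comp f.toLinearMap, fun s v => by
        change single φ x₀ (σ s) • delta φ x₀ hσ ρ' hinj (f v) =
          delta φ x₀ hσ ρ' hinj (f (ρ s v))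
        rw [single_smul_delta, f.isIntertwining]⟩
      left_inv := fun ψ => by
        refine Subtype.ext (LinearMap.ext fun v => ext_val fun h => ?_)
        change (delta φ x₀ hσ ρ' hinj ((ψ.1 v).val 1)).val h = _
        by_cases hh : ∃ s, σ s = h
        · obtain ⟨s, rfl⟩ := hh
          rw [delta_val, ← val_mul, one_mul]
        · rw [delta_val_of_notMem hinj _ hh, val_eq_zero_of_equivariant ψ v h fun h' =>
            hh (hst h h')]
      right_inv := fun f => by
        ext v
        change (delta φ x₀ hσ ρ' hinj (f v)).val 1 = f v
        rw [← map_one σ, delta_val]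
        simp }

/-- A map is determined by its values on the vectors at x₀, and the target has nothing over x₀ when
x₀ lies outside the orbit of y₀. -/
theorem subsingleton_hom_of_orbit_ne {y₀ : X} {S' : Type*} [Group S'] {σ' : S' →* H}
    {hσ' : ∀ s, φ (σ' s) y₀ = y₀} {ρ' : Representation ℂ S' V'} (hinj : Function.Injective σ)
    (hne : ∀ h, φ h y₀ ≠ x₀) :
    Subsingleton (StabModule φ x₀ σ ρ hσ →ₗ[ActionAlgebra φ] StabModule φ y₀ σ' ρ' hσ') := by
  refine @Function.Injective.subsingleton _ _ _ ((linearMapEquivSemilinear _ _).trans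
    (homEquiv (AlgHom.id ℂ _) hinj)).injective
      ⟨fun ψ ψ' => Subtype.ext (LinearMap.ext fun v => ext_val fun h => ?_)⟩
  rw [val_eq_zero_of_equivariant ψ v h (hne h), val_eq_zero_of_equivariant ψ' v h (hne h)]

/-- Endomorphisms of the module are intertwiners of ρ, which are scalars by Schur's lemma; a
semisimple module with scalar endomorphisms is simple. -/
theorem isSimpleModule [Module.Finite ℂ V] [hρ : ρ.IsIrreducible] (hinj : Function.Injective σ)
    (hst : ∀ h, φ h x₀ = x₀ → ∃ s, σ s = h) :
    IsSimpleModule (ActionAlgebra φ) (StabModule φ x₀ σ ρ hσ) := by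
  have h1 : Module.finrank ℂ
      (StabModule φ x₀ σ ρ hσ →ₗ[ActionAlgebra φ] StabModule φ x₀ σ ρ hσ) = 1 := by
    rw [(homEquivIntertwining hinj hst).finrank_eq]
    exact Representation.IsIrreducible.finrank_intertwiningMap_self ρ
  have : Nontrivial (StabModule φ x₀ σ ρ hσ) := by
    by_contra hn
    rw [not_nontrivial_iff_subsingleton] at hn
    rw [Module.finrank_zero_of_subsingleton] at h1
    exact zero_ne_one h1
  exact isSimpleModule_of_finrank_end_eq_one (k := ℂ) h1

/-- The dimension of End(ρ) is nonzero and equals the sum of the squared multiplicities, so some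
multiplicity is nonzero. -/
theorem exists_intertwiningMap_ne_zero [Finite S] {ι : Type*} (irr : ι → MatIrrep S)
    (hirr : ∀ π, ∃ a, irr a ≈ π) [Module.Finite ℂ V] [Nontrivial V] (ρ : Representation ℂ S V) :
    ∃ a, ∃ f : Representation.IntertwiningMap (irr a).rep ρ, f ≠ 0 := by
  have h1 : Module.finrank ℂ (Representation.IntertwiningMap ρ ρ) ≠ 0 := by
    rw [Ne, Module.finrank_zero_iff]
    intro h
    obtain ⟨v, hv⟩ := exists_ne (0 : V)
    exact hv (congrArg (fun f : Representation.IntertwiningMap ρ ρ => f v)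
      (Subsingleton.elim (Representation.IntertwiningMap.id ρ) 0))
  rw [finrank_intertwiningMap_eq_sum] at h1
  obtain ⟨π, hπ⟩ : ∃ π : Irr S, repMult (Quotient.out π) ρ * repMult (Quotient.out π) ρ ≠ 0 := by
    by_contra! h
    exact h1 (by simp only [h, finsum_zero])
  have h2 := right_ne_zero_of_mul hπ
  rw [repMult, Ne, Module.finrank_zero_iff, not_subsingleton_iff_nontrivial] at h2
  obtain ⟨f, hf⟩ := exists_ne (0 : Representation.IntertwiningMap (Quotient.out π).rep ρ)
  obtain ⟨a, ⟨e⟩⟩ := hirr (Quotient.out π)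
  refine ⟨a, f.comp e.toIntertwiningMap, fun h0 => hf ?_⟩
  refine Representation.IntertwiningMap.ext (LinearMap.ext fun v => ?_)
  have h1 : f (e (e.symm v)) = 0 :=
    congrArg (fun f : Representation.IntertwiningMap (irr a).rep ρ => f (e.symm v)) h0
  rwa [Representation.Equiv.apply_symm_apply] at h1

/-- The part of a module at the point `x₀`. -/
def pointPart {N : Type*} [AddCommGroup N] [Module ℂ N] [Module (ActionAlgebra φ) N]
    [SMulCommClass (ActionAlgebra φ) ℂ N] (x₀ : X) : Submodule ℂ N where
  carrier := {n | single φ x₀ 1 • n = n}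
  add_mem' := fun {a b} ha hb => by
    change _ • _ = _
    rw [smul_add, ha, hb]
  zero_mem' := smul_zero _
  smul_mem' := fun c a ha => by
    change _ • _ = _
    rw [smul_comm, ha]

variable (φ hσ) in
/-- The representation of the stabilizer on the part of a module at the point `x₀`. -/
def pointRep (N : Type*) [AddCommGroup N] [Module ℂ N] [Module (ActionAlgebra φ) N]
    [SMulCommClass (ActionAlgebra φ) ℂ N] :
    Representation ℂ S (pointPart (φ := φ) (N := N) x₀) where
  toFun s :=
    { toFun := fun n => ⟨single φ x₀ (σ s) • n.1, by
        change _ • _ = _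
        rw [← mul_smul, single_mul_single, if_pos (by simp), one_mul]⟩
      map_add' := fun a b => Subtype.ext (smul_add _ _ _)
      map_smul' := fun c a => Subtype.ext (smul_comm _ _ _) }
  map_one' := by
    ext n
    change single φ x₀ (σ 1) • n.1 = n.1
    rw [map_one]
    exact n.2
  map_mul' s t := by
    ext n
    change single φ x₀ (σ (s * t)) • n.1 = single φ x₀ (σ s) • single φ x₀ (σ t) • n.1
    rw [← mul_smul, single_mul_single, if_pos (hσ s).symm, map_mul]

/-- A simple module which does not vanish at the orbit of `x₀` is one of the modules attached to
irreducible representations of the stabilizer. -/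
theorem exists_linearEquiv_of_isSimpleModule [Finite S] (hinj : Function.Injective σ)
    (hst : ∀ h, φ h x₀ = x₀ → ∃ s, σ s = h) {ι : Type*} (irr : ι → MatIrrep S)
    (hirr : ∀ π, ∃ a, irr a ≈ π) {N : Type*} [AddCommGroup N] [Module ℂ N]
    [Module (ActionAlgebra φ) N] [IsScalarTower ℂ (ActionAlgebra φ) N]
    [SMulCommClass (ActionAlgebra φ) ℂ N] [Module.Finite ℂ N] [IsSimpleModule (ActionAlgebra φ) N]
    (k : H) (n : N) (hn : single φ (φ k x₀) 1 • n ≠ 0) :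
    ∃ a, Nonempty (StabModule φ x₀ σ (irr a).rep hσ ≃ₗ[ActionAlgebra φ] N) := by
  -- The arrow `e (x₀, k⁻¹)` carries the part at `k • x₀` invertibly to the part at x₀, so the
  -- latter is nonzero as well.
  have : Nontrivial (pointPart (φ := φ) (N := N) x₀) := by
    refine ⟨⟨⟨single φ x₀ k⁻¹ • n, ?_⟩, 0, fun h => hn ?_⟩⟩
    · change _ • _ = _
      rw [← mul_smul, single_mul_single, if_pos (by simp), one_mul]
    · have h1 : single φ x₀ k⁻¹ • n = 0 := congrArg Subtype.val h
      have h2 : single φ (φ k x₀) 1 = single φ (φ k x₀) k * single φ x₀ k⁻¹ := by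
        rw [single_mul_single, if_pos rfl, mul_inv_cancel]
      rw [h2, mul_smul, h1, smul_zero]
  obtain ⟨a, f, hf⟩ := exists_intertwiningMap_ne_zero irr hirr (pointRep φ hσ N)
  refine ⟨a, ?_⟩
  -- An irreducible constituent of the part at x₀ is an equivariant map; Frobenius reciprocity
  -- extends it to a nonzero map between simple modules.
  let ψ : EquivariantMaps x₀ σ (irr a).rep (AlgHom.id ℂ _) N :=
    ⟨(Submodule.subtype _).comp f.toLinearMap, fun s v => by
      have := congrArg Subtype.val (LinearMap.congr_fun (f.isIntertwining' s) v)
      exact this.symm⟩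
  let F := (linearMapEquivSemilinear (StabModule φ x₀ σ (irr a).rep hσ) N).symm
    ((homEquiv (AlgHom.id ℂ _) hinj).symm ψ)
  have hF : F ≠ 0 := by
    intro h0
    have h1 : ψ = 0 := 
      (LinearEquiv.map_eq_zero_iff _).mp ((LinearEquiv.map_eq_zero_iff _).mp h0)
    refine hf (Representation.IntertwiningMap.ext (LinearMap.ext fun v => Subtype.ext ?_))
    exact LinearMap.congr_fun (congrArg Subtype.val h1) v
  have := (irr a).irreducible
  have := isSimpleModule (φ := φ) (hσ := hσ) (ρ := (irr a).rep) hinj hst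
  exact ⟨LinearEquiv.ofBijective F ((LinearMap.bijective_or_eq_zero F).resolve_right hF)⟩

end StabModule

/-! ### Elementary excitations of the bulk and of the boundary -/

variable {G : Type u} [Group G] [Finite G]

theorem card_carrier_mul_card_centralizer {C : ConjClasses G} {r : G} (hr : ConjClasses.mk r = C) :
    Nat.card C.carrier * Nat.card (centralizerOf r) = Nat.card G := by
  classical
  subst hr
  let _ := Fintype.ofFinite G
  rw [← ConjAct.orbit_eq_carrier_conjClasses, Subgroup.nat_card_centralizer_nat_card_stabilizer,
    Nat.card_eq_fintype_card, Nat.card_eq_fintype_card,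
    MulAction.card_orbit_mul_card_stabilizer_eq_card_group, ← Nat.card_eq_fintype_card]
  rfl

omit [Finite G] in
theorem conj_centralizer_eq (r : G) (s : centralizerOf r) :
    ((MulAut.toPerm (M := G)).comp MulAut.conj) ((centralizerOf r).subtype s) r = r :=
  mul_inv_eq_iff_eq_mul.mpr (Subgroup.mem_centralizer_singleton_iff.mp s.2)

omit [Finite G] in
theorem exists_centralizer_eq (r h : G)
    (hh : ((MulAut.toPerm (M := G)).comp MulAut.conj) h r = r) :
    ∃ s, (centralizerOf r).subtype s = h :=
  ⟨⟨h, Subgroup.mem_centralizer_singleton_iff.mpr (mul_inv_eq_iff_eq_mul.mp hh)⟩, rfl⟩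

namespace BulkAnyon

variable {β : BulkChoice G}

instance : Finite (BulkAnyon β) := inferInstance

omit [Finite G] in
theorem exists_irrep_equiv (C : ConjClasses G) (π : MatIrrep (centralizerOf (β.r C))) :
    ∃ a, β.irrep C a ≈ π :=
  ⟨Quotient.mk _ π, Quotient.exact (β.mk_irrep C (Quotient.mk _ π))⟩

omit [Finite G] in
theorem irrep_equiv_iff {C : ConjClasses G} {π π' : Irr (centralizerOf (β.r C))} :
    β.irrep C π ≈ β.irrep C π' ↔ π = π' := by
  constructor
  · intro h
    rw [← β.mk_irrep C π, ← β.mk_irrep C π']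
    exact Quotient.sound h
  · rintro rfl
    exact Setoid.refl _

instance (a : BulkAnyon β) : IsSimpleModule (QuantumDouble G) a.Mod :=
  have := a.irrep.irreducible
  StabModule.isSimpleModule Subtype.val_injective (exists_centralizer_eq a.pt)

theorem eq_of_linearEquiv (a b : BulkAnyon β) (h : Nonempty (a.Mod ≃ₗ[QuantumDouble G] b.Mod)) :
    a = b := by
  obtain ⟨e⟩ := h
  have : Nontrivial a.Mod := IsSimpleModule.nontrivial (QuantumDouble G) a.Mod
  have he : e.toLinearMap ≠ 0 := by
    intro h0
    obtain ⟨m, hm⟩ := exists_ne (0 : a.Mod)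
    exact hm (e.injective (by rw [map_zero]; exact LinearMap.congr_fun h0 m))
  have hC : a.1 = b.1 := by
    by_contra hne
    have := StabModule.subsingleton_hom_of_orbit_ne
      (φ := (MulAut.toPerm (M := G)).comp MulAut.conj) (hσ := a.pt_fixed) (hσ' := b.pt_fixed)
      (ρ := a.irrep.rep) (ρ' := b.irrep.rep) Subtype.val_injective (fun h hh => hne (by
        rw [← β.mk_r a.1, ← β.mk_r b.1, eq_comm, ConjClasses.mk_eq_mk_iff_isConj, isConj_iff]
        exact ⟨h, hh⟩))
    exact he (Subsingleton.elim _ _)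
  obtain ⟨C, π⟩ := a
  obtain ⟨C', π'⟩ := b
  obtain rfl : C = C' := hC
  have := (β.irrep C π).irreducible
  have := (β.irrep C π').irreducible
  let f := StabModule.homEquivIntertwining Subtype.val_injective
    (exists_centralizer_eq (β.r C)) e.toLinearMap
  have hf : f ≠ 0 := fun h0 => he ((LinearEquiv.map_eq_zero_iff _).mp h0)
  rw [show π = π' from irrep_equiv_iff.mp ⟨Representation.IntertwiningMap.ofBijective f
    ((Representation.IsIrreducible.bijective_or_eq_zero f).resolve_right hf)⟩]

theorem exists_linearEquiv (N : Type*) [AddCommGroup N] [Module ℂ N] [Module (QuantumDouble G) N]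
    [IsScalarTower ℂ (QuantumDouble G) N] [SMulCommClass (QuantumDouble G) ℂ N]
    [Module.Finite ℂ N] [IsSimpleModule (QuantumDouble G) N] :
    ∃ a : BulkAnyon β, Nonempty (a.Mod ≃ₗ[QuantumDouble G] N) := by
  have : Nontrivial N := IsSimpleModule.nontrivial (QuantumDouble G) N
  obtain ⟨x, n, hn⟩ := ActionAlgebra.exists_single_smul_ne_zero
    (φ := (MulAut.toPerm (M := G)).comp MulAut.conj) (M := N)
  have h1 : IsConj (β.r (ConjClasses.mk x)) x :=
    ConjClasses.mk_eq_mk_iff_isConj.mp (β.mk_r (ConjClasses.mk x))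
  obtain ⟨k, hk⟩ := isConj_iff.mp h1
  obtain ⟨π, h⟩ := StabModule.exists_linearEquiv_of_isSimpleModule
    (hσ := conj_centralizer_eq (β.r (ConjClasses.mk x))) Subtype.val_injective
    (exists_centralizer_eq _) (β.irrep (ConjClasses.mk x)) (exists_irrep_equiv _) k n (by
      change ActionAlgebra.single _ (k * β.r (ConjClasses.mk x) * k⁻¹) 1 • n ≠ 0
      rwa [hk])
  exact ⟨⟨ConjClasses.mk x, π⟩, h⟩

/-- Quantum dimensions are ordinary dimensions, so the sum rule becomes a count of dimensions. -/
theorem FPdim_eq (a : BulkAnyon β) : a.FPdim = Module.finrank ℂ a.Mod := by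
  have h1 := StabModule.finrank_mul_card (φ := (MulAut.toPerm (M := G)).comp MulAut.conj)
    (hσ := a.pt_fixed) (ρ := a.irrep.rep) Subtype.val_injective
  rw [← card_carrier_mul_card_centralizer (β.mk_r a.1), Module.finrank_fin_fun, mul_right_comm]
    at h1
  rw [FPdim, Nat.eq_of_mul_eq_mul_right Nat.card_pos h1]
  push_cast
  rfl

end BulkAnyon

namespace BoundaryAnyon

variable {K : Subgroup G} (b : BoundaryAnyon K)

theorem FPdim_eq : b.FPdim = Module.finrank ℂ b.Mod := by
  have h1 := StabModule.finrank_mul_card (φ := MulAction.toPermHom K (G ⧸ K))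
    (hσ := b.pt_fixed) (ρ := b.irrep.rep) (Subgroup.inclusion_injective _)
  rw [Module.finrank_fin_fun] at h1
  have h2 : (Nat.card (stab K b.r) : ℚ) ≠ 0 := Nat.cast_ne_zero.mpr Nat.card_pos.ne'
  rw [FPdim, div_mul_eq_mul_div, div_eq_iff h2]
  exact_mod_cast h1.symm

end BoundaryAnyon

/-! ### The induced module -/

section Induced

open ActionAlgebra

variable {G : Type u} [Group G] [Finite G] {K : Subgroup G}

/-- Any representatives of the cosets `G / K`. -/
abbrev cosetRep (y : G ⧸ K) : G := Quotient.out y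

omit [Finite G] in
theorem mk_cosetRep (y : G ⧸ K) : QuotientGroup.mk (s := K) (cosetRep y) = y := QuotientGroup.out_eq' y

theorem incl_coeff_of_mem (z : BoundaryAlgebra K) (h : G) {g : G} (hg : g ∈ K) :
    (incl K z).coeff h g = z.coeff (h : G ⧸ K) ⟨g, hg⟩ :=
  dif_pos hg

theorem incl_coeff_of_notMem (z : BoundaryAlgebra K) (h : G) {g : G} (hg : g ∉ K) :
    (incl K z).coeff h g = 0 :=
  dif_neg hg

/-- The coordinates with respect to the basis `rightBasis` of `D(G)` as a right module over the
boundary algebra. -/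
def rightCoord (i : (G ⧸ K) × K) : QuantumDouble G →ₗ[ℂ] BoundaryAlgebra K where
  toFun d := ofCoeff _ fun x k =>
    d.coeff (cosetRep i.1 * (cosetRep x * i.2) * (cosetRep i.1)⁻¹) (cosetRep i.1 * k)
  map_add' _ _ := rfl
  map_smul' _ _ := rfl

theorem rightCoord_coeff (i : (G ⧸ K) × K) (d : QuantumDouble G) (x : G ⧸ K) (k : K) :
    (rightCoord i d).coeff x k =
      d.coeff (cosetRep i.1 * (cosetRep x * i.2) * (cosetRep i.1)⁻¹) (cosetRep i.1 * k) := rfl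

open Classical in
/-- A basis of `D(G)` as a right module over the boundary algebra. -/
def rightBasis (i : (G ⧸ K) × K) : QuantumDouble G :=
  ofCoeff _ fun h g => if g = cosetRep i.1 ∧ (cosetRep i.1)⁻¹ * h * cosetRep i.1 =
    cosetRep (((cosetRep i.1)⁻¹ * h * cosetRep i.1 : G) : G ⧸ K) * i.2 then 1 else 0

omit [Finite G] in
open Classical in
theorem rightBasis_coeff (i : (G ⧸ K) × K) (h g : G) :
    (rightBasis i).coeff h g = if g = cosetRep i.1 ∧ (cosetRep i.1)⁻¹ * h * cosetRep i.1 =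
    cosetRep (((cosetRep i.1)⁻¹ * h * cosetRep i.1 : G) : G ⧸ K) * i.2 then 1 else 0 := rfl

/-- For coset representatives y and x and for κ, k in K, the product of `rightBasis (yK, κ)` with
Z^{(xK,k)} is the single vector D^{(y x κ y⁻¹, y k)}. These products run once through the basis of
D(G), and `rightCoord` reads off the coefficients; here this is seen to be linear over Z on the
right. -/
theorem rightCoord_mul_incl (i : (G ⧸ K) × K) (d : QuantumDouble G) (z : BoundaryAlgebra K) :
    rightCoord i (d * incl K z) = rightCoord i d * z := by
  let _ := Fintype.ofFinite G
  let _ := Fintype.ofFinite K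
  refine ext_coeff fun x k => ?_
  rw [rightCoord_coeff, coeff_mul, coeff_mul]
  refine (Fintype.sum_of_injective (fun l : K => cosetRep i.1 * (l : G))
    (fun a b h => Subtype.ext (mul_left_cancel h)) _ _ ?_ ?_).symm
  · intro l hl
    rw [incl_coeff_of_notMem, mul_zero]
    intro hmem
    refine hl ⟨⟨(cosetRep i.1)⁻¹ * l, ?_⟩, by simp⟩
    have : (cosetRep i.1)⁻¹ * l = k * (l⁻¹ * (cosetRep i.1 * k))⁻¹ := by group
    rw [this]
    exact K.mul_mem k.2 (K.inv_mem hmem)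
  · intro l
    rw [rightCoord_coeff]
    congr 1
    have h1 : (cosetRep i.1 * (l : G))⁻¹ * (cosetRep i.1 * (k : G)) = ((l⁻¹ * k : K) : G) := by
      simp [mul_assoc]
    rw [h1, incl_coeff_of_mem _ _ (l⁻¹ * k).2]
    congr 1
    have h2 : (MulAction.toPermHom K (G ⧸ K) l)⁻¹ x =
        QuotientGroup.mk (s := K) ((l⁻¹ : K) * cosetRep x) := by
      conv_lhs => rw [← mk_cosetRep x, ← map_inv]
      rfl
    have h3 : (((MulAut.toPerm (M := G)).comp MulAut.conj) (cosetRep i.1 * l))⁻¹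
        (cosetRep i.1 * (cosetRep x * i.2) * (cosetRep i.1)⁻¹) = (cosetRep i.1 * l)⁻¹ *
          (cosetRep i.1 * (cosetRep x * i.2) * (cosetRep i.1)⁻¹) * (cosetRep i.1 * l) := by
      rw [← map_inv]
      conv_rhs => rw [← inv_inv (cosetRep i.1 * (l : G)), inv_inv (cosetRep i.1 * (l : G))⁻¹]
      change _ * _ * ((cosetRep i.1 * (l : G))⁻¹)⁻¹ = _
      rw [inv_inv]
    rw [h2, h3, QuotientGroup.eq]
    have : ((l⁻¹ : K) * cosetRep x : G)⁻¹ * ((cosetRep i.1 * l)⁻¹ * (cosetRep i.1 *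
        (cosetRep x * i.2) * (cosetRep i.1)⁻¹) * (cosetRep i.1 * l)) = (i.2 * l : K) := by
      push_cast
      group
    rw [this]
    exact (i.2 * l).2

theorem rightCoord_rightBasis [DecidableEq ((G ⧸ K) × K)] (i j : (G ⧸ K) × K) :
    rightCoord i (rightBasis j) = if i = j then 1 else 0 := by
  classical
  refine ext_coeff fun x k => ?_
  rw [rightCoord_coeff, rightBasis_coeff]
  by_cases hij : i = j
  · subst hij
    rw [if_pos rfl, coeff_one]
    have h1 : (cosetRep i.1)⁻¹ * (cosetRep i.1 * (cosetRep x * (i.2 : G)) * (cosetRep i.1)⁻¹) *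
      cosetRep i.1 = cosetRep x * i.2 := by group
    have h2 : ((cosetRep x * (i.2 : G) : G) : G ⧸ K) = x := by
      rw [QuotientGroup.mk_mul_of_mem _ i.2.2, mk_cosetRep]
    rw [h1, h2]
    simp
  · rw [if_neg hij, coeff_zero, if_neg]
    rintro ⟨h1, h2⟩
    have hy : i.1 = j.1 := by
      rw [← mk_cosetRep j.1, ← h1, QuotientGroup.mk_mul_of_mem _ k.2, mk_cosetRep]
    rw [← hy] at h2
    have h3 : (cosetRep i.1)⁻¹ * (cosetRep i.1 * (cosetRep x * (i.2 : G)) * (cosetRep i.1)⁻¹) *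
      cosetRep i.1 = cosetRep x * i.2 := by group
    have h4 : ((cosetRep x * (i.2 : G) : G) : G ⧸ K) = x := by
      rw [QuotientGroup.mk_mul_of_mem _ i.2.2, mk_cosetRep]
    rw [h3, h4] at h2
    exact hij (Prod.ext hy (Subtype.ext (mul_left_cancel h2)))

theorem sum_rightBasis_mul_incl [Fintype ((G ⧸ K) × K)] (d : QuantumDouble G) :
    ∑ i, rightBasis i * incl K (rightCoord i d) = d := by
  classical
  let _ := Fintype.ofFinite G
  refine ext_coeff fun h g => ?_
  rw [coeff_sum]
  have h1 : ∀ i : (G ⧸ K) × K, (rightBasis i * incl K (rightCoord i d)).coeff h g =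
      if (cosetRep i.1)⁻¹ * h * cosetRep i.1 =
        cosetRep (((cosetRep i.1)⁻¹ * h * cosetRep i.1 : G) : G ⧸ K) * i.2 then
        (incl K (rightCoord i d)).coeff ((cosetRep i.1)⁻¹ * h * cosetRep i.1)
          ((cosetRep i.1)⁻¹ * g) else 0 := by
    intro i
    rw [coeff_mul, Finset.sum_eq_single (cosetRep i.1)]
    · rw [rightBasis_coeff]
      have : ((((MulAut.toPerm (M := G)).comp MulAut.conj) (cosetRep i.1))⁻¹ h) =
          (cosetRep i.1)⁻¹ * h * cosetRep i.1 := by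
        rw [← map_inv]
        change (cosetRep i.1)⁻¹ * h * (cosetRep i.1)⁻¹⁻¹ = _
        rw [inv_inv]
      rw [this]
      split_ifs with h1 h2 h2
      · rw [one_mul]
      · exact absurd h1.2 h2
      · exact absurd ⟨rfl, h2⟩ h1
      · rw [zero_mul]
    · intro l _ hl
      rw [rightBasis_coeff, if_neg (fun h => hl h.1), zero_mul]
    · simp
  simp only [h1]
  set y : G ⧸ K := (g : G ⧸ K) with hy
  set x : G ⧸ K := (((cosetRep y)⁻¹ * h * cosetRep y : G) : G ⧸ K) with hx
  have hκ : (cosetRep x)⁻¹ * ((cosetRep y)⁻¹ * h * cosetRep y) ∈ K := by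
    rw [← QuotientGroup.eq, mk_cosetRep]
  have hk : (cosetRep y)⁻¹ * g ∈ K := by
    rw [← QuotientGroup.eq, mk_cosetRep]
  -- Only one index reaches (h, g): its coset is gK, and its K-part measures the conjugate of h
  -- against the representative of its own coset.
  rw [Finset.sum_eq_single (y, ⟨_, hκ⟩)]
  · rw [if_pos (by simp [← hx]), incl_coeff_of_mem _ _ hk, rightCoord_coeff]
    dsimp only
    rw [← hx]
    congr 1 <;> group
  · intro i _ hi
    split_ifs with h2
    · rw [incl_coeff_of_notMem]
      intro hmem
      have hy' : i.1 = y := by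
        rw [hy, ← mk_cosetRep i.1, QuotientGroup.eq]
        exact hmem
      refine hi (Prod.ext hy' (Subtype.ext ?_))
      rw [hy', ← hx] at h2
      change (i.2 : G) = (cosetRep x)⁻¹ * ((cosetRep y)⁻¹ * h * cosetRep y)
      rw [h2, inv_mul_cancel_left]
    · rfl
  · simp

variable {M : Type*} [AddCommGroup M] [Module ℂ M] [Module (BoundaryAlgebra K) M]

variable (K M) in
/-- The submodule of relations `d z ⊗ m = d ⊗ z m`. -/
abbrev inducedRel : Submodule (QuantumDouble G) (QuantumDouble G ⊗[ℂ] M) :=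
  Submodule.span (QuantumDouble G)
    {t : QuantumDouble G ⊗[ℂ] M | ∃ (d : QuantumDouble G) (z : BoundaryAlgebra K) (m : M),
      t = (d * incl K z) ⊗ₜ[ℂ] m - d ⊗ₜ[ℂ] (z • m)}

variable (K) in
/-- The class of `d ⊗ m`. -/
def Induced.mk (d : QuantumDouble G) (m : M) : Induced K M :=
  (inducedRel K M).mkQ (d ⊗ₜ[ℂ] m)

theorem Induced.mk_mul_incl (d : QuantumDouble G) (z : BoundaryAlgebra K) (m : M) :
    Induced.mk K (d * incl K z) m = Induced.mk K d (z • m) := by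
  rw [Induced.mk, Induced.mk, ← sub_eq_zero, ← map_sub, Submodule.mkQ_apply,
    Submodule.Quotient.mk_eq_zero]
  exact Submodule.subset_span ⟨d, z, m, rfl⟩

variable {N : Type*} [AddCommGroup N] [Module ℂ N] [Module (QuantumDouble G) N]
  [IsScalarTower ℂ (QuantumDouble G) N] [SMulCommClass (QuantumDouble G) ℂ N]

omit [SMulCommClass (QuantumDouble G) ℂ N] in
theorem Induced.hom_ext {F F' : Induced K M →ₗ[QuantumDouble G] N}
    (h : ∀ m, F (Induced.mk K 1 m) = F' (Induced.mk K 1 m)) : F = F' := by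
  refine Submodule.linearMap_qext _ (TensorProduct.AlgebraTensorModule.curry_injective ?_)
  ext m
  exact h m

variable [IsScalarTower ℂ (BoundaryAlgebra K) M]

/-- The universal property of the induced module. -/
def inducedHomEquiv :
    (Induced K M →ₗ[QuantumDouble G] N) ≃ₗ[ℂ] (M →ₛₗ[(incl K).toRingHom] N) where
  toFun F :=
    { toFun := fun m => F (Induced.mk K 1 m)
      map_add' := fun m n => by
        rw [Induced.mk, TensorProduct.tmul_add, map_add, map_add]
        rfl
      map_smul' := fun z m => by
        rw [← Induced.mk_mul_incl, one_mul]
        change _ = incl K z • F _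
        rw [← map_smul]
        congr 1
        rw [Induced.mk, Induced.mk, ← map_smul, TensorProduct.smul_tmul', smul_eq_mul, mul_one] }
  map_add' _ _ := rfl
  map_smul' _ _ := rfl
  invFun ψ := (inducedRel K M).liftQ
    (TensorProduct.AlgebraTensorModule.lift
      { toFun := fun d =>
          { toFun := fun m => d • ψ m
            map_add' := fun m n => by rw [map_add, smul_add]
            map_smul' := fun c m => by
              rw [semilinear_map_smul, smul_comm, RingHom.id_apply] }
        map_add' := fun d e => LinearMap.ext fun m => add_smul _ _ _
        map_smul' := fun d e => LinearMap.ext fun m => mul_smul _ _ _ })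
    (by
      rw [Submodule.span_le]
      rintro _ ⟨d, z, m, rfl⟩
      change _ = _
      rw [map_sub, sub_eq_zero]
      change (d * incl K z) • ψ m = d • ψ (z • m)
      rw [map_smulₛₗ, mul_smul]
      rfl)
  left_inv F := Induced.hom_ext fun m => one_smul _ _
  right_inv ψ := LinearMap.ext fun m => one_smul _ _

/-- The coordinates of `d ⊗ m` with respect to `rightBasis`. -/
def rightCoordTensor : QuantumDouble G ⊗[ℂ] M →ₗ[ℂ] ((G ⧸ K) × K → M) :=
  TensorProduct.lift
    { toFun := fun d =>
        { toFun := fun m i => rightCoord i d • m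
          map_add' := fun m n => funext fun i => smul_add _ _ _
          map_smul' := fun c m => funext fun i => by
            have := IsScalarTower.to_smulCommClass (R := ℂ) (A := BoundaryAlgebra K) (M := M)
            exact smul_comm _ _ _ }
      map_add' := fun d e => LinearMap.ext fun m => funext fun i => by
        change rightCoord i (d + e) • m = rightCoord i d • m + rightCoord i e • m
        rw [map_add, add_smul]
      map_smul' := fun c d => LinearMap.ext fun m => funext fun i => by
        change rightCoord i (c • d) • m = c • rightCoord i d • m
        rw [map_smul, smul_assoc] }

theorem rightCoordTensor_tmul (d : QuantumDouble G) (m : M) (i : (G ⧸ K) × K) :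
    rightCoordTensor (d ⊗ₜ[ℂ] m) i = rightCoord i d • m := rfl

theorem rightCoordTensor_eq_zero {t : QuantumDouble G ⊗[ℂ] M} (ht : t ∈ inducedRel K M) :
    rightCoordTensor (K := K) t = 0 := by
  -- The relations span over D(G) while the coordinates are only complex linear, so the claim is
  -- strengthened to all multiples of t before inducting.
  suffices h : ∀ d : QuantumDouble G, rightCoordTensor (K := K) (d • t) = 0 by
    simpa using h 1
  induction ht using Submodule.span_induction with
  | mem t ht =>
    obtain ⟨e, z, m, rfl⟩ := ht
    intro d
    rw [smul_sub, TensorProduct.smul_tmul', TensorProduct.smul_tmul', map_sub, sub_eq_zero]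
    funext i
    rw [rightCoordTensor_tmul, rightCoordTensor_tmul, smul_eq_mul, smul_eq_mul, ← mul_assoc,
      rightCoord_mul_incl, mul_smul]
  | zero => intro d; rw [smul_zero, map_zero]
  | add s t _ _ hs ht => intro d; rw [smul_add, map_add, hs, ht, add_zero]
  | smul e t _ ht => intro d; rw [← mul_smul, ht]

omit [IsScalarTower ℂ (BoundaryAlgebra K) M] in
theorem Induced.induction {p : Induced K M → Prop} (hmk : ∀ d m, p (Induced.mk K d m))
    (hadd : ∀ t u, p t → p u → p (t + u)) (t : Induced K M) : p t := by
  obtain ⟨t, rfl⟩ := (inducedRel K M).mkQ_surjective t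
  induction t using TensorProduct.induction_on with
  | zero => simpa [Induced.mk] using hmk 0 0
  | tmul d m => exact hmk d m
  | add t u ht hu => rw [map_add]; exact hadd _ _ ht hu

variable (K M) in
/-- The coordinates of an element of the induced module. -/
def inducedCoord : Induced K M →ₗ[ℂ] ((G ⧸ K) × K → M) :=
  ((inducedRel K M).restrictScalars ℂ).liftQ rightCoordTensor
    fun _ ht => rightCoordTensor_eq_zero ht

theorem inducedCoord_mk (d : QuantumDouble G) (m : M) (i : (G ⧸ K) × K) :
    inducedCoord K M (Induced.mk K d m) i = rightCoord i d • m := rfl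

variable (K M) in
/-- The element of the induced module with given coordinates. -/
def inducedOfCoord [Fintype ((G ⧸ K) × K)] : ((G ⧸ K) × K → M) →ₗ[ℂ] Induced K M where
  toFun f := ∑ i, Induced.mk K (rightBasis i) (f i)
  map_add' f g := by
    simp only [Induced.mk, Pi.add_apply, TensorProduct.tmul_add, map_add,
      Finset.sum_add_distrib]
  map_smul' c f := by
    simp only [Induced.mk, Pi.smul_apply, TensorProduct.tmul_smul, RingHom.id_apply,
      Finset.smul_sum]
    rfl

theorem inducedCoord_inducedOfCoord [Fintype ((G ⧸ K) × K)] (f : (G ⧸ K) × K → M) :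
    inducedCoord K M (inducedOfCoord K M f) = f := by
  classical
  funext j
  change inducedCoord K M (∑ i, Induced.mk K (rightBasis i) (f i)) j = f j
  rw [map_sum, Finset.sum_apply, Finset.sum_eq_single j]
  · rw [inducedCoord_mk, rightCoord_rightBasis, if_pos rfl, one_smul]
  · intro i _ hi
    rw [inducedCoord_mk, rightCoord_rightBasis, if_neg hi.symm, zero_smul]
  · simp

omit [IsScalarTower ℂ (BoundaryAlgebra K) M] in
theorem Induced.mk_sum {ι : Type*} (s : Finset ι) (d : ι → QuantumDouble G) (m : M) :
    Induced.mk K (∑ i ∈ s, d i) m = ∑ i ∈ s, Induced.mk K (d i) m := by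
  simp only [Induced.mk, TensorProduct.sum_tmul, map_sum]

theorem inducedOfCoord_inducedCoord [Fintype ((G ⧸ K) × K)] (t : Induced K M) :
    inducedOfCoord K M (inducedCoord K M t) = t := by
  induction t using Induced.induction with
  | hmk d m =>
    change ∑ i, Induced.mk K (rightBasis i) (inducedCoord K M (Induced.mk K d m) i) = _
    simp only [inducedCoord_mk, ← Induced.mk_mul_incl]
    rw [← Induced.mk_sum, sum_rightBasis_mul_incl]
  | hadd t u ht hu => rw [map_add, map_add, ht, hu]

variable (K M) in
/-- The induced module as a vector space. -/
def inducedEquiv : Induced K M ≃ₗ[ℂ] ((G ⧸ K) × K → M) :=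
  letI := Fintype.ofFinite ((G ⧸ K) × K)
  { inducedCoord K M with
    invFun := inducedOfCoord K M
    left_inv := inducedOfCoord_inducedCoord
    right_inv := inducedCoord_inducedOfCoord }

instance [Module.Finite ℂ M] : Module.Finite ℂ (Induced K M) :=
  Module.Finite.equiv (inducedEquiv K M).symm

/-- The rank of D(G) over Z is |G/K| · |K| = |G|. -/
theorem finrank_induced [Module.Finite ℂ M] :
    Module.finrank ℂ (Induced K M) = Nat.card G * Module.finrank ℂ M := by
  let _ := Fintype.ofFinite (G ⧸ K)
  let _ := Fintype.ofFinite K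
  rw [(inducedEquiv K M).finrank_eq, Module.finrank_pi_fintype, Finset.sum_const, smul_eq_mul,
    Finset.card_univ, Fintype.card_prod, K.card_eq_card_quotient_mul_card_subgroup,
    Nat.card_eq_fintype_card, Nat.card_eq_fintype_card]

end Induced

/-! ### Condensation multiplicities -/

section Mackey

open ActionAlgebra StabModule

variable {G : Type u} [Group G] [Finite G] {K : Subgroup G} {β : BulkChoice G}
  {a : BulkAnyon β} {b : BoundaryAnyon K}

omit [Finite G] in
theorem aligned_iff (y : G) : Aligned a b y ↔
    QuotientGroup.mk (s := K) (y * a.pt * y⁻¹) = QuotientGroup.mk (s := K) b.r := by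
  rw [eq_comm, QuotientGroup.eq]
  rfl

omit [Finite G] in
theorem Aligned.mul {y : G} (hy : Aligned a b y) {k e : G} (hk : k ∈ stab K b.r)
    (he : e ∈ centralizerOf a.pt) : Aligned a b (k * y * e) := by
  have h1 : e * a.pt * e⁻¹ = a.pt :=
    mul_inv_eq_iff_eq_mul.mpr (Subgroup.mem_centralizer_singleton_iff.mp he)
  have h2 : b.r⁻¹ * (k * y * e * a.pt * (k * y * e)⁻¹) =
      (b.r⁻¹ * k * b.r) * (b.r⁻¹ * (y * a.pt * y⁻¹)) * k⁻¹ := by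
    conv_rhs => rw [← h1]
    group
  rw [Aligned, h2]
  exact K.mul_mem (K.mul_mem (mem_conjSubgroup.mp hk.2) hy) (K.inv_mem hk.1)

omit [Finite G] in
-- Together with `Aligned.mul` this shows that the aligned elements of a double coset K x E(C) with
-- x aligned form exactly K^r x E(C).
theorem Aligned.mem_stab {y k : G} (hy : Aligned a b y) (hk : k ∈ K)
    (hky : Aligned a b (k * y)) : k ∈ stab K b.r := by
  refine ⟨hk, mem_conjSubgroup.mpr ?_⟩
  have : b.r⁻¹ * k * b.r = (b.r⁻¹ * (k * y * a.pt * (k * y)⁻¹)) * k *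
      (b.r⁻¹ * (y * a.pt * y⁻¹))⁻¹ := by group
  rw [this]
  exact K.mul_mem (K.mul_mem hky hk) (K.inv_mem hy)

omit [Finite G] in
theorem Aligned.mem_T {y k e : G} (hy : Aligned a b y) (hk : k ∈ K)
    (he : e ∈ centralizerOf a.pt) : (k * y * e) * a.pt * (k * y * e)⁻¹ ∈ b.T := by
  have h1 : e * a.pt * e⁻¹ = a.pt :=
    mul_inv_eq_iff_eq_mul.mpr (Subgroup.mem_centralizer_singleton_iff.mp he)
  refine DoubleCoset.mem_doubleCoset.mpr ⟨k, hk, b.r⁻¹ * (y * a.pt * y⁻¹) * k⁻¹,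
    K.mul_mem hy (K.inv_mem hk), ?_⟩
  conv_rhs => rw [← h1]
  group

open Classical in
theorem incl_single_smul_val (k : K) (f : a.Mod) (y : G) :
    (incl K (single _ (b.r : G ⧸ K) k) • f).val y =
      if Aligned a b y then f.val ((k : G)⁻¹ * y) else 0 := by
  let _ := Fintype.ofFinite G
  rw [val_smul, Finset.sum_eq_single (k : G)]
  · rw [incl_coeff_of_mem _ _ k.2, coeff_single]
    by_cases hy : Aligned a b y
    · rw [if_pos hy, if_pos ⟨(aligned_iff y).mp hy, rfl⟩, one_smul]
    · rw [if_neg hy, if_neg fun h => hy ((aligned_iff y).mpr h.1), zero_smul]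
  · intro l _ hl
    by_cases hlK : l ∈ K
    · rw [incl_coeff_of_mem _ _ hlK, coeff_single, if_neg, zero_smul]
      rintro ⟨-, h⟩
      exact hl (congrArg Subtype.val h)
    · rw [incl_coeff_of_notMem _ _ hlK, zero_smul]
  · simp

variable (X : DoubleCosetReps a b)

/-- The double cosets which contribute to the condensation. -/
abbrev DoubleCosetReps.Index : Type u := {d // X.x d * a.pt * (X.x d)⁻¹ ∈ b.T}

omit [Finite G] in
theorem DoubleCosetReps.exists_eq {y : G} (hy : Aligned a b y) :
    ∃ (d : X.Index) (k : stab K b.r) (e : centralizerOf a.pt), y = k * X.x d.1 * e := by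
  obtain ⟨k, hk, e, he, h⟩ := (DoubleCoset.eq K (centralizerOf a.pt) _ _).mp
    (X.mk_x (DoubleCoset.mk K (centralizerOf a.pt) y)).symm
  set x := X.x (DoubleCoset.mk K (centralizerOf a.pt) y) with hx
  have hT : x * a.pt * x⁻¹ ∈ b.T := by
    rw [h]
    exact hy.mem_T hk he
  have hal : Aligned a b x := X.aligned _ hT
  have hk' : k ∈ stab K b.r := by
    refine hy.mem_stab hk ?_
    have : k * y = 1 * x * e⁻¹ := by rw [h]; group
    rw [this]
    exact hal.mul (stab K b.r).one_mem ((centralizerOf a.pt).inv_mem he)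
  refine ⟨⟨_, hT⟩, ⟨k⁻¹, (stab K b.r).inv_mem hk'⟩, ⟨e⁻¹, (centralizerOf a.pt).inv_mem he⟩, ?_⟩
  change y = k⁻¹ * x * e⁻¹
  rw [h]
  group

omit [Finite G] in
theorem DoubleCosetReps.index_eq {d d' : X.Index} {k k' e e' : G} (hk : k ∈ K) (hk' : k' ∈ K)
    (he : e ∈ centralizerOf a.pt) (he' : e' ∈ centralizerOf a.pt)
    (h : k * X.x d.1 * e = k' * X.x d'.1 * e') : d = d' := by
  refine Subtype.ext ?_
  rw [← X.mk_x d.1, ← X.mk_x d'.1]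
  refine (DoubleCoset.eq K (centralizerOf a.pt) _ _).mpr ⟨k'⁻¹ * k, K.mul_mem (K.inv_mem hk') hk,
    e * e'⁻¹, Subgroup.mul_mem _ he (Subgroup.inv_mem _ he'), ?_⟩
  have : k'⁻¹ * k * X.x d.1 * (e * e'⁻¹) = k'⁻¹ * (k * X.x d.1 * e) * e'⁻¹ := by group
  rw [this, h]
  group

/-- The spaces of intertwiners at the double cosets. -/
abbrev DoubleCosetReps.Local (d : X.Index) : Type _ :=
  Representation.IntertwiningMap (boundaryRes b a.1 (X.x d.1)) (twistRes a b.r (X.x d.1))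

variable {X} in
open Classical in
/-- The equivariant function on `G` with given values at the representatives. -/
def equivariantFun (w : ∀ d, X.Local d) (y : G) :
    (Fin b.irrep.dim → ℂ) →ₗ[ℂ] (Fin a.irrep.dim → ℂ) :=
  if h : ∃ q : X.Index × stab K b.r × centralizerOf a.pt, y = q.2.1 * X.x q.1.1 * q.2.2 then
    (a.irrep.rep h.choose.2.2⁻¹).comp
      ((w h.choose.1).toLinearMap.comp (b.irrep.rep h.choose.2.1⁻¹))
  else 0

omit [Finite G] in
-- Two factorizations of one group element differ by s = k⁻¹k' with x⁻¹sx = e e'⁻¹. This s lies in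
-- xE(C)x⁻¹ ∩ K^r, and f intertwines its two actions, so `equivariantFun` does not depend on the
-- factorization chosen.
theorem local_eq (d : X.Index) (f : X.Local d) {k k' : stab K b.r} {e e' : centralizerOf a.pt}
    (h : (k : G) * X.x d.1 * e = k' * X.x d.1 * e') :
    (a.irrep.rep e⁻¹).comp (f.toLinearMap.comp (b.irrep.rep k⁻¹)) =
      (a.irrep.rep e'⁻¹).comp (f.toLinearMap.comp (b.irrep.rep k'⁻¹)) := by
  have h1 : (X.x d.1)⁻¹ * ((k : G)⁻¹ * k') * X.x d.1 = e * (e' : G)⁻¹ := by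
    have : (X.x d.1)⁻¹ * ((k : G)⁻¹ * k') * X.x d.1 =
      (X.x d.1)⁻¹ * (k : G)⁻¹ * (k' * X.x d.1 * e') * (e' : G)⁻¹ := by group
    rw [this, ← h]
    group
  let s : interStab β K a.1 b.r (X.x d.1) := ⟨(k⁻¹ * k' : stab K b.r),
    mem_conjSubgroup.mpr (by
      change (X.x d.1)⁻¹ * ((k : G)⁻¹ * k') * X.x d.1 ∈ _
      rw [h1]
      exact (e * e'⁻¹).2), (k⁻¹ * k').2⟩
  have h2 : ∀ v, f (b.irrep.rep (k⁻¹ * k') v) = a.irrep.rep (e * e'⁻¹) (f v) := by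
    intro v
    have h3 := LinearMap.congr_fun (f.isIntertwining' s) v
    have h4 : twistRes a b.r (X.x d.1) s = a.irrep.rep (e * e'⁻¹) := by
      change a.irrep.rep _ = _
      congr 1
      exact Subtype.ext h1
    rw [h4] at h3
    exact h3
  refine LinearMap.ext fun v => ?_
  change a.irrep.rep e⁻¹ (f (b.irrep.rep k⁻¹ v)) = a.irrep.rep e'⁻¹ (f (b.irrep.rep k'⁻¹ v))
  have h5 : b.irrep.rep k⁻¹ v = b.irrep.rep (k⁻¹ * k') (b.irrep.rep k'⁻¹ v) := by
    rw [← Module.End.mul_apply, ← map_mul, mul_inv_cancel_right]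
  rw [h5, h2, ← Module.End.mul_apply, ← map_mul, inv_mul_cancel_left]

omit [Finite G] in
theorem equivariantFun_apply (w : ∀ d, X.Local d) (d : X.Index) (k : stab K b.r)
    (e : centralizerOf a.pt) : equivariantFun w (k * X.x d.1 * e) =
      (a.irrep.rep e⁻¹).comp ((w d).toLinearMap.comp (b.irrep.rep k⁻¹)) := by
  have h : ∃ q : X.Index × stab K b.r × centralizerOf a.pt,
      (k * X.x d.1 * e : G) = q.2.1 * X.x q.1.1 * q.2.2 := ⟨⟨d, k, e⟩, rfl⟩
  rw [equivariantFun, dif_pos h]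
  have h3 := h.choose_spec
  generalize h.choose = q at h3 ⊢
  obtain ⟨d', k', e'⟩ := q
  obtain rfl : d = d' := X.index_eq k.2.1 k'.2.1 e.2 e'.2 h3
  exact (local_eq X d (w d) h3).symm

omit [Finite G] in
theorem equivariantFun_of_not_aligned (w : ∀ d, X.Local d) {y : G} (hy : ¬ Aligned a b y) :
    equivariantFun w y = 0 := by
  rw [equivariantFun, dif_neg]
  rintro ⟨⟨d, k, e⟩, rfl⟩
  exact hy ((X.aligned _ d.2).mul k.2 e.2)

omit [Finite G] in
theorem equivariantFun_mul (w : ∀ d, X.Local d) (y : G) (k : stab K b.r)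
    (e : centralizerOf a.pt) : equivariantFun w (k * y * e) =
      (a.irrep.rep e⁻¹).comp ((equivariantFun w y).comp (b.irrep.rep k⁻¹)) := by
  by_cases hy : Aligned a b y
  · obtain ⟨d, k', e', rfl⟩ := X.exists_eq hy
    have : (k : G) * (k' * X.x d.1 * e') * e = (k * k' : stab K b.r) * X.x d.1 *
        (e' * e : centralizerOf a.pt) := by
      push_cast
      group
    rw [this, equivariantFun_apply, equivariantFun_apply]
    refine LinearMap.ext fun v => ?_
    simp [map_mul]
  · rw [equivariantFun_of_not_aligned X w hy, equivariantFun_of_not_aligned]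
    · simp
    · intro h
      apply hy
      have : y = ((k⁻¹ : stab K b.r) : G) * (k * y * e) * (e⁻¹ : centralizerOf a.pt) := by
        push_cast
        group
      rw [this]
      exact h.mul (k⁻¹).2 (e⁻¹).2

variable (a b) in
/-- The equivariant maps from `R` to `(C, π)`. -/
abbrev CondensationMaps : Submodule ℂ ((Fin b.irrep.dim → ℂ) →ₗ[ℂ] a.Mod) :=
  EquivariantMaps (b.r : G ⧸ K) (Subgroup.inclusion (inf_le_left : stab K b.r ≤ K))
    b.irrep.rep (incl K) a.Mod

open Classical in
-- Pointwise form of equivariance: ψ becomes a Hom(V_R, V_π)-valued function on G, supported on the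
-- aligned elements and equivariant under left translation by K^r.
theorem CondensationMaps.val_rep (ψ : CondensationMaps a b) (k : stab K b.r)
    (v : Fin b.irrep.dim → ℂ) (y : G) : (ψ.1 (b.irrep.rep k v)).val y =
      if Aligned a b y then (ψ.1 v).val ((k : G)⁻¹ * y) else 0 := by
  rw [← ψ.2, incl_single_smul_val]
  rfl

theorem CondensationMaps.val_of_not_aligned (ψ : CondensationMaps a b)
    (v : Fin b.irrep.dim → ℂ) {y : G} (hy : ¬ Aligned a b y) : (ψ.1 v).val y = 0 := by
  have := CondensationMaps.val_rep ψ 1 v y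
  rwa [map_one, Module.End.one_apply, if_neg hy] at this

omit [Finite G] in
theorem val_mul_centralizer (f : a.Mod) (y : G) (e : centralizerOf a.pt) :
    f.val (y * e) = a.irrep.rep e⁻¹ (f.val y) := val_mul f y e

/-- The intertwiner which an equivariant map gives at a double coset. -/
def CondensationMaps.eval (ψ : CondensationMaps a b) (d : X.Index) : X.Local d where
  toFun v := (ψ.1 v).val (X.x d.1)
  map_add' v w := by simp
  map_smul' c v := by simp
  isIntertwining' s := by
    refine LinearMap.ext fun v => ?_
    have hs := CondensationMaps.val_rep ψ (Subgroup.inclusion inf_le_right s) v (X.x d.1)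
    rw [if_pos (X.aligned _ d.2)] at hs
    let t : centralizerOf a.pt := ⟨(X.x d.1)⁻¹ * (s : G) * X.x d.1, mem_conjSubgroup.mp s.2.1⟩
    have h1 : (s : G)⁻¹ * X.x d.1 = X.x d.1 * (t⁻¹ : centralizerOf a.pt) := by
      simp [t, mul_assoc]
    refine hs.trans ?_
    change (ψ.1 v).val ((s : G)⁻¹ * X.x d.1) = _
    rw [h1, val_mul_centralizer, inv_inv]
    rfl

variable {X} in
/-- The element of `(C, π)` given by an equivariant function. -/
def equivariantVal (w : ∀ d, X.Local d) : (Fin b.irrep.dim → ℂ) →ₗ[ℂ] a.Mod where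
  toFun v := ⟨fun y => equivariantFun w y v, fun y e => by
    have := equivariantFun_mul X w y 1 e
    rw [OneMemClass.coe_one, one_mul] at this
    change equivariantFun w (y * e) v = _
    rw [this]
    simp⟩
  map_add' v v' := ext_val fun y => map_add _ _ _
  map_smul' c v := ext_val fun y => map_smul _ _ _

omit [Finite G] in
theorem equivariantVal_val (w : ∀ d, X.Local d) (v : Fin b.irrep.dim → ℂ) (y : G) :
    (equivariantVal w v).val y = equivariantFun w y v := rfl

/-- The equivariant map with given intertwiners at the double cosets. -/
def CondensationMaps.extend (w : ∀ d, X.Local d) : CondensationMaps a b :=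
  ⟨equivariantVal w, fun s v => by
    classical
    refine ext_val fun y => ?_
    rw [incl_single_smul_val, equivariantVal_val, equivariantVal_val]
    change (if _ then equivariantFun w ((s : G)⁻¹ * y) v else 0) = _
    split_ifs with h
    · have := equivariantFun_mul X w y s⁻¹ 1
      rw [OneMemClass.coe_one, mul_one] at this
      push_cast at this
      rw [this]
      simp
    · rw [equivariantFun_of_not_aligned X w h]
      rfl⟩

/-- Mackey's formula: the equivariant maps from `R` to `(C, π)` are determined by intertwiners at
the double cosets. -/
def mackeyEquiv : CondensationMaps a b ≃ₗ[ℂ] ∀ d, X.Local d where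
  toFun ψ := CondensationMaps.eval X ψ
  map_add' _ _ := rfl
  map_smul' _ _ := rfl
  invFun w := CondensationMaps.extend X w
  left_inv ψ := by
    refine Subtype.ext (LinearMap.ext fun v => ext_val fun y => ?_)
    change equivariantFun _ y v = _
    by_cases hy : Aligned a b y
    · obtain ⟨d, k, e, rfl⟩ := X.exists_eq hy
      rw [equivariantFun_apply]
      change a.irrep.rep e⁻¹ ((ψ.1 (b.irrep.rep k⁻¹ v)).val (X.x d.1)) = _
      rw [CondensationMaps.val_rep, if_pos (X.aligned _ d.2), val_mul_centralizer]
      simp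
    · rw [equivariantFun_of_not_aligned X _ hy, CondensationMaps.val_of_not_aligned ψ v hy]
      rfl
  right_inv w := by
    funext d
    refine Representation.IntertwiningMap.ext (LinearMap.ext fun v => ?_)
    change equivariantFun w (X.x d.1) v = w d v
    have := equivariantFun_apply X w d 1 1
    rw [OneMemClass.coe_one, OneMemClass.coe_one, one_mul, mul_one] at this
    rw [this]
    simp

/-- Frobenius reciprocity along `incl` and Mackey's formula reduce the count to intertwiners at the
contributing double cosets, which are then counted by common irreducible constituents. -/
theorem condensationMult_eq_condensationSum : condensationMult a b = condensationSum X := by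
  classical
  have : Finite (DoubleCoset.Quotient (K : Set G) (centralizerOf a.pt : Set G)) :=
    Finite.of_surjective _ Quotient.mk_surjective
  let _ := Fintype.ofFinite (DoubleCoset.Quotient (K : Set G) (centralizerOf a.pt : Set G))
  let _ := Fintype.ofFinite X.Index
  rw [condensationMult, condensationSum,
    ((homEquiv (incl K) (Subgroup.inclusion_injective _)).trans (mackeyEquiv X)).finrank_eq,
    Module.finrank_pi_fintype, finsum_eq_sum_of_fintype, ← Finset.sum_filter,
    Finset.sum_subtype (p := fun d => X.x d * a.pt * (X.x d)⁻¹ ∈ b.T) _ (fun d => by simp)]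
  exact Finset.sum_congr rfl fun d _ => finrank_intertwiningMap_eq_sum _ _

end Mackey

/-! ### Inverse condensation -/

section InverseCondensation

variable {G : Type u} [Group G] [Finite G] {K : Subgroup G} {β : BulkChoice G}

theorem exists_linearEquiv_submodule {V : Type*} [AddCommGroup V] [Module ℂ V]
    [Module (QuantumDouble G) V] [IsScalarTower ℂ (QuantumDouble G) V]
    [SMulCommClass (QuantumDouble G) ℂ V] [Module.Finite ℂ V]
    (S : Submodule (QuantumDouble G) V) (hS : IsSimpleModule (QuantumDouble G) S) :
    ∃ a : BulkAnyon β, Nonempty (a.Mod ≃ₗ[QuantumDouble G] S) := by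
  have : Module.Finite ℂ S := finite_submodule S
  exact BulkAnyon.exists_linearEquiv S

theorem inverseMult_eq_condensationMult (b : BoundaryAnyon K) (a : BulkAnyon β) :
    inverseMult b a = condensationMult a b := by
  let _ := Fintype.ofFinite (BulkAnyon β)
  rw [inverseMult, ← finrank_hom_comm (k := ℂ) (M := fun a : BulkAnyon β => a.Mod)
    (V := Induced K b.Mod) BulkAnyon.eq_of_linearEquiv exists_linearEquiv_submodule,
    condensationMult, inducedHomEquiv.finrank_eq]

/-- The decomposition of the induced module into bulk excitations. -/
def inducedDecomposition (b : BoundaryAnyon K) : Induced K b.Mod ≃ₗ[QuantumDouble G]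
    ⨁ a : BulkAnyon β, (Fin (inverseMult b a) → a.Mod) :=
  isotypicEquiv (k := ℂ) (M := fun a : BulkAnyon β => a.Mod) BulkAnyon.eq_of_linearEquiv
    exists_linearEquiv_submodule

theorem sum_inverseMult_mul_FPdim (b : BoundaryAnyon K) :
    ∑ᶠ a : BulkAnyon β, (inverseMult b a : ℚ) * a.FPdim = Nat.card G * b.FPdim := by
  let _ := Fintype.ofFinite (BulkAnyon β)
  have h := finrank_eq_sum_isotypic (k := ℂ) (M := fun a : BulkAnyon β => a.Mod)
    (V := Induced K b.Mod) BulkAnyon.eq_of_linearEquiv exists_linearEquiv_submodule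
  rw [finrank_induced] at h
  rw [b.FPdim_eq, finsum_eq_sum_of_fintype, ← Nat.cast_mul, h, Nat.cast_sum]
  refine Finset.sum_congr rfl fun a _ => ?_
  rw [a.FPdim_eq, inverseMult, Nat.cast_mul]

end InverseCondensation

/-! ### Ribbon operators -/

section Ribbon

open ActionAlgebra

variable {G : Type u} [Group G] [Finite G] {β : BulkChoice G} {K : Subgroup G}
  {M : Type*} [AddCommGroup M] [Module ℂ M] {N : Type*} [AddCommGroup N] [Module ℂ N]

theorem bulkFourier_eq (F : G → G → M) (a : BulkAnyon β) (u v : a.Loc)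
    [Fintype (centralizerOf a.pt)] : bulkFourier F a u v =
      ((a.irrep.dim : ℂ) / Nat.card (centralizerOf a.pt)) •
        ∑ k : centralizerOf a.pt, a.irrep.mat k⁻¹ u.2 v.2 •
          F (β.p a.1 u.1 * a.pt * (β.p a.1 u.1)⁻¹)⁻¹ (β.p a.1 u.1 * k * (β.p a.1 v.1)⁻¹) := by
  rw [bulkFourier]
  congr!

theorem boundaryFourier_eq (Y : G ⧸ K → K → M) (b : BoundaryAnyon K) (u v : b.Loc)
    [Fintype (stab K b.r)] : boundaryFourier Y b u v =
      ((b.irrep.dim : ℂ) / Nat.card (stab K b.r)) •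
        ∑ k : stab K b.r, b.irrep.mat k⁻¹ u.2 v.2 •
          Y (((b.q u.1 : G) * b.r * (b.q u.1 : G)⁻¹)⁻¹ : G)
            (b.q u.1 * b.shift k * (b.q v.1)⁻¹) := by
  rw [boundaryFourier]
  congr!

theorem map_bulkFourier (f : M →ₗ[ℂ] N) (F : G → G → M) (a : BulkAnyon β) (u v : a.Loc) :
    f (bulkFourier F a u v) = bulkFourier (fun h g => f (F h g)) a u v := by
  simp only [bulkFourier, map_smul, map_sum]

theorem map_boundaryFourier (f : M →ₗ[ℂ] N) (Y : G ⧸ K → K → M) (b : BoundaryAnyon K)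
    (u v : b.Loc) :
    f (boundaryFourier Y b u v) = boundaryFourier (fun x k => f (Y x k)) b u v := by
  simp only [boundaryFourier, map_smul, map_sum]

/-- The linear map which sends `F^{(h,g)}` to a given family. -/
def ribbonLift (F : G → G → M) : BulkRibbon G →ₗ[ℂ] M :=
  letI := Fintype.ofFinite G
  ∑ h, ∑ g, (LinearMap.applyₗ (single _ h g)).smulRight (F h g)

theorem ribbonLift_ribbonF (F : G → G → M) (h g : G) : ribbonLift F (ribbonF h g) = F h g := by
  classical
  let _ := Fintype.ofFinite G
  have h1 : ∀ h' g', ribbonF h g (single _ h' g') = if h = h' ∧ g = g' then 1 else 0 := by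
    intro h' g'
    exact coeff_single ((MulAut.toPerm (M := G)).comp MulAut.conj) h' h g' g
  simp only [ribbonLift, LinearMap.sum_apply, LinearMap.smulRight_apply, LinearMap.applyₗ_apply_apply,
    h1]
  rw [Finset.sum_eq_single h, Finset.sum_eq_single g]
  · simp
  · intro g' _ hg
    rw [if_neg fun h => hg h.2.symm, zero_smul]
  · simp
  · intro h' _ hh
    exact Finset.sum_eq_zero fun g' _ => by rw [if_neg fun h => hh h.1.symm, zero_smul]
  · simp

theorem ribbonLift_bulkFourier (F : G → G → M) (a : BulkAnyon β) (u v : a.Loc) :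
    ribbonLift F (bulkFourier ribbonF a u v) = bulkFourier F a u v := by
  rw [map_bulkFourier]
  simp only [ribbonLift_ribbonF]

open Classical in
theorem expand_ribbonY [Fintype G] (x : G ⧸ K) (k : K) : expand K (ribbonY x k) =
    (Nat.card K : ℂ)⁻¹ • ∑ j : G, if (j : G ⧸ K) = x then ribbonF j (k : G) else 0 := by
  refine LinearMap.ext fun d => ?_
  change (Nat.card K : ℂ)⁻¹ * _ = _
  rw [LinearMap.smul_apply, smul_eq_mul, LinearMap.sum_apply]
  congr 1
  refine Finset.sum_congr (by congr!) fun j _ => ?_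
  split_ifs <;> rfl

/-- The linear map that realizes bulk operators on a triangle also realizes boundary operators,
through `expand`. Any expansion in the dual of D(G) therefore persists on the triangle. -/
theorem ribbonLift_triangleF_expand (plus : Bool) (x : G ⧸ K) (k : K) :
    ribbonLift (triangleF plus) (expand K (ribbonY x k)) = triangleY plus x k := by
  classical
  let _ := Fintype.ofFinite G
  rw [expand_ribbonY, map_smul, map_sum, triangleY]
  by_cases hk : k = 1
  · subst hk
    rw [if_pos rfl]
    congr 1
    refine Finset.sum_congr (by congr!) fun j _ => ?_
    split_ifs with h
    · rw [ribbonLift_ribbonF, triangleF, if_pos (by simp)]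
    · rw [map_zero]
  · rw [if_neg hk, Finset.sum_eq_zero, smul_zero]
    intro j _
    split_ifs
    · rw [ribbonLift_ribbonF, triangleF, if_neg]
      exact fun h => hk (Subtype.ext h)
    · rw [map_zero]

/-- The element `c_i = p_i r_C p_i⁻¹` of a conjugacy class. -/
abbrev BulkChoice.c (β : BulkChoice G) (C : ConjClasses G) (i : G ⧸ centralizerOf (β.r C)) : G :=
  β.p C i * β.r C * (β.p C i)⁻¹

omit [Finite G] in
theorem BulkChoice.mk_c (C : ConjClasses G) (i : G ⧸ centralizerOf (β.r C)) :
    ConjClasses.mk (β.c C i) = C := by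
  conv_rhs => rw [← β.mk_r C]
  rw [eq_comm, ConjClasses.mk_eq_mk_iff_isConj, isConj_iff]
  exact ⟨_, rfl⟩

omit [Finite G] in
theorem conj_eq_conj_iff {r x y : G} : x * r * x⁻¹ = y * r * y⁻¹ ↔ x⁻¹ * y ∈ centralizerOf r := by
  rw [Subgroup.mem_centralizer_singleton_iff]
  constructor
  · intro h
    have : x⁻¹ * y * r = x⁻¹ * (y * r * y⁻¹) * y := by group
    rw [this, ← h]
    group
  · intro h
    have : y * r * y⁻¹ = x * (x⁻¹ * y * r) * y⁻¹ := by group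
    rw [this, h]
    group

omit [Finite G] in
theorem BulkChoice.c_injective (C : ConjClasses G) : Function.Injective (β.c C) := by
  intro i j h
  rw [← β.mk_p C i, ← β.mk_p C j, QuotientGroup.eq]
  exact conj_eq_conj_iff.mp h

omit [Finite G] in
theorem BulkChoice.exists_c_eq (h : G) : ∃ C i, β.c C i = h := by
  obtain ⟨x, hx⟩ := isConj_iff.mp (ConjClasses.mk_eq_mk_iff_isConj.mp (β.mk_r (ConjClasses.mk h)))
  refine ⟨ConjClasses.mk h, QuotientGroup.mk x, ?_⟩
  conv_rhs => rw [← hx]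
  exact (conj_eq_conj_iff.mpr (QuotientGroup.eq.mp (β.mk_p _ (QuotientGroup.mk x)).symm)).symm

omit [Finite G] in
theorem BulkChoice.exists_eq_mul (C : ConjClasses G) (i : G ⧸ centralizerOf (β.r C)) (g : G) :
    ∃ (j : G ⧸ centralizerOf (β.r C)) (k : centralizerOf (β.r C)),
      g = β.p C i * k * (β.p C j)⁻¹ := by
  have h := QuotientGroup.eq.mp
    (β.mk_p C (QuotientGroup.mk (g⁻¹ * β.p C i))).symm
  refine ⟨QuotientGroup.mk (g⁻¹ * β.p C i), ⟨_, h⟩, ?_⟩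
  group

omit [Finite G] in
theorem BulkChoice.mul_eq_mul {C : ConjClasses G} {i j j' : G ⧸ centralizerOf (β.r C)}
    {k k' : centralizerOf (β.r C)}
    (h : β.p C i * k * (β.p C j)⁻¹ = β.p C i * k' * (β.p C j')⁻¹) : j = j' ∧ k = k' := by
  have h1 : (k : G) * (β.p C j)⁻¹ = k' * (β.p C j')⁻¹ := by
    rw [mul_assoc, mul_assoc] at h
    exact mul_left_cancel h
  have hj : j = j' := by
    rw [← β.mk_p C j, ← β.mk_p C j', QuotientGroup.eq]
    have : (β.p C j)⁻¹ * β.p C j' = ((k⁻¹ * k' : centralizerOf (β.r C)) : G) := by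
      push_cast
      rw [eq_inv_mul_iff_mul_eq, ← mul_assoc, h1]
      group
    rw [this]
    exact (k⁻¹ * k').2
  subst hj
  exact ⟨rfl, Subtype.ext (mul_right_cancel h1)⟩

/-- The family in `D(G)` dual to the operators `F^{(C,π);(u,v)}`. -/
def dualElt (t : RibbonIndex β) : QuantumDouble G :=
  letI := Fintype.ofFinite (centralizerOf t.1.pt)
  ∑ k : centralizerOf t.1.pt, t.1.irrep.mat k t.2.2.2 t.2.1.2 •
    single _ (β.c t.1.1 t.2.1.1)⁻¹ (β.p t.1.1 t.2.1.1 * k * (β.p t.1.1 t.2.2.1)⁻¹)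

open Classical in
theorem dualElt_coeff (t : RibbonIndex β) [Fintype (centralizerOf t.1.pt)] (h g : G) :
    (dualElt t).coeff h g = ∑ k : centralizerOf t.1.pt, t.1.irrep.mat k t.2.2.2 t.2.1.2 *
      if h = (β.c t.1.1 t.2.1.1)⁻¹ ∧ g = β.p t.1.1 t.2.1.1 * k * (β.p t.1.1 t.2.2.1)⁻¹
        then 1 else 0 := by
  rw [dualElt, coeff_sum]
  refine Finset.sum_congr (by congr!) fun k _ => ?_
  rw [coeff_smul, coeff_single]

theorem dualElt_coeff_of_ne (t : RibbonIndex β) {C : ConjClasses G} (hC : C ≠ t.1.1)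
    (i : G ⧸ centralizerOf (β.r C)) (g : G) : (dualElt t).coeff (β.c C i)⁻¹ g = 0 := by
  classical
  let _ := Fintype.ofFinite (centralizerOf t.1.pt)
  rw [dualElt_coeff]
  refine Finset.sum_eq_zero fun k _ => ?_
  rw [if_neg, mul_zero]
  rintro ⟨h, -⟩
  exact hC (by rw [← β.mk_c C i, inv_injective h, β.mk_c])

open Classical in
theorem dualElt_coeff_same (C : ConjClasses G) (π : Irr (centralizerOf (β.r C)))
    (u v : BulkAnyon.Loc (β := β) ⟨C, π⟩) (i j : G ⧸ centralizerOf (β.r C))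
    (k : centralizerOf (β.r C)) :
    (dualElt ⟨⟨C, π⟩, u, v⟩).coeff (β.c C i)⁻¹ (β.p C i * k * (β.p C j)⁻¹) =
      if i = u.1 ∧ j = v.1 then (β.irrep C π).mat k v.2 u.2 else 0 := by
  let _ := Fintype.ofFinite (centralizerOf (β.r C))
  rw [dualElt_coeff (t := ⟨⟨C, π⟩, u, v⟩)]
  split_ifs with h
  · obtain ⟨rfl, rfl⟩ := h
    rw [Finset.sum_eq_single k]
    · rw [if_pos ⟨rfl, rfl⟩, mul_one]
    · intro k' _ hk
      rw [if_neg, mul_zero]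
      rintro ⟨-, h⟩
      exact hk (BulkChoice.mul_eq_mul h).2.symm
    · simp
  · refine Finset.sum_eq_zero fun k' _ => ?_
    rw [if_neg, mul_zero]
    rintro ⟨h1, h2⟩
    obtain rfl := β.c_injective C (inv_injective h1)
    exact h ⟨rfl, (BulkChoice.mul_eq_mul h2).1⟩

open Classical in
-- Each pair (h,g) is uniquely (c_i⁻¹, p_i k p_j⁻¹), so the pairing vanishes unless class and cosets
-- agree. What remains is Schur orthogonality on E(C), and the prefactor dim π/|E(C)| normalizes it
-- to 1.
theorem bulkFamily_dualElt (s t : RibbonIndex β) :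
    bulkFamily β ribbonF s (dualElt t) = if s = t then 1 else 0 := by
  obtain ⟨⟨C, π⟩, u, v⟩ := s
  let _ := Fintype.ofFinite (centralizerOf (β.r C))
  have h1 : bulkFamily β ribbonF ⟨⟨C, π⟩, u, v⟩ (dualElt t) =
      (((β.irrep C π).dim : ℂ) / Nat.card (centralizerOf (β.r C))) *
        ∑ k : centralizerOf (β.r C), (β.irrep C π).mat k⁻¹ u.2 v.2 *
          (dualElt t).coeff (β.c C u.1)⁻¹ (β.p C u.1 * k * (β.p C v.1)⁻¹) := by
    rw [bulkFamily, bulkFourier_eq, LinearMap.smul_apply, LinearMap.sum_apply]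
    rfl
  rw [h1]
  obtain ⟨⟨C', π'⟩, u', v'⟩ := t
  by_cases hC : C = C'
  · subst hC
    simp only [dualElt_coeff_same]
    by_cases hi : u.1 = u'.1 ∧ v.1 = v'.1
    · simp only [hi, and_self, if_true]
      by_cases hπ : π = π'
      · subst hπ
        simp only [mul_comm ((β.irrep C π).mat _ u.2 v.2)]
        rw [sum_mat_mul_mat_inv]
        by_cases hj : v'.2 = v.2 ∧ u'.2 = u.2
        · rw [if_pos hj, if_pos, ← Nat.card_eq_fintype_card, div_mul_div_cancel₀', div_self]
          · exact Nat.cast_ne_zero.mpr Nat.card_pos.ne'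
          · exact Nat.cast_ne_zero.mpr (β.irrep C π).dim_pos.ne'
          · rw [Prod.ext hi.1 hj.2.symm, Prod.ext hi.2 hj.1.symm]
        · rw [if_neg hj, if_neg, mul_zero]
          intro h
          obtain ⟨rfl, rfl⟩ : u = u' ∧ v = v' := by simpa using h
          exact hj ⟨rfl, rfl⟩
      · simp only [mul_comm ((β.irrep C π).mat _ u.2 v.2)]
        rw [sum_mat_mul_mat_inv_of_not_equiv fun h => hπ (BulkAnyon.irrep_equiv_iff.mp h).symm,
          mul_zero, if_neg]
        intro h
        injection h with h h'
        injection h with h h''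
        exact hπ h''
    · simp only [hi, if_false, mul_zero, Finset.sum_const_zero]
      rw [if_neg]
      intro h
      injection h with h h'
      injection h with h h''
      subst h''
      obtain ⟨rfl, rfl⟩ : u = u' ∧ v = v' := by simpa using h'
      exact hi ⟨rfl, rfl⟩
  · rw [if_neg]
    · simp only [dualElt_coeff_of_ne ⟨⟨C', π'⟩, u', v'⟩ hC, mul_zero, Finset.sum_const_zero]
    · intro h
      injection h with h
      injection h with h
      exact hC h

theorem linearIndependent_bulkFamily : LinearIndependent ℂ (bulkFamily β (ribbonF (G := G))) := by
  classical
  rw [linearIndependent_iff']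
  intro S c hc t ht
  have h1 := LinearMap.congr_fun hc (dualElt t)
  simpa [LinearMap.sum_apply, bulkFamily_dualElt, ht] using h1

/-- For fixed class and cosets the coefficients of d form a function on E(C) orthogonal to all
matrix coefficients. By the double annihilator this yields that the family spans. -/
theorem eq_zero_of_bulkFamily_eq_zero (d : QuantumDouble G)
    (hd : ∀ t, bulkFamily β ribbonF t d = 0) : d = 0 := by
  refine ext_coeff fun h g => ?_
  obtain ⟨C, i, hi⟩ := β.exists_c_eq h⁻¹
  obtain ⟨j, k, rfl⟩ := β.exists_eq_mul C i g
  let _ := Fintype.ofFinite (centralizerOf (β.r C))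
  have h1 := eq_zero_of_sum_mul_mat_eq_zero (β.irrep C) (BulkAnyon.exists_irrep_equiv C)
    (fun s => d.coeff h (β.p C i * (s⁻¹ : centralizerOf (β.r C)) * (β.p C j)⁻¹)) (by
      intro π m n
      have h2 := hd ⟨⟨C, π⟩, (i, m), (j, n)⟩
      rw [bulkFamily, bulkFourier_eq, LinearMap.smul_apply, LinearMap.sum_apply] at h2
      have h3 := (smul_eq_zero.mp h2).resolve_left (div_ne_zero
        (Nat.cast_ne_zero.mpr (β.irrep C π).dim_pos.ne') (Nat.cast_ne_zero.mpr Nat.card_pos.ne'))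
      rw [← h3]
      refine Fintype.sum_equiv (Equiv.inv _) _ _ fun s => ?_
      change _ = (β.irrep C π).mat (s⁻¹)⁻¹ m n *
        d.coeff (β.c C i)⁻¹ (β.p C i * (s⁻¹ : centralizerOf (β.r C)) * (β.p C j)⁻¹)
      rw [inv_inv, hi, inv_inv, mul_comm])
  have h2 := congrFun h1 k⁻¹
  simpa using h2

theorem span_bulkFamily : Submodule.span ℂ (Set.range (bulkFamily β (ribbonF (G := G)))) = ⊤ := by
  rw [← Subspace.dualCoannihilator_dualAnnihilator_eq
    (W := Submodule.span ℂ (Set.range (bulkFamily β (ribbonF (G := G)))))]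
  have : (Submodule.span ℂ (Set.range (bulkFamily β (ribbonF (G := G))))).dualCoannihilator =
      ⊥ := by
    rw [eq_bot_iff]
    intro d hd
    rw [Submodule.mem_dualCoannihilator] at hd
    exact eq_zero_of_bulkFamily_eq_zero d fun t => hd _ (Submodule.subset_span ⟨t, rfl⟩)
  rw [this, Submodule.dualAnnihilator_bot]

instance : Finite (RibbonIndex β) := inferInstance

/-- The coefficients of a ribbon operator with respect to the operators `F^{(C,π);(u,v)}`. -/
def bulkCoeff (f : BulkRibbon G) : RibbonIndex β →₀ ℂ :=
  Finsupp.equivFunOnFinite.symm fun t => f (dualElt t)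

theorem linearCombination_bulkCoeff (f : BulkRibbon G) :
    Finsupp.linearCombination ℂ (bulkFamily β ribbonF) (bulkCoeff f) = f := by
  classical
  have hf : f ∈ Submodule.span ℂ (Set.range (bulkFamily β (ribbonF (G := G)))) := by
    rw [span_bulkFamily]
    trivial
  obtain ⟨c, rfl⟩ := Finsupp.mem_span_range_iff_exists_finsupp.mp hf
  have : bulkCoeff (β := β) (c.sum fun t z => z • bulkFamily β ribbonF t) = c := by
    ext t
    change (c.sum fun t z => z • bulkFamily β ribbonF t) (dualElt t) = c t
    simp only [Finsupp.sum, LinearMap.sum_apply, LinearMap.smul_apply, bulkFamily_dualElt]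
    simp [eq_comm]
  rw [this]
  rfl

theorem linearCombination_bulkCoeff_triangle (plus : Bool) (b : BoundaryAnyon K) (u v : b.Loc) :
    boundaryFourier (triangleY plus) b u v =
      Finsupp.linearCombination ℂ (bulkFamily β (triangleF plus))
        (bulkCoeff (expand K (boundaryFourier ribbonY b u v))) := by
  have h1 : ribbonLift (triangleF plus) (expand K (boundaryFourier ribbonY b u v)) =
      boundaryFourier (triangleY plus) b u v := by
    rw [map_boundaryFourier]
    refine (map_boundaryFourier (ribbonLift (triangleF plus)) _ b u v).trans ?_
    simp only [ribbonLift_triangleF_expand]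
  rw [← h1]
  conv_lhs => rw [← linearCombination_bulkCoeff (β := β) (expand K _)]
  rw [Finsupp.apply_linearCombination]
  congr 2
  funext t
  exact ribbonLift_bulkFourier (triangleF plus) t.1 t.2.1 t.2.2

end Ribbon

/-! ### Which expansion coefficients vanish -/

section RibbonCoefficients

open ActionAlgebra

variable {G : Type u} [Group G] [Finite G] {β : BulkChoice G} {K : Subgroup G}
  {a : BulkAnyon β} {b : BoundaryAnyon K}

variable (a b) in
open Classical in
/-- The sum of products of matrix coefficients over the pairs `(k, e)` with
`q r⁻¹ k r q'⁻¹ = p e p'⁻¹`. -/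
def pairSum (q q' p p' : G) (i i' : Fin b.irrep.dim) (j j' : Fin a.irrep.dim) : ℂ :=
  letI := Fintype.ofFinite (stab K b.r)
  letI := Fintype.ofFinite (centralizerOf a.pt)
  ∑ k : stab K b.r, ∑ e : centralizerOf a.pt, b.irrep.mat k⁻¹ i i' *
    (a.irrep.mat e j' j * if q * b.shift k * q'⁻¹ = p * e * p'⁻¹ then 1 else 0)

open Classical in
-- The dual element is supported at first argument c_i⁻¹, so the average over a coset of K keeps at
-- most that one term, and only if c_i⁻¹ lies in the coset.
theorem bulkCoeff_boundaryFourier (u v : a.Loc) (w w' : b.Loc) :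
    bulkCoeff (expand K (boundaryFourier ribbonY b w w')) ⟨a, u, v⟩ =
      if (QuotientGroup.mk (s := K) (β.c a.1 u.1)⁻¹) =
          QuotientGroup.mk (s := K) ((b.q w.1 : G) * b.r * (b.q w.1 : G)⁻¹)⁻¹ then
        (b.irrep.dim : ℂ) / Nat.card (stab K b.r) * ((Nat.card K : ℂ)⁻¹ *
          pairSum a b (b.q w.1) (b.q w'.1) (β.p a.1 u.1) (β.p a.1 v.1) w.2 w'.2 u.2 v.2)
      else 0 := by
  let _ := Fintype.ofFinite G
  let _ := Fintype.ofFinite (stab K b.r)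
  let _ := Fintype.ofFinite (centralizerOf a.pt)
  have h1 : ∀ (x : G ⧸ K) (k : K), expand K (ribbonY x k) (dualElt ⟨a, u, v⟩) =
      if QuotientGroup.mk (s := K) (β.c a.1 u.1)⁻¹ = x then (Nat.card K : ℂ)⁻¹ *
        ∑ e : centralizerOf a.pt, a.irrep.mat e v.2 u.2 *
          if (k : G) = β.p a.1 u.1 * e * (β.p a.1 v.1)⁻¹ then 1 else 0 else 0 := by
    intro x k
    rw [expand_ribbonY, LinearMap.smul_apply, smul_eq_mul, LinearMap.sum_apply,
      Finset.sum_eq_single (β.c a.1 u.1)⁻¹]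
    · split_ifs with h
      · congr 1
        exact (dualElt_coeff ⟨a, u, v⟩ _ _).trans (Finset.sum_congr rfl fun e _ => by simp)
      · simp
    · intro j _ hj
      split_ifs with h
      · refine (dualElt_coeff ⟨a, u, v⟩ _ _).trans (Finset.sum_eq_zero fun e _ => ?_)
        rw [if_neg fun h => hj h.1, mul_zero]
      · rfl
    · simp
  change expand K (boundaryFourier ribbonY b w w') (dualElt ⟨a, u, v⟩) = _
  rw [map_boundaryFourier, boundaryFourier_eq, LinearMap.smul_apply, LinearMap.sum_apply,
    smul_eq_mul]
  simp only [LinearMap.smul_apply, h1, smul_eq_mul]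
  split_ifs with h
  · congr 1
    rw [pairSum, Finset.mul_sum]
    refine Finset.sum_congr (by congr!) fun k _ => ?_
    rw [mul_left_comm, ← Finset.mul_sum]
    congr!
  · simp

/-- From one solution (k₀, e₀) all others arise as (s k₀, x⁻¹ s x e₀) with s in xE(C)x⁻¹ ∩ K^r and x
= r q⁻¹ p. Multiplicativity of the matrices splits off k₀ and e₀ and leaves entries of averaged
matrix units. -/
theorem pairSum_eq_sum {q q' p p' : G} {k₀ : stab K b.r} {e₀ : centralizerOf a.pt}
    (h : q * b.shift k₀ * q'⁻¹ = p * e₀ * p'⁻¹) (i i' : Fin b.irrep.dim)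
    (j j' : Fin a.irrep.dim) [Fintype (interStab β K a.1 b.r (b.r * q⁻¹ * p))] :
    pairSum a b q q' p p' i i' j j' = ∑ m, ∑ n, b.irrep.mat k₀⁻¹ i m * a.irrep.mat e₀ n j *
      ∑ s, LinearMap.toMatrix' (twistRes a b.r (b.r * q⁻¹ * p) s) j' n *
        LinearMap.toMatrix' (boundaryRes b a.1 (b.r * q⁻¹ * p) s⁻¹) m i' := by
  classical
  let _ := Fintype.ofFinite (stab K b.r)
  let _ := Fintype.ofFinite (centralizerOf a.pt)
  set x := b.r * q⁻¹ * p with hx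
  have hshift : ∀ k : stab K b.r, (b.shift k : G) = b.r⁻¹ * k * b.r := fun k => rfl
  let f : interStab β K a.1 b.r x → stab K b.r × centralizerOf a.pt := fun s =>
    (Subgroup.inclusion inf_le_right s * k₀,
      ⟨x⁻¹ * (s : G) * x, mem_conjSubgroup.mp s.2.1⟩ * e₀)
  have hf : Function.Injective f := by
    intro s t hst
    have := congrArg (fun y => (y.1 : G)) hst
    exact Subtype.ext (mul_right_cancel this)
  have h0 : b.r⁻¹ * (k₀ : G) * b.r = q⁻¹ * (p * e₀ * p'⁻¹) * q' := by
    rw [← h, hshift]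
    group
  have hf1 : ∀ s, q * b.shift (f s).1 * q'⁻¹ = p * (f s).2 * p'⁻¹ := by
    intro s
    change q * (b.r⁻¹ * ((s : G) * k₀) * b.r) * q'⁻¹ = p * (x⁻¹ * (s : G) * x * e₀) * p'⁻¹
    generalize (s : G) = g
    have : b.r⁻¹ * (g * k₀) * b.r =
      b.r⁻¹ * g * b.r * (b.r⁻¹ * (k₀ : G) * b.r) := by group
    rw [this, h0, hx]
    group
  have hf2 : ∀ y : stab K b.r × centralizerOf a.pt,
      q * b.shift y.1 * q'⁻¹ = p * y.2 * p'⁻¹ → y ∈ Set.range f := by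
    rintro ⟨k, e⟩ hy
    have h2 : b.r⁻¹ * (k : G) * b.r = q⁻¹ * (p * e * p'⁻¹) * q' := by
      rw [← hy, hshift]
      group
    have h3 : x⁻¹ * ((k : G) * (k₀ : G)⁻¹) * x = e * (e₀ : G)⁻¹ := by
      have : x⁻¹ * ((k : G) * (k₀ : G)⁻¹) * x =
        p⁻¹ * q * (b.r⁻¹ * (k : G) * b.r) * (b.r⁻¹ * (k₀ : G) * b.r)⁻¹ * q⁻¹ * p := by
        rw [hx]
        group
      rw [this, h0, h2]
      group
    refine ⟨⟨(k * k₀⁻¹ : stab K b.r), mem_conjSubgroup.mpr ?_, (k * k₀⁻¹).2⟩, ?_⟩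
    · change x⁻¹ * ((k : G) * (k₀ : G)⁻¹) * x ∈ _
      rw [h3]
      exact (e * e₀⁻¹).2
    · refine Prod.ext (Subtype.ext ?_) (Subtype.ext ?_)
      · change (k : G) * (k₀ : G)⁻¹ * k₀ = k
        group
      · change x⁻¹ * ((k : G) * (k₀ : G)⁻¹) * x * e₀ = e
        rw [h3]
        group
  have hsum : pairSum a b q q' p p' i i' j j' =
      ∑ s, b.irrep.mat (f s).1⁻¹ i i' * a.irrep.mat (f s).2 j' j := by
    have h4 : pairSum a b q q' p p' i i' j j' = ∑ y : stab K b.r × centralizerOf a.pt,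
        b.irrep.mat y.1⁻¹ i i' * (a.irrep.mat y.2 j' j *
          if q * b.shift y.1 * q'⁻¹ = p * y.2 * p'⁻¹ then 1 else 0) := by
      rw [pairSum, Fintype.sum_prod_type]
    rw [h4]
    refine (Fintype.sum_of_injective f hf _ _ (fun y hy => ?_) fun s => ?_).symm
    · rw [if_neg fun h => hy (hf2 y h), mul_zero, mul_zero]
    · rw [if_pos (hf1 s), mul_one]
  rw [hsum]
  have h5 : ∀ s, b.irrep.mat (f s).1⁻¹ i i' * a.irrep.mat (f s).2 j' j =
      ∑ m, ∑ n, b.irrep.mat k₀⁻¹ i m * a.irrep.mat e₀ n j *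
        (LinearMap.toMatrix' (twistRes a b.r x s) j' n *
          LinearMap.toMatrix' (boundaryRes b a.1 x s⁻¹) m i') := by
    intro s
    have h6 : b.irrep.mat (f s).1⁻¹ i i' = ∑ m, b.irrep.mat k₀⁻¹ i m *
        LinearMap.toMatrix' (boundaryRes b a.1 x s⁻¹) m i' := by
      change b.irrep.mat (Subgroup.inclusion inf_le_right s * k₀)⁻¹ i i' = _
      rw [mul_inv_rev, MatIrrep.mat_mul, Matrix.mul_apply]
      rfl
    have h7 : a.irrep.mat (f s).2 j' j = ∑ n,
        LinearMap.toMatrix' (twistRes a b.r x s) j' n * a.irrep.mat e₀ n j := by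
      change a.irrep.mat (_ * e₀) j' j = _
      rw [MatIrrep.mat_mul, Matrix.mul_apply]
      rfl
    rw [h6, h7, Finset.sum_mul_sum]
    exact Finset.sum_congr rfl fun m _ => Finset.sum_congr rfl fun n _ => by ring
  simp only [h5, Finset.mul_sum]
  rw [Finset.sum_comm]
  refine Finset.sum_congr rfl fun m _ => ?_
  rw [Finset.sum_comm]
  congr!

theorem finrank_ne_zero_iff_exists (x : G) :
    Module.finrank ℂ (Representation.IntertwiningMap (boundaryRes b a.1 x)
      (twistRes a b.r x)) ≠ 0 ↔ ∃ σ, twistMult a b x σ ≠ 0 ∧ boundaryMult a b x σ ≠ 0 := by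
  rw [finrank_intertwiningMap_eq_sum]
  constructor
  · intro h
    by_contra! h'
    refine h ?_
    rw [finsum_congr fun σ => ?_, finsum_zero]
    by_cases hσ : twistMult a b x σ = 0
    · exact mul_eq_zero_of_right _ hσ
    · exact mul_eq_zero_of_left (h' σ hσ) _
  · rintro ⟨σ, h1, h2⟩ h
    let _ := Fintype.ofFinite (Irr (interStab β K a.1 b.r x))
    rw [finsum_eq_sum_of_fintype, Finset.sum_eq_zero_iff] at h
    exact mul_ne_zero h2 h1 (h σ (Finset.mem_univ σ))

omit [Finite G] in
-- Replacing x by xe leaves the intersection unchanged and alters the twisted representation by the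
-- isomorphism π(e)⁻¹. This is needed because r q⁻¹ p_i can match a given x only up to E(C).
theorem finrank_ne_zero_mul_centralizer {x : G} (e : centralizerOf a.pt)
    (h : Module.finrank ℂ (Representation.IntertwiningMap (boundaryRes b a.1 x)
      (twistRes a b.r x)) ≠ 0) :
    Module.finrank ℂ (Representation.IntertwiningMap (boundaryRes b a.1 (x * e))
      (twistRes a b.r (x * e))) ≠ 0 := by
  rw [Ne, Module.finrank_zero_iff, not_subsingleton_iff_nontrivial] at h ⊢
  obtain ⟨f, hf⟩ := exists_ne (0 : Representation.IntertwiningMap (boundaryRes b a.1 x)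
      (twistRes a b.r x))
  let f' : Representation.IntertwiningMap (boundaryRes b a.1 (x * e)) (twistRes a b.r (x * e)) :=
    { toLinearMap := (a.irrep.rep e⁻¹).comp f.toLinearMap
      isIntertwining' := fun s => by
        have hs : x⁻¹ * (s : G) * x = e * ((x * (e : G))⁻¹ * (s : G) * (x * e)) * (e : G)⁻¹ := by
          group
        let t : centralizerOf a.pt := ⟨(x * (e : G))⁻¹ * (s : G) * (x * e),
          mem_conjSubgroup.mp s.2.1⟩
        let s' : interStab β K a.1 b.r x := ⟨s, mem_conjSubgroup.mpr (by
          rw [hs]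
          exact (e * t * e⁻¹).2), s.2.2⟩
        have h1 : twistRes a b.r x s' = a.irrep.rep (e * t * e⁻¹) := by
          change a.irrep.rep _ = _
          congr 1
          exact Subtype.ext hs
        refine LinearMap.ext fun v => ?_
        have h2 := LinearMap.congr_fun (f.isIntertwining' s') v
        rw [h1] at h2
        change a.irrep.rep e⁻¹ (f (boundaryRes b a.1 x s' v)) = a.irrep.rep t (a.irrep.rep e⁻¹ (f v))
        change f (boundaryRes b a.1 x s' v) = a.irrep.rep (e * t * e⁻¹) (f v) at h2
        rw [h2, ← Module.End.mul_apply, ← Module.End.mul_apply, ← map_mul, ← map_mul]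
        congr 2
        group }
  refine ⟨f', 0, fun h0 => hf (Representation.IntertwiningMap.ext (LinearMap.ext fun v => ?_))⟩
  have h1 : a.irrep.rep e⁻¹ (f v) = 0 :=
    congrArg (fun g : Representation.IntertwiningMap _ _ => g v) h0
  have h2 : f v = a.irrep.rep e (a.irrep.rep e⁻¹ (f v)) := by
    rw [← Module.End.mul_apply, ← map_mul]
    simp
  change f v = 0
  rw [h2, h1, map_zero]

omit [Finite G] in
-- The support condition of the coefficient is alignment of the same x = r q⁻¹ p that governs its
-- sum.
theorem mk_c_inv_eq_iff (q : K) (i : G ⧸ centralizerOf a.pt) :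
    QuotientGroup.mk (s := K) (β.c a.1 i)⁻¹ =
      QuotientGroup.mk (s := K) ((q : G) * b.r * (q : G)⁻¹)⁻¹ ↔
    Aligned a b (b.r * (q : G)⁻¹ * β.p a.1 i) := by
  rw [QuotientGroup.eq, Aligned]
  have h1 : b.r⁻¹ * (b.r * (q : G)⁻¹ * β.p a.1 i * a.pt * (b.r * (q : G)⁻¹ * β.p a.1 i)⁻¹) =
      (q : G)⁻¹ * ((β.c a.1 i)⁻¹⁻¹ * ((q : G) * b.r * (q : G)⁻¹)⁻¹) * q := by
    group
  rw [h1, K.mul_mem_cancel_right q.2, K.mul_mem_cancel_left (K.inv_mem q.2)]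

omit [Finite G] in
-- The first condition of `Compatible` follows from the alignment required in the second.
theorem Aligned.nonempty {x : G} (hx : Aligned a b x) : (a.1.carrier ∩ b.T).Nonempty := by
  refine ⟨x * a.pt * x⁻¹, ?_, ?_⟩
  · rw [ConjClasses.mem_carrier_iff_mk_eq]
    conv_rhs => rw [← β.mk_r a.1]
    rw [eq_comm, ConjClasses.mk_eq_mk_iff_isConj, isConj_iff]
    exact ⟨x, rfl⟩
  · simpa using hx.mem_T K.one_mem (centralizerOf a.pt).one_mem

theorem exists_bulkCoeff_ne_zero_iff : (∃ (u v : a.Loc) (w : b.Loc × b.Loc),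
    bulkCoeff (expand K (boundaryFourier ribbonY b w.1 w.2)) ⟨a, u, v⟩ ≠ 0) ↔
      Compatible a b := by
  classical
  constructor
  · rintro ⟨u, v, w, h⟩
    rw [bulkCoeff_boundaryFourier] at h
    split_ifs at h with hc
    · have hal := (mk_c_inv_eq_iff _ _).mp hc
      refine ⟨hal.nonempty, _, hal, (finrank_ne_zero_iff_exists _).mp ?_⟩
      have hp := right_ne_zero_of_mul (right_ne_zero_of_mul h)
      obtain ⟨k₀, e₀, h0⟩ : ∃ (k₀ : stab K b.r) (e₀ : centralizerOf a.pt),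
          (b.q w.1.1 : G) * b.shift k₀ * (b.q w.2.1 : G)⁻¹ =
            β.p a.1 u.1 * e₀ * (β.p a.1 v.1)⁻¹ := by
        by_contra! hne
        refine hp (Finset.sum_eq_zero fun k _ => Finset.sum_eq_zero fun e _ => ?_)
        rw [if_neg (hne k e), mul_zero, mul_zero]
      let _ := Fintype.ofFinite
        (interStab β K a.1 b.r (b.r * (b.q w.1.1 : G)⁻¹ * β.p a.1 u.1))
      rw [pairSum_eq_sum h0] at hp
      rw [← exists_sum_mat_ne_zero_iff]
      by_contra! hz
      exact hp (Finset.sum_eq_zero fun m _ => Finset.sum_eq_zero fun n _ => by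
        rw [hz, mul_zero])
    · exact absurd rfl h
  · rintro ⟨-, x, hx, hσ⟩
    have hfr := (finrank_ne_zero_iff_exists x).mpr hσ
    let y : K ⧸ (stab K b.r⁻¹).subgroupOf K := QuotientGroup.mk 1
    -- The coset i is that of q r⁻¹ x, so that r q⁻¹ p_i equals x up to E(C).
    obtain ⟨e, he⟩ : ∃ e : centralizerOf a.pt,
        b.r * (b.q y : G)⁻¹ * β.p a.1 (QuotientGroup.mk (b.q y * b.r⁻¹ * x)) = x * e := by
      have h1 := QuotientGroup.eq.mp (β.mk_p a.1 (QuotientGroup.mk (b.q y * b.r⁻¹ * x))).symm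
      exact ⟨⟨_, h1⟩, by group⟩
    set i : G ⧸ centralizerOf a.pt := QuotientGroup.mk (b.q y * b.r⁻¹ * x)
    have hfr' := finrank_ne_zero_mul_centralizer e hfr
    have hal : Aligned a b (b.r * (b.q y : G)⁻¹ * β.p a.1 i) := by
      rw [he]
      simpa using hx.mul (stab K b.r).one_mem e.2
    rw [← he] at hfr'
    let _ := Fintype.ofFinite (interStab β K a.1 b.r (b.r * (b.q y : G)⁻¹ * β.p a.1 i))
    obtain ⟨j', j, m, m', hne⟩ := (exists_sum_mat_ne_zero_iff _ _).mpr hfr'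
    -- Equal cosets on both ends make k₀ = 1, e₀ = 1 a solution, so the coefficient is a nonzero
    -- multiple of one averaged entry.
    refine ⟨(i, j), (i, j'), ((y, m), (y, m')), ?_⟩
    rw [bulkCoeff_boundaryFourier, if_pos ((mk_c_inv_eq_iff _ _).mpr hal)]
    refine mul_ne_zero (div_ne_zero ?_ ?_) (mul_ne_zero (inv_ne_zero ?_) ?_)
    · exact Nat.cast_ne_zero.mpr b.irrep.dim_pos.ne'
    · exact Nat.cast_ne_zero.mpr Nat.card_pos.ne'
    · exact Nat.cast_ne_zero.mpr Nat.card_pos.ne'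
    · have h0 : (b.q y : G) * b.shift 1 * (b.q y : G)⁻¹ =
          β.p a.1 i * (1 : centralizerOf a.pt) * (β.p a.1 i)⁻¹ := by
        simp [BoundaryAnyon.shift]
      rw [pairSum_eq_sum h0]
      simpa [MatIrrep.mat_one, Matrix.one_apply] using hne

end RibbonCoefficients

end KitaevBoundary

end

open KitaevBoundary in
theorem mainTheorem3 {G : Type*} [Group G] [Finite G] (K : Subgroup G) (β : BulkChoice G)
    (b : BoundaryAnyon K) :
    -- the expansion of the boundary operators of type `(T, R)` in bulk operators
    (LinearIndependent ℂ (bulkFamily β (ribbonF (G := G))) ∧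
      ∃ c : b.Loc × b.Loc → (RibbonIndex β →₀ ℂ),
        (∀ w, expand K (boundaryFourier ribbonY b w.1 w.2) =
          Finsupp.linearCombination ℂ (bulkFamily β ribbonF) (c w)) ∧
        (∀ (plus : Bool) (w), boundaryFourier (triangleY plus) b w.1 w.2 =
          Finsupp.linearCombination ℂ (bulkFamily β (triangleF plus)) (c w)) ∧
        ∀ a : BulkAnyon β, (∃ (u v : a.Loc) (w : b.Loc × b.Loc), c w ⟨a, u, v⟩ ≠ 0) ↔
          Compatible a b) ∧
    -- the decomposition into bulk anyons and its multiplicities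
    Nonempty (Induced K b.Mod ≃ₗ[QuantumDouble G]
      ⨁ a : BulkAnyon β, (Fin (inverseMult b a) → a.Mod)) ∧
    (∀ a : BulkAnyon β, inverseMult b a = condensationMult a b ∧
      ∀ X : DoubleCosetReps a b, inverseMult b a = condensationSum X) ∧
    -- the total quantum dimension
    Finite (BulkAnyon β) ∧
    ∑ᶠ a : BulkAnyon β, (inverseMult b a : ℚ) * a.FPdim = Nat.card G * b.FPdim := by
  refine ⟨⟨linearIndependent_bulkFamily,
    fun w => bulkCoeff (expand K (boundaryFourier ribbonY b w.1 w.2)),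
    fun w => (linearCombination_bulkCoeff _).symm,
    fun plus w => linearCombination_bulkCoeff_triangle plus b w.1 w.2,
    fun a => exists_bulkCoeff_ne_zero_iff⟩, ⟨inducedDecomposition b⟩,
    fun a => ⟨inverseMult_eq_condensationMult b a, fun X =>
      (inverseMult_eq_condensationMult b a).trans (condensationMult_eq_condensationSum X)⟩,
    -- Finiteness of the set of excitations makes the `finsum` an honest sum and not the default
    -- value 0.
    inferInstance, sum_inverseMult_mul_FPdim b⟩
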